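/- Theorem 7.1. Fix $N\ge 1$, $V=\{1,\dots,N\}$, $V^*=\{0,1,\dots,N+1\}$, and let $\theta\ge 0$, or $\theta=-1/\alpha$ with $\alpha\in\{1,2,\dots\}$. Let $p:V\times V\to[0,\infty)$ be symmetric, let $c_\ell,c_r,\rho_\ell,\rho_r\ge 0$, and assume $\rho_\ell,\rho_r\le 1/|\theta|$ if $\theta<0$. Write $\Lambda_\theta=\{0,1,2,\dots\}$ if $\theta\ge0$, $\Lambda_\theta=\{0,1,\dots,1/|\theta|\}$ if $\theta<0$, and $\eta^{i,j}=\eta-\delta_i+\delta_j$. Let $\eta(t)$ be the continuous-time Markov chain on $\Omega_\theta=\Lambda_\theta^V$ with generator $$\begin{aligned}\mathcal L^{\rm res}_\theta f(\eta)=&\sum_{i,j\in V}p(i,j)\,\eta_i(1+\theta\eta_j)[f(\eta^{i,j})-f(\eta)]\\&+c_\ell\{\rho_\ell(1+\theta\eta_1)[f(\eta+\delta_1)-f(\eta)]+(1+\theta\rho_\ell)\eta_1[f(\eta-\delta_1)-f(\eta)]\}\\&+c_r\{\rho_r(1+\theta\eta_N)[f(\eta+\delta_N)-f(\eta)]+(1+\theta\rho_r)\eta_N[f(\eta-\delta_N)-f(\eta)]\}.\end{aligned}$$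 Let $\xi(t)$ be the dual chain on $\{\xi\in\mathbb N^{V^*}:\xi_i\in\Lambda_\theta \text{ for } i\in V\}$, where $\mathbb N=\{0,1,2,\dots\}$, with generator $$\begin{aligned}\mathcal L^{\rm Dual}_\theta f(\xi)=&\sum_{i,j\in V}p(i,j)\,\xi_i(1+\theta\xi_j)[f(\xi^{i,j})-f(\xi)]\\&+c_\ell\,\xi_1[f(\xi^{1,0})-f(\xi)]+c_r\,\xi_N[f(\xi^{N,N+1})-f(\xi)],\end{aligned}$$ and let $\mathbb P_\xi$ be its law started from $\xi$. Let $\mathbb P^{\rm irw}_\xi$ be the law of the configuration of $|\xi|=\sum_{i\in V^*}\xi_i$ independent random walkers on $V^*$ started from $\xi$, each of which jumps from $i\in V$ to $j\in V$ at rate $p(i,j)$, from $1$ to $0$ at rate $c_\ell$, from $N$ to $N+1$ at rate $c_r$, and is absorbed at $0$ and $N+1$. For both laws the probability of $\{\xi_0(\infty)=0\}$ (all particles are eventually absorbed at $N+1$) is $\lim_{t\to\infty}$ of the probability of $\{\xi_0(t)=0\}$. Let $$\widehat D_\theta(\xi,\eta)=\rho_\ell^{\xi_0}\Big(\prod_{i\in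 V}d_\theta(\xi_i,\eta_i)\Big)\rho_r^{\xi_{N+1}},\qquad d_\theta(k,m)=\frac{m!}{(m-k)!}\prod_{j=0}^{k-1}\frac1{1+\theta j},$$ with $d_\theta(k,m)=0$ for $k>m$ and $0^0=1$. Assume that the chains $\eta(t)$ with parameters $\theta$ and $0$ each have a unique stationary probability measure, denoted $\mu^{\rm st}_\theta$ and $\mu^{\rm st}_0$. Let $n\ge 2$ and let ${\bf x}=(x_1,\dots,x_n)\in V^n$ be such that $\phi({\bf x})=\sum_{i=1}^n\delta_{x_i}$ lies in $\Omega_\theta$ (viewed as a dual configuration with no particles at $0$ and $N+1$). Then the limits below exist for all sub-tuples of ${\bf x}$, $\widehat D_\theta(\phi({\bf x}),\cdot)$ and $\widehat D_0(\phi({\bf x}),\cdot)$ are integrable with respect to $\mu^{\rm st}_\theta$ and $\mu^{\rm st}_0$, and $$\int\widehat D_\theta(\phi({\bf x}),\eta)\,\mu^{\rm st}_\theta(d\eta)-\int\widehat D_0(\phi({\bf x}),\eta)\,\mu^{\rm st}_0(d\eta)=\sum_{\kappa=2}^n\gamma_\kappa({\bf x})\,(\rho_r-\rho_\ell)^\kappa\rho_\ell^{\,n-\kappa},$$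 $$\gamma_\kappa({\bf x})=\sum_{1\le i_1<\dots<i_\kappa\le n}\Big(\mathbb P_{\phi({\bf y})}(\xi_0(\infty)=0)-\mathbb P^{\rm irw}_{\phi({\bf y})}(\xi_0(\infty)=0)\Big),\qquad {\bf y}=(x_{i_1},\dots,x_{i_\kappa}).$$ -/

import Mathlib

open Filter Topology MeasureTheory
open scoped ENNReal

noncomputable section

namespace ReservoirChain

/-! ### Continuous-time Markov chains on a countable set

A chain on `S` is given by its jump rates `q i j`, `i ≠ j` (the diagonal values are ignored). -/

section MarkovChain

variable {S : Type*}

open scoped Classical in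
/-- The total rate `∑_{k ≠ j} q j k` at which the chain leaves the state `j`. -/
def exitRate (q : S → S → ℝ≥0∞) (j : S) : ℝ :=
  (∑' k, if k = j then 0 else q j k).toReal

open scoped Classical in
/-- `transBefore q m t i j` is the probability that the chain started from `i` is in `j` at time `t`
and has made fewer than `m` jumps up to time `t`: either there was no jump, or the last
jump took place at some time `s ≤ t`, from some `k ≠ j` to `j`, and the chain stayed in `j` during
the remaining time `t - s`. -/
def transBefore (q : S → S → ℝ≥0∞) : ℕ → ℝ → S → S → ℝ≥0∞
  | 0, _, _, _ => 0
  | m + 1, t, i, j =>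
      (if i = j then ENNReal.ofReal (Real.exp (-(exitRate q j * t))) else 0) +
        ∫⁻ s in Set.Ioc 0 t,
          (∑' k, if k = j then 0 else transBefore q m s i k * q k j) *
            ENNReal.ofReal (Real.exp (-(exitRate q j * (t - s))))

/-- The transition probability `ℙ_i (X(t) = j)` of the continuous-time Markov chain with jump rates
`q` (the minimal transition function of the `Q`-matrix). -/
def transProb (q : S → S → ℝ≥0∞) (t : ℝ) (i j : S) : ℝ≥0∞ :=
  ⨆ m, transBefore q m t i j

/-- `μ` is a stationary probability measure of the chain with jump rates `q`. -/
def IsStationary [MeasurableSpace S] (q : S → S → ℝ≥0∞) (μ : Measure S) : Prop :=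
  IsProbabilityMeasure μ ∧
    ∀ t : ℝ, 0 ≤ t → ∀ j : S, ∑' i, μ {i} * transProb q t i j = μ {j}

/-- `μ` is the unique stationary probability measure of the chain with jump rates `q`. -/
def IsUniqueStationary [MeasurableSpace S] (q : S → S → ℝ≥0∞) (μ : Measure S) : Prop :=
  IsStationary q μ ∧ ∀ ν : Measure S, IsStationary q ν → ν = μ

end MarkovChain

/-! ### Sites and configurations

The bulk `V = {1, …, N}` is `Fin N` (the site `x` being the element of value `x - 1`), and
`V* = {0, 1, …, N, N + 1}` is `Fin (N + 2)`, with `0` and `Fin.last (N + 1)` the absorbing sites. -/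

/-- The inclusion of `V = {1, …, N}` into `V* = {0, …, N + 1}`. -/
def bulk {N : ℕ} (i : Fin N) : Fin (N + 2) := i.succ.castSucc

/-- Admissible values of the interaction parameter: `θ ≥ 0`, or `θ = -1/α` with `α ∈ {1, 2, …}`. -/
def AdmissibleTheta (θ : ℝ) : Prop :=
  0 ≤ θ ∨ ∃ α : ℕ, 0 < α ∧ θ = -(1 / (α : ℝ))

/-- The allowed occupation numbers of a bulk site: all of `ℕ` if `θ ≥ 0`, and `{0, …, 1/|θ|}`
if `θ < 0`. -/
def AllowedOcc (θ : ℝ) (k : ℕ) : Prop := θ < 0 → (k : ℝ) ≤ 1 / |θ|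

/-- The state space of the system with reservoirs. -/
def Config (θ : ℝ) (N : ℕ) : Type := {η : Fin N → ℕ // ∀ i, AllowedOcc θ (η i)}

instance (θ : ℝ) (N : ℕ) : MeasurableSpace (Config θ N) := ⊤

/-- The state space of the dual system; there is no restriction at the two absorbing sites. -/
def DualConfig (θ : ℝ) (N : ℕ) : Type :=
  {ξ : Fin (N + 2) → ℕ // ∀ i : Fin N, AllowedOcc θ (ξ (bulk i))}

/-- `η ↦ η - δ_i + δ_j` (used only where `η i ≥ 1`, or with a vanishing rate). -/
def move {ι : Type*} [DecidableEq ι] (η : ι → ℕ) (i j : ι) : ι → ℕ :=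
  η - Pi.single i 1 + Pi.single j 1

/-! ### The dynamics -/

open scoped Classical in
/-- Jump rates of the system with reservoirs: each pair `i, j` of bulk sites has jumps
`η ↦ η - δ_i + δ_j` at rate `p(i,j) η_i (1 + θ η_j)`; the reservoir of strength `cl` and density
`ρl` acts on the site `1`, the one of strength `cr` and density `ρr` on the site `N`, each by
creating particles at rate `c ρ (1 + θ η_i)` and removing them at rate `c (1 + θ ρ) η_i`. -/
def resRate (θ : ℝ) {N : ℕ} (p : Fin N → Fin N → ℝ) (cl cr ρl ρr : ℝ)
    (η η' : Config θ N) : ℝ≥0∞ :=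
  (∑ i : Fin N, ∑ j : Fin N,
    if η'.1 = move η.1 i j then ENNReal.ofReal (p i j * η.1 i * (1 + θ * η.1 j)) else 0) +
  (∑ i : Fin N, if i.val = 0 then
      (if η'.1 = η.1 + Pi.single i 1 then ENNReal.ofReal (cl * (ρl * (1 + θ * η.1 i))) else 0) +
      (if η'.1 = η.1 - Pi.single i 1 then ENNReal.ofReal (cl * ((1 + θ * ρl) * η.1 i)) else 0)
    else 0) +
  (∑ i : Fin N, if i.val + 1 = N then
      (if η'.1 = η.1 + Pi.single i 1 then ENNReal.ofReal (cr * (ρr * (1 + θ * η.1 i))) else 0) +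
      (if η'.1 = η.1 - Pi.single i 1 then ENNReal.ofReal (cr * ((1 + θ * ρr) * η.1 i)) else 0)
    else 0)

open scoped Classical in
/-- Jump rates of the dual system: the same bulk jumps; in addition every particle at the site `1`
jumps to the absorbing site `0` at rate `cl`, and every particle at the site `N` jumps to the
absorbing site `N + 1` at rate `cr`. -/
def dualRate (θ : ℝ) {N : ℕ} (p : Fin N → Fin N → ℝ) (cl cr : ℝ)
    (ξ ξ' : DualConfig θ N) : ℝ≥0∞ :=
  (∑ i : Fin N, ∑ j : Fin N,
    if ξ'.1 = move ξ.1 (bulk i) (bulk j) then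
      ENNReal.ofReal (p i j * ξ.1 (bulk i) * (1 + θ * ξ.1 (bulk j))) else 0) +
  (∑ i : Fin N, if i.val = 0 ∧ ξ'.1 = move ξ.1 (bulk i) 0 then
      ENNReal.ofReal (cl * ξ.1 (bulk i)) else 0) +
  (∑ i : Fin N, if i.val + 1 = N ∧ ξ'.1 = move ξ.1 (bulk i) (Fin.last (N + 1)) then
      ENNReal.ofReal (cr * ξ.1 (bulk i)) else 0)

open scoped Classical in
/-- Jump rates of the associated random walk on `V*`, that is, of a single dual particle. -/
def walkRate {N : ℕ} (p : Fin N → Fin N → ℝ) (cl cr : ℝ) (u v : Fin (N + 2)) : ℝ≥0∞ :=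
  (∑ i : Fin N, ∑ j : Fin N, if u = bulk i ∧ v = bulk j then ENNReal.ofReal (p i j) else 0) +
  (∑ i : Fin N, if i.val = 0 ∧ u = bulk i ∧ v = 0 then ENNReal.ofReal cl else 0) +
  (∑ i : Fin N, if i.val + 1 = N ∧ u = bulk i ∧ v = Fin.last (N + 1) then
      ENNReal.ofReal cr else 0)

/-! ### Particle positions -/

/-- The configuration `φ(u) = ∑_l δ_{u_l}` of the particle positions `u`. -/
def occupation {ι : Type*} [DecidableEq ι] {m : ℕ} (u : Fin m → ι) : ι → ℕ :=
  ∑ l, Pi.single (u l) 1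

/-- The set `V_n` of `n`-tuples of bulk sites whose configuration is allowed. -/
def Positions (θ : ℝ) (N n : ℕ) : Type :=
  {x : Fin n → Fin N // ∀ i, AllowedOcc θ (occupation x i)}

theorem occupation_apply {ι : Type*} [DecidableEq ι] {m : ℕ} (u : Fin m → ι) (a : ι) :
    occupation u a = (Finset.univ.filter fun l => u l = a).card := by
  rw [Finset.card_filter]
  simp only [occupation, Finset.sum_apply, Pi.single_apply]
  exact Finset.sum_congr rfl fun l _ => if_congr eq_comm rfl rfl

theorem occupation_comp_le {ι : Type*} [DecidableEq ι] {m n : ℕ} (u : Fin n → ι)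
    (e : Fin m ↪o Fin n) (a : ι) : occupation (u ∘ e) a ≤ occupation u a := by
  rw [occupation_apply, occupation_apply]
  refine Finset.card_le_card_of_injOn e ?_ e.injective.injOn
  intro l hl
  simpa using hl

theorem bulk_injective {N : ℕ} : Function.Injective (bulk : Fin N → Fin (N + 2)) :=
  (Fin.castSucc_injective _).comp (Fin.succ_injective _)

theorem occupation_bulk {N m : ℕ} (x : Fin m → Fin N) (i : Fin N) :
    occupation (fun l => bulk (x l)) (bulk i) = occupation x i := by
  simp [occupation_apply, bulk_injective.eq_iff]

/-- The sub-tuple `(x_{i_1}, …, x_{i_κ})`, for `i_1 < … < i_κ`. -/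
def Positions.sub {θ : ℝ} {N n κ : ℕ} (x : Positions θ N n) (e : Fin κ ↪o Fin n) :
    Positions θ N κ :=
  ⟨x.1 ∘ e, fun i hθ =>
    le_trans (Nat.cast_le.2 (occupation_comp_le x.1 e i)) (x.2 i hθ)⟩

/-- The same particle positions, as positions in `V*`. -/
def Positions.sites {θ : ℝ} {N n : ℕ} (x : Positions θ N n) : Fin n → Fin (N + 2) :=
  fun l => bulk (x.1 l)

/-- The dual configuration `φ(x)`. -/
def Positions.config {θ : ℝ} {N n : ℕ} (x : Positions θ N n) : DualConfig θ N :=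
  ⟨occupation x.sites, fun i => by
    unfold Positions.sites
    rw [occupation_bulk]
    exact x.2 i⟩

/-! ### The duality function -/

/-- The single-site duality function `d_θ(k, m) = m! / (m - k)! / ∏_{j<k} (1 + θ j)`, equal to `0`
for `k > m`. The denominator is `1` if `θ = 0`, `θ^k` times the rising factorial of
`1/θ` if `θ > 0`, and `|θ|^k` times the falling factorial of `1/|θ|` if `θ < 0`. -/
def singleDuality (θ : ℝ) (k m : ℕ) : ℝ :=
  (m.descFactorial k : ℝ) / ∏ j ∈ Finset.range k, (1 + θ * (j : ℝ))

/-- The duality function `ρ_ℓ^{ξ_0} · ∏_{i ∈ V} d_θ(ξ_i, η_i) · ρ_r^{ξ_{N+1}}`. -/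
def dualityFun (θ ρl ρr : ℝ) {N : ℕ} (ξ : Fin (N + 2) → ℕ) (η : Fin N → ℕ) : ℝ :=
  ρl ^ ξ 0 * (∏ i : Fin N, singleDuality θ (ξ (bulk i)) (η i)) * ρr ^ ξ (Fin.last (N + 1))

/-! ### Absorption probabilities -/

open scoped Classical in
/-- The probability `ℙ_ξ (ξ_0(t) = 0)` for the dual system. -/
def dualNoLeft (θ : ℝ) {N : ℕ} (p : Fin N → Fin N → ℝ) (cl cr : ℝ) (ξ : DualConfig θ N)
    (t : ℝ) : ℝ :=
  (∑' ξ' : DualConfig θ N,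
    if ξ'.1 0 = 0 then transProb (dualRate θ p cl cr) t ξ ξ' else 0).toReal

/-- The probability `ℙ^irw_{φ(u)} (ξ_0(t) = 0)` for independent copies of the associated
random walk, started from the sites `u_1, …, u_m`. -/
def irwNoLeft {N : ℕ} (p : Fin N → Fin N → ℝ) (cl cr : ℝ) {m : ℕ} (u : Fin m → Fin (N + 2))
    (t : ℝ) : ℝ :=
  (∑ v : Fin m → Fin (N + 2),
    if occupation v 0 = 0 then ∏ l, transProb (walkRate p cl cr) t (u l) (v l) else 0).toReal

/-- `ℙ_ξ (ξ_0(∞) = 0)`, the limit of `ℙ_ξ (ξ_0(t) = 0)` as `t → ∞`. -/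
def dualNoLeftLimit (θ : ℝ) {N : ℕ} (p : Fin N → Fin N → ℝ) (cl cr : ℝ)
    (ξ : DualConfig θ N) : ℝ :=
  limUnder atTop (dualNoLeft θ p cl cr ξ)

/-- `ℙ^irw_{φ(u)} (ξ_0(∞) = 0)`, the limit of `ℙ^irw_{φ(u)} (ξ_0(t) = 0)` as `t → ∞`. -/
def irwNoLeftLimit {N : ℕ} (p : Fin N → Fin N → ℝ) (cl cr : ℝ) {m : ℕ}
    (u : Fin m → Fin (N + 2)) : ℝ :=
  limUnder atTop (irwNoLeft p cl cr u)

/-- The coefficient `γ_κ(x)`: the sum, over the sub-tuples `y` of `x` of length `κ`, of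
`ℙ_{φ(y)} (ξ_0(∞) = 0) - ℙ^irw_{φ(y)} (ξ_0(∞) = 0)`. -/
def gammaCoeff {θ : ℝ} {N n : ℕ} (p : Fin N → Fin N → ℝ) (cl cr : ℝ) (κ : ℕ)
    (x : Positions θ N n) : ℝ :=
  ∑ e : Fin κ ↪o Fin n,
    (dualNoLeftLimit θ p cl cr (x.sub e).config - irwNoLeftLimit p cl cr (x.sub e).sites)

end ReservoirChain

end

open ReservoirChain

noncomputable section

namespace ReservoirChain

section ForwardEquation

theorem ofReal_exp_add_lintegral {c s t : ℝ} (hc : 0 ≤ c) (hst : s ≤ t) :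
    ENNReal.ofReal (Real.exp (-(c * (t - s)))) +
      ENNReal.ofReal c * ∫⁻ u in Set.Ioc s t, ENNReal.ofReal (Real.exp (-(c * (u - s)))) = 1 := by
  rw [← lintegral_const_mul _ (by fun_prop)]
  simp_rw [← ENNReal.ofReal_mul hc]
  have hcont : Continuous fun u : ℝ => c * Real.exp (-(c * (u - s))) := by fun_prop
  rw [← ofReal_integral_eq_lintegral_ofReal hcont.integrableOn_Ioc
    (Eventually.of_forall fun u => by positivity),
    ← intervalIntegral.integral_of_le hst,
    intervalIntegral.integral_eq_sub_of_hasDerivAt (f := fun u => -Real.exp (-(c * (u - s))))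
      (fun u _ => ?_) (hcont.intervalIntegrable _ _)]
  · have h1 : Real.exp (-(c * (t - s))) ≤ 1 :=
      Real.exp_le_one_iff.2 (by have := mul_nonneg hc (sub_nonneg.2 hst); linarith)
    rw [← ENNReal.ofReal_add (Real.exp_pos _).le (by simpa using h1)]
    simp
  · have h : HasDerivAt (fun u : ℝ => -(c * (u - s))) (-(c * 1)) u :=
      (((hasDerivAt_id u).sub_const s).const_mul c).neg
    have h2 := h.exp.neg
    rw [show -(Real.exp (-(c * (u - s))) * -(c * 1)) = c * Real.exp (-(c * (u - s))) by ring] at h2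
    exact h2

theorem lintegral_exp_convolution {G : ℝ → ℝ≥0∞} (hG : Measurable G) {c : ℝ} (hc : 0 ≤ c)
    (t : ℝ) :
    (∫⁻ s in Set.Ioc 0 t, G s * ENNReal.ofReal (Real.exp (-(c * (t - s))))) +
      ENNReal.ofReal c * ∫⁻ u in Set.Ioc 0 t, ∫⁻ s in Set.Ioc 0 u,
        G s * ENNReal.ofReal (Real.exp (-(c * (u - s)))) = ∫⁻ s in Set.Ioc 0 t, G s := by
  have hswap : (∫⁻ u in Set.Ioc 0 t, ∫⁻ s in Set.Ioc 0 u,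
        G s * ENNReal.ofReal (Real.exp (-(c * (u - s))))) =
      ∫⁻ s in Set.Ioc 0 t, G s *
        ∫⁻ u in Set.Ioc s t, ENNReal.ofReal (Real.exp (-(c * (u - s)))) := by
    have hA : MeasurableSet {z : ℝ × ℝ | 0 < z.2 ∧ z.2 ≤ z.1 ∧ z.1 ≤ t} :=
      ((measurableSet_lt measurable_const measurable_snd).inter
        ((measurableSet_le measurable_snd measurable_fst).inter
          (measurableSet_le measurable_fst measurable_const)))
    have hF : Measurable fun z : ℝ × ℝ =>
        Set.indicator {z : ℝ × ℝ | 0 < z.2 ∧ z.2 ≤ z.1 ∧ z.1 ≤ t}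
          (fun z => G z.2 * ENNReal.ofReal (Real.exp (-(c * (z.1 - z.2))))) z :=
      ((hG.comp measurable_snd).mul (by fun_prop)).indicator hA
    have h := lintegral_lintegral_swap (μ := (volume : Measure ℝ)) (ν := (volume : Measure ℝ))
      (f := fun u s => Set.indicator {z : ℝ × ℝ | 0 < z.2 ∧ z.2 ≤ z.1 ∧ z.1 ≤ t}
          (fun z => G z.2 * ENNReal.ofReal (Real.exp (-(c * (z.1 - z.2))))) (u, s))
      hF.aemeasurable
    convert h using 1
    · rw [← lintegral_indicator measurableSet_Ioc]
      refine lintegral_congr fun u => ?_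
      by_cases hu : u ∈ Set.Ioc 0 t
      · rw [Set.indicator_of_mem hu, ← lintegral_indicator measurableSet_Ioc]
        refine lintegral_congr fun s => ?_
        by_cases hs : s ∈ Set.Ioc 0 u
        · rw [Set.indicator_of_mem hs, Set.indicator_of_mem]
          exact ⟨hs.1, hs.2, hu.2⟩
        · rw [Set.indicator_of_notMem hs, Set.indicator_of_notMem]
          exact fun h => hs ⟨h.1, h.2.1⟩
      · rw [Set.indicator_of_notMem hu]
        symm
        rw [← lintegral_zero (μ := (volume : Measure ℝ))]
        refine lintegral_congr fun s => ?_
        exact Set.indicator_of_notMem (fun h => hu ⟨h.1.trans_le h.2.1, h.2.2⟩) _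
    · rw [← lintegral_indicator measurableSet_Ioc]
      refine lintegral_congr fun s => ?_
      by_cases hs : s ∈ Set.Ioc 0 t
      · rw [Set.indicator_of_mem hs, restrict_Ioc_eq_restrict_Icc,
          ← lintegral_const_mul _ (by fun_prop), ← lintegral_indicator measurableSet_Icc]
        refine lintegral_congr fun u => ?_
        by_cases hu : u ∈ Set.Icc s t
        · rw [Set.indicator_of_mem hu, Set.indicator_of_mem]
          exact ⟨hs.1, hu.1, hu.2⟩
        · rw [Set.indicator_of_notMem hu, Set.indicator_of_notMem]
          exact fun h => hu ⟨h.2.1, h.2.2⟩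
      · rw [Set.indicator_of_notMem hs]
        symm
        rw [← lintegral_zero (μ := (volume : Measure ℝ))]
        refine lintegral_congr fun u => ?_
        exact Set.indicator_of_notMem (fun h => hs ⟨h.1, h.2.1.trans h.2.2⟩) _
  have hmeas : Measurable fun s => ∫⁻ u in Set.Ioc s t,
      ENNReal.ofReal (Real.exp (-(c * (u - s)))) := by
    have : (fun s => ∫⁻ u in Set.Ioc s t, ENNReal.ofReal (Real.exp (-(c * (u - s))))) =
        fun s => ENNReal.ofReal (Real.exp (c * s)) *
          ∫⁻ u in Set.Ioc s t, ENNReal.ofReal (Real.exp (-(c * u))) := by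
      ext s
      rw [← lintegral_const_mul _ (by fun_prop)]
      refine lintegral_congr fun u => ?_
      rw [← ENNReal.ofReal_mul (Real.exp_pos _).le, ← Real.exp_add]
      ring_nf
    rw [this]
    refine Measurable.mul (by fun_prop) (Antitone.measurable fun a b hab => ?_)
    exact lintegral_mono_set (Set.Ioc_subset_Ioc_left hab)
  rw [hswap, ← lintegral_const_mul _ (by fun_prop), ← lintegral_add_left (by fun_prop)]
  refine setLIntegral_congr_fun measurableSet_Ioc fun s hs => ?_
  rw [mul_left_comm, ← mul_add, ofReal_exp_add_lintegral hc hs.2, mul_one]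

theorem measurable_exp_convolution (G : ℝ → ℝ≥0∞) (hG : Measurable G) (c : ℝ) :
    Measurable fun t => ∫⁻ s in Set.Ioc 0 t,
      G s * ENNReal.ofReal (Real.exp (-(c * (t - s)))) := by
  have : (fun t => ∫⁻ s in Set.Ioc 0 t, G s * ENNReal.ofReal (Real.exp (-(c * (t - s))))) =
      fun t => ENNReal.ofReal (Real.exp (-(c * t))) *
        ∫⁻ s in Set.Ioc 0 t, G s * ENNReal.ofReal (Real.exp (c * s)) := by
    ext t
    rw [← lintegral_const_mul _ (by fun_prop)]
    refine lintegral_congr fun u => ?_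
    rw [mul_left_comm, ← ENNReal.ofReal_mul (Real.exp_pos _).le, ← Real.exp_add]
    ring_nf
  rw [this]
  refine Measurable.mul (by fun_prop) (Monotone.measurable fun a b hab => ?_)
  exact lintegral_mono_set (Set.Ioc_subset_Ioc_right hab)

variable {S : Type*}

open scoped Classical in
/-- The total rate `∑_{k ≠ j} a_k q_{kj}` at which mass distributed as `a` flows into `j`. -/
def inflow (q : S → S → ℝ≥0∞) (a : S → ℝ≥0∞) (j : S) : ℝ≥0∞ :=
  ∑' k, if k = j then 0 else a k * q k j

open scoped Classical in
/-- The off-diagonal part `∑_{j ≠ k} q_{kj} f_j` of the generator. -/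
def jumpSum (q : S → S → ℝ≥0∞) (f : S → ℝ≥0∞) (k : S) : ℝ≥0∞ :=
  ∑' j, if j = k then 0 else q k j * f j

theorem exitRate_nonneg (q : S → S → ℝ≥0∞) (j : S) : 0 ≤ exitRate q j := ENNReal.toReal_nonneg

theorem inflow_mono (q : S → S → ℝ≥0∞) {a b : S → ℝ≥0∞} (h : ∀ k, a k ≤ b k) (j : S) :
    inflow q a j ≤ inflow q b j := by
  refine ENNReal.tsum_le_tsum fun k => ?_
  split_ifs
  · rfl
  · gcongr; exact h k

open scoped Classical in
theorem transBefore_succ (q : S → S → ℝ≥0∞) (m : ℕ) (t : ℝ) (i j : S) :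
    transBefore q (m + 1) t i j =
      (if i = j then ENNReal.ofReal (Real.exp (-(exitRate q j * t))) else 0) +
        ∫⁻ s in Set.Ioc 0 t, inflow q (transBefore q m s i) j *
            ENNReal.ofReal (Real.exp (-(exitRate q j * (t - s)))) := rfl

theorem transBefore_le_succ (q : S → S → ℝ≥0∞) (m : ℕ) (t : ℝ) (i j : S) :
    transBefore q m t i j ≤ transBefore q (m + 1) t i j := by
  induction m generalizing t j with
  | zero => exact zero_le
  | succ m ih =>
    rw [transBefore_succ, transBefore_succ]
    gcongr with s
    exact inflow_mono q (fun k => ih s k) j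

theorem transBefore_mono (q : S → S → ℝ≥0∞) (t : ℝ) (i j : S) :
    Monotone fun m => transBefore q m t i j :=
  monotone_nat_of_le_succ fun m => transBefore_le_succ q m t i j

theorem tsum_iSup_of_monotone [Countable S] {f : ℕ → S → ℝ≥0∞} (hf : ∀ i, Monotone fun m => f m i) :
    ∑' i, ⨆ m, f m i = ⨆ m, ∑' i, f m i := by
  let _ : MeasurableSpace S := ⊤
  simp_rw [← lintegral_count]
  exact lintegral_iSup (fun m => measurable_from_top) (fun a b hab i => hf i hab)

variable [Countable S]

open scoped Classical in
theorem measurable_inflow (q : S → S → ℝ≥0∞) {a : ℝ → S → ℝ≥0∞}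
    (ha : ∀ k, Measurable fun s => a s k) (j : S) : Measurable fun s => inflow q (a s) j := by
  refine Measurable.tsum fun k => ?_
  by_cases h : k = j
  · simp [h]
  · simpa [h] using (ha k).mul_const _

theorem measurable_transBefore (q : S → S → ℝ≥0∞) (m : ℕ) (i j : S) :
    Measurable fun t => transBefore q m t i j := by
  induction m generalizing j with
  | zero => exact measurable_const
  | succ m ih =>
    simp_rw [transBefore_succ]
    refine Measurable.add ?_ (measurable_exp_convolution _ (measurable_inflow q ih j) _)
    split_ifs <;> fun_prop

theorem measurable_transProb (q : S → S → ℝ≥0∞) (i j : S) :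
    Measurable fun t => transProb q t i j :=
  Measurable.iSup fun m => measurable_transBefore q m i j

open scoped Classical in
/-- The integrated forward equation for the truncated transition function. -/
theorem transBefore_forward (q : S → S → ℝ≥0∞) (m : ℕ) {t : ℝ} (ht : 0 ≤ t) (i j : S) :
    transBefore q (m + 1) t i j +
      ENNReal.ofReal (exitRate q j) * ∫⁻ s in Set.Ioc 0 t, transBefore q (m + 1) s i j =
    (if i = j then 1 else 0) + ∫⁻ s in Set.Ioc 0 t, inflow q (transBefore q m s i) j := by
  have hm := measurable_inflow q (fun k => measurable_transBefore q m i k) j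
  rw [← lintegral_exp_convolution hm (exitRate_nonneg q j) t]
  simp_rw [transBefore_succ]
  rw [lintegral_add_right _ (measurable_exp_convolution _ hm _), mul_add, add_add_add_comm]
  congr 1
  split_ifs
  · have := ofReal_exp_add_lintegral (exitRate_nonneg q j) ht
    simpa using this
  · simp

theorem inflow_iSup (q : S → S → ℝ≥0∞) {a : ℕ → S → ℝ≥0∞} (ha : ∀ k, Monotone fun m => a m k)
    (j : S) : inflow q (fun k => ⨆ m, a m k) j = ⨆ m, inflow q (a m) j := by
  unfold inflow
  rw [← tsum_iSup_of_monotone]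
  · refine tsum_congr fun k => ?_
    split_ifs
    · simp
    · rw [ENNReal.iSup_mul]
  · intro k m n hmn
    simp only
    split_ifs
    · rfl
    · gcongr; exact ha k hmn

open scoped Classical in
/-- The integrated forward equation. -/
theorem transProb_forward (q : S → S → ℝ≥0∞) {t : ℝ} (ht : 0 ≤ t) (i j : S) :
    transProb q t i j +
      ENNReal.ofReal (exitRate q j) * ∫⁻ s in Set.Ioc 0 t, transProb q s i j =
    (if i = j then 1 else 0) + ∫⁻ s in Set.Ioc 0 t, inflow q (transProb q s i) j := by
  have hmono := transBefore_mono q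
  have e1 : ∀ s j, transProb q s i j = ⨆ m, transBefore q (m + 1) s i j := fun s j =>
    ((hmono s i j).iSup_nat_add 1).symm
  have e2 : ∀ s, inflow q (transProb q s i) j = ⨆ m, inflow q (transBefore q m s i) j := fun s =>
    inflow_iSup q (fun k => hmono s i k) j
  have hm2 : ∀ j, Monotone fun (m : ℕ) (s : ℝ) => transBefore q (m + 1) s i j :=
    fun j m n hmn s => hmono s i j (by simpa using hmn)
  have hm3 : Monotone fun (m : ℕ) (s : ℝ) => inflow q (transBefore q m s i) j :=
    fun m n hmn s => inflow_mono q (fun k => hmono s i k hmn) j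
  simp_rw [e2]
  rw [lintegral_iSup (fun m => measurable_inflow q (fun k => measurable_transBefore q m i k) j) hm3]
  simp_rw [e1]
  rw [lintegral_iSup (fun m => measurable_transBefore q (m + 1) i j) (hm2 j), ENNReal.mul_iSup,
    ENNReal.iSup_add_iSup_of_monotone (fun m n h => hm2 j h t)
      (fun m n h => by gcongr; exact hm2 j h _), ENNReal.add_iSup]
  exact iSup_congr fun m => transBefore_forward q m ht i j

/-- A stationary measure satisfies the balance equations. -/
theorem IsStationary.balance [MeasurableSpace S] {q : S → S → ℝ≥0∞} {μ : Measure S}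
    (h : IsStationary q μ) (j : S) :
    inflow q (fun k => μ {k}) j = ENNReal.ofReal (exitRate q j) * μ {j} := by
  classical
  obtain ⟨hp, h⟩ := h
  have key := fun i => congrArg (μ {i} * ·) (transProb_forward q zero_le_one i j)
  have key2 := tsum_congr (L := .unconditional S) key
  simp only [mul_add] at key2
  rw [ENNReal.tsum_add, ENNReal.tsum_add, h 1 zero_le_one j] at key2
  have e1 : ∑' i, μ {i} * (if i = j then (1 : ℝ≥0∞) else 0) = μ {j} := by
    rw [tsum_eq_single j (fun i hi => by simp [hi])]; simp
  have e2 : ∑' i, μ {i} * (ENNReal.ofReal (exitRate q j) *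
      ∫⁻ s in Set.Ioc 0 (1 : ℝ), transProb q s i j) = ENNReal.ofReal (exitRate q j) * μ {j} := by
    simp_rw [mul_left_comm (μ _)]
    rw [ENNReal.tsum_mul_left]
    congr 1
    simp_rw [← lintegral_const_mul _ (measurable_transProb q _ j)]
    rw [← lintegral_tsum fun i => ((measurable_transProb q i j).const_mul _).aemeasurable,
      setLIntegral_congr_fun measurableSet_Ioc fun s hs => h s hs.1.le j]
    simp
  have e3 : ∑' i, μ {i} * (∫⁻ s in Set.Ioc 0 (1 : ℝ), inflow q (transProb q s i) j) =
      inflow q (fun k => μ {k}) j := by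
    have hm := fun i => measurable_inflow q (fun k => measurable_transProb q i k) j
    simp_rw [← lintegral_const_mul _ (hm _)]
    rw [← lintegral_tsum fun i => ((hm i).const_mul _).aemeasurable,
      setLIntegral_congr_fun (g := fun _ => inflow q (fun k => μ {k}) j) measurableSet_Ioc
        fun s hs => ?_]
    · simp
    · simp only [inflow, ← ENNReal.tsum_mul_left]
      rw [ENNReal.tsum_comm]
      refine tsum_congr fun k => ?_
      split_ifs
      · simp
      · rw [← h s hs.1.le k, ← ENNReal.tsum_mul_right]
        exact tsum_congr fun i => (mul_assoc _ _ _).symm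
  rw [e1, e2, e3] at key2
  exact ((ENNReal.add_right_inj (measure_ne_top μ _)).1 key2).symm

theorem lintegral_eq_tsum_singleton [MeasurableSpace S] [DiscreteMeasurableSpace S] (μ : Measure S)
    (f : S → ℝ≥0∞) : ∫⁻ i, f i ∂μ = ∑' i, μ {i} * f i := by
  rw [lintegral_countable']
  exact tsum_congr fun i => mul_comm _ _

end ForwardEquation

section JumpRepresentation

variable {S I : Type*} [Fintype I]

open scoped Classical in
/-- The jump rates `q` are given by finitely many kinds of jumps: the jump of kind `a` takes the
state `s` to `τ a s`, at rate `r a s`. -/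
structure IsJumpRep (q : S → S → ℝ≥0∞) (r : I → S → ℝ) (τ : I → S → S) : Prop where
  nonneg : ∀ a s, 0 ≤ r a s
  rate_eq : ∀ s s', s' ≠ s → q s s' = ∑ a, if s' = τ a s then ENNReal.ofReal (r a s) else 0

/-- The generator of the chain with jumps `s ↦ τ a s` at rate `r a s`. -/
def gen (r : I → S → ℝ) (τ : I → S → S) (f : S → ℝ) (s : S) : ℝ :=
  ∑ a, r a s * (f (τ a s) - f s)

variable {q : S → S → ℝ≥0∞} {r : I → S → ℝ} {τ : I → S → S}

open scoped Classical in
theorem IsJumpRep.jumpSum_eq_sum (h : IsJumpRep q r τ) (f : S → ℝ≥0∞) (s : S) :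
    jumpSum q f s = ∑ a, if τ a s = s then 0 else ENNReal.ofReal (r a s) * f (τ a s) := by
  have e : ∀ j, (if j = s then 0 else q s j * f j) =
      ∑ a, if j = τ a s then (if τ a s = s then 0 else ENNReal.ofReal (r a s) * f (τ a s)) else 0 := by
    intro j
    split_ifs with hj
    · subst hj
      refine (Finset.sum_eq_zero fun a _ => ?_).symm
      split_ifs with h1 h2
      · rfl
      · exact absurd h1.symm h2
      · rfl
    · rw [h.rate_eq s j hj, Finset.sum_mul]
      refine Finset.sum_congr rfl fun a _ => ?_
      split_ifs with h1 h2
      · exact absurd (h1.trans h2) hj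
      · rw [h1]
      · simp
  rw [jumpSum, tsum_congr e, Summable.tsum_finsetSum fun a _ => ENNReal.summable]
  exact Finset.sum_congr rfl fun a _ => tsum_ite_eq (τ a s) _

theorem jumpSum_one_toReal (q : S → S → ℝ≥0∞) (s : S) :
    (jumpSum q (fun _ => 1) s).toReal = exitRate q s := by
  simp [jumpSum, exitRate]

open scoped Classical in
theorem IsJumpRep.exitRate_eq (h : IsJumpRep q r τ) (s : S) :
    exitRate q s = ∑ a, if τ a s = s then 0 else r a s := by
  rw [← jumpSum_one_toReal, h.jumpSum_eq_sum, ENNReal.toReal_sum]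
  · refine Finset.sum_congr rfl fun a _ => ?_
    split_ifs
    · simp
    · simp [h.nonneg a s]
  · intro a _
    split_ifs <;> simp

theorem IsJumpRep.jumpSum_one (h : IsJumpRep q r τ) (s : S) :
    jumpSum q (fun _ => 1) s = ENNReal.ofReal (exitRate q s) := by
  classical
  rw [← jumpSum_one_toReal, ENNReal.ofReal_toReal]
  rw [h.jumpSum_eq_sum]
  refine ENNReal.sum_ne_top.2 fun a _ => ?_
  split_ifs <;> simp

theorem IsJumpRep.jumpSum_ne_top (h : IsJumpRep q r τ) {f : S → ℝ≥0∞} (hf : ∀ s, f s ≠ ∞) (s : S) :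
    jumpSum q f s ≠ ∞ := by
  classical
  rw [h.jumpSum_eq_sum]
  refine ENNReal.sum_ne_top.2 fun a _ => ?_
  split_ifs
  · simp
  · exact ENNReal.mul_ne_top ENNReal.ofReal_ne_top (hf _)

theorem IsJumpRep.jumpSum_eq_zero (h : IsJumpRep q r τ) {s : S} (hs : exitRate q s = 0)
    (f : S → ℝ≥0∞) : jumpSum q f s = 0 := by
  classical
  have h1 := h.jumpSum_one s
  rw [hs, ENNReal.ofReal_zero, jumpSum, ENNReal.tsum_eq_zero] at h1
  refine ENNReal.tsum_eq_zero.2 fun j => ?_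
  have := h1 j
  split_ifs with hj
  · rfl
  · rw [if_neg hj, mul_one] at this
    rw [this, zero_mul]

theorem IsJumpRep.exitRate_mul_add_gen_nonneg (h : IsJumpRep q r τ) {f : S → ℝ}
    (hf : ∀ s, 0 ≤ f s) (s : S) : 0 ≤ exitRate q s * f s + gen r τ f s := by
  classical
  rw [h.exitRate_eq, gen, Finset.sum_mul, ← Finset.sum_add_distrib]
  refine Finset.sum_nonneg fun a _ => ?_
  split_ifs with h1
  · simp [h1]
  · have := mul_nonneg (h.nonneg a s) (hf (τ a s))
    linarith

theorem IsJumpRep.jumpSum_ofReal (h : IsJumpRep q r τ) {f : S → ℝ} (hf : ∀ s, 0 ≤ f s) (s : S) :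
    jumpSum q (fun j => ENNReal.ofReal (f j)) s =
      ENNReal.ofReal (exitRate q s * f s + gen r τ f s) := by
  classical
  have e : exitRate q s * f s + gen r τ f s =
      ∑ a, if τ a s = s then 0 else r a s * f (τ a s) := by
    rw [h.exitRate_eq, gen, Finset.sum_mul, ← Finset.sum_add_distrib]
    refine Finset.sum_congr rfl fun a _ => ?_
    split_ifs with h1
    · rw [h1]; ring
    · ring
  rw [h.jumpSum_eq_sum, e, ENNReal.ofReal_sum_of_nonneg]
  · refine Finset.sum_congr rfl fun a _ => ?_
    split_ifs
    · simp
    · rw [ENNReal.ofReal_mul (h.nonneg a s)]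
  · intro a _
    split_ifs
    · rfl
    · exact mul_nonneg (h.nonneg a s) (hf _)

end JumpRepresentation

section Weighted

theorem ofReal_exp_add_lintegral_reflect {c t : ℝ} (hc : 0 ≤ c) (ht : 0 ≤ t) :
    ENNReal.ofReal (Real.exp (-(c * t))) +
      ENNReal.ofReal c * ∫⁻ u in Set.Ioc 0 t, ENNReal.ofReal (Real.exp (-(c * (t - u)))) = 1 := by
  rw [← lintegral_const_mul _ (by fun_prop)]
  simp_rw [← ENNReal.ofReal_mul hc]
  have hcont : Continuous fun u : ℝ => c * Real.exp (-(c * (t - u))) := by fun_prop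
  rw [← ofReal_integral_eq_lintegral_ofReal hcont.integrableOn_Ioc
    (Eventually.of_forall fun u => by positivity),
    ← intervalIntegral.integral_of_le ht,
    intervalIntegral.integral_eq_sub_of_hasDerivAt (f := fun u => Real.exp (-(c * (t - u))))
      (fun u _ => ?_) (hcont.intervalIntegrable _ _)]
  · have h1 : Real.exp (-(c * t)) ≤ 1 := Real.exp_le_one_iff.2 (by have := mul_nonneg hc ht; linarith)
    rw [← ENNReal.ofReal_add (Real.exp_pos _).le (by simpa using h1)]
    simp
  · have h : HasDerivAt (fun u : ℝ => -(c * (t - u))) (-(c * -1)) u :=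
      (((hasDerivAt_id u).const_sub t).const_mul c).neg
    have h2 := h.exp
    rw [show Real.exp (-(c * (t - u))) * -(c * -1) = c * Real.exp (-(c * (t - u))) by ring] at h2
    exact h2

variable {S : Type*}

theorem tsum_mul_inflow (q : S → S → ℝ≥0∞) (f a : S → ℝ≥0∞) :
    ∑' j, f j * inflow q a j = ∑' k, a k * jumpSum q f k := by
  simp only [inflow, jumpSum, ← ENNReal.tsum_mul_left]
  rw [ENNReal.tsum_comm]
  refine tsum_congr fun k => tsum_congr fun j => ?_
  by_cases h : k = j
  · simp [h]
  · rw [if_neg h, if_neg (Ne.symm h)]; ring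

variable [Countable S]

theorem tsum_mul_forward (q : S → S → ℝ≥0∞) (f : S → ℝ≥0∞) {t : ℝ} (i : S)
    {a b : ℝ → S → ℝ≥0∞} (ha : ∀ k, Measurable fun s => a s k) (hb : ∀ k, Measurable fun s => b s k)
    (h : ∀ j, b t j + ENNReal.ofReal (exitRate q j) * ∫⁻ s in Set.Ioc 0 t, b s j =
      (open scoped Classical in if i = j then 1 else 0) + ∫⁻ s in Set.Ioc 0 t, inflow q (a s) j) :
    (∑' j, f j * b t j) +
      ∫⁻ s in Set.Ioc 0 t, ∑' j, f j * ENNReal.ofReal (exitRate q j) * b s j =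
    f i + ∫⁻ s in Set.Ioc 0 t, ∑' k, a s k * jumpSum q f k := by
  classical
  have key2 := tsum_congr (L := .unconditional S) fun j => congrArg (f j * ·) (h j)
  simp only [mul_add] at key2
  rw [ENNReal.tsum_add, ENNReal.tsum_add] at key2
  have e1 : ∑' j, f j * (if i = j then (1 : ℝ≥0∞) else 0) = f i := by
    rw [tsum_eq_single i (fun j hj => by simp [hj.symm])]; simp
  rw [e1] at key2
  rw [lintegral_tsum fun j => ((hb j).const_mul _).aemeasurable]
  simp_rw [← tsum_mul_inflow]
  rw [lintegral_tsum fun j => ((measurable_inflow q ha j).const_mul _).aemeasurable]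
  simp_rw [lintegral_const_mul _ (hb _), lintegral_const_mul _ (measurable_inflow q ha _),
    mul_assoc]
  exact key2

theorem tsum_mul_transBefore (q : S → S → ℝ≥0∞) (f : S → ℝ≥0∞) (m : ℕ) {t : ℝ} (ht : 0 ≤ t)
    (i : S) : (∑' j, f j * transBefore q (m + 1) t i j) +
      ∫⁻ s in Set.Ioc 0 t, ∑' j, f j * ENNReal.ofReal (exitRate q j) * transBefore q (m + 1) s i j =
    f i + ∫⁻ s in Set.Ioc 0 t, ∑' k, transBefore q m s i k * jumpSum q f k :=
  tsum_mul_forward q f i (measurable_transBefore q m i) (measurable_transBefore q (m + 1) i)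
    (transBefore_forward q m ht i)

theorem tsum_mul_transProb (q : S → S → ℝ≥0∞) (f : S → ℝ≥0∞) {t : ℝ} (ht : 0 ≤ t) (i : S) :
    (∑' j, f j * transProb q t i j) +
      ∫⁻ s in Set.Ioc 0 t, ∑' j, f j * ENNReal.ofReal (exitRate q j) * transProb q s i j =
    f i + ∫⁻ s in Set.Ioc 0 t, ∑' k, transProb q s i k * jumpSum q f k :=
  tsum_mul_forward q f i (measurable_transProb q i) (measurable_transProb q i)
    (transProb_forward q ht i)

variable {I : Type*} [Fintype I] {q : S → S → ℝ≥0∞} {r : I → S → ℝ} {τ : I → S → S}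

theorem IsJumpRep.lintegral_transBefore_ne_top (h : IsJumpRep q r τ) (m : ℕ) {f : S → ℝ≥0∞}
    (hf : ∀ s, f s ≠ ∞) {t : ℝ} (ht : 0 ≤ t) (i : S) :
    ∫⁻ s in Set.Ioc 0 t, ∑' j, f j * ENNReal.ofReal (exitRate q j) * transBefore q m s i j ≠ ∞ := by
  induction m generalizing f with
  | zero => simp [transBefore]
  | succ m ih =>
    refine ne_top_of_le_ne_top ?_ (le_of_le_of_eq le_add_self (tsum_mul_transBefore q f m ht i))
    refine ENNReal.add_ne_top.2 ⟨hf i, ?_⟩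
    have e : ∀ k, jumpSum q f k =
        (if exitRate q k = 0 then 0 else jumpSum q f k / ENNReal.ofReal (exitRate q k)) *
          ENNReal.ofReal (exitRate q k) := by
      intro k
      split_ifs with hk
      · rw [h.jumpSum_eq_zero hk, zero_mul]
      · rw [ENNReal.div_mul_cancel _ ENNReal.ofReal_ne_top]
        have := (exitRate_nonneg q k).lt_of_ne' hk
        simpa using this
    have hg : ∀ k, (if exitRate q k = 0 then 0 else
        jumpSum q f k / ENNReal.ofReal (exitRate q k)) ≠ ∞ := by
      intro k
      split_ifs with hk
      · simp
      · refine ENNReal.div_ne_top (h.jumpSum_ne_top hf k) ?_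
        have := (exitRate_nonneg q k).lt_of_ne' hk
        simpa using this
    have := ih hg
    simp_rw [← e, mul_comm (jumpSum q f _)] at this
    exact this

theorem IsJumpRep.tsum_mul_transBefore_le (h : IsJumpRep q r τ) {f : S → ℝ≥0∞}
    (hf : ∀ s, f s ≠ ∞) {B : ℝ≥0∞}
    (hB : ∀ k, jumpSum q f k ≤ ENNReal.ofReal (exitRate q k) * f k + B) (m : ℕ) {t : ℝ}
    (ht : 0 ≤ t) (i : S) :
    ∑' j, f j * transBefore q m t i j ≤
      f i + B * ∫⁻ s in Set.Ioc 0 t, ∑' k, transBefore q m s i k := by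
  cases m with
  | zero => simp [transBefore]
  | succ m =>
    have key := tsum_mul_transBefore q f m ht i
    have hfin := h.lintegral_transBefore_ne_top (m + 1) hf ht i
    refine (ENNReal.add_le_add_iff_right hfin).1 (key.le.trans ?_)
    rw [add_assoc]
    gcongr
    rw [← lintegral_const_mul _ (Measurable.tsum fun k => measurable_transBefore q _ i k),
      ← lintegral_add_left
      ((Measurable.tsum fun k => measurable_transBefore q _ i k).const_mul B)]
    refine lintegral_mono fun s => ?_
    simp only
    rw [← ENNReal.tsum_mul_left, ← ENNReal.tsum_add]
    refine ENNReal.tsum_le_tsum fun k => ?_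
    calc _ ≤ transBefore q (m + 1) s i k * (ENNReal.ofReal (exitRate q k) * f k + B) :=
          mul_le_mul' (transBefore_le_succ q m s i k) (hB k)
      _ = _ := by ring

theorem IsJumpRep.tsum_transBefore_le_one (h : IsJumpRep q r τ) (m : ℕ) {t : ℝ}
    (ht : 0 ≤ t) (i : S) : ∑' j, transBefore q m t i j ≤ 1 := by
  have := h.tsum_mul_transBefore_le (f := fun _ => 1) (B := 0) (by simp)
    (fun k => by simp [h.jumpSum_one k]) m ht i
  simpa using this

theorem tsum_mul_transProb_eq_iSup (q : S → S → ℝ≥0∞) (f : S → ℝ≥0∞) (t : ℝ) (i : S) :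
    ∑' j, f j * transProb q t i j = ⨆ m, ∑' j, f j * transBefore q m t i j := by
  simp_rw [transProb, ENNReal.mul_iSup]
  exact tsum_iSup_of_monotone fun j m n hmn => mul_le_mul_right (transBefore_mono q t i j hmn) _

theorem IsJumpRep.tsum_transProb_le_one (h : IsJumpRep q r τ) {t : ℝ}
    (ht : 0 ≤ t) (i : S) : ∑' j, transProb q t i j ≤ 1 := by
  have := tsum_mul_transProb_eq_iSup q (fun _ => 1) t i
  simp only [one_mul] at this
  rw [this]
  exact iSup_le fun m => h.tsum_transBefore_le_one m ht i

theorem IsJumpRep.tsum_mul_transProb_le (h : IsJumpRep q r τ) {f : S → ℝ≥0∞}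
    (hf : ∀ s, f s ≠ ∞) {B : ℝ≥0∞}
    (hB : ∀ k, jumpSum q f k ≤ ENNReal.ofReal (exitRate q k) * f k + B) {t : ℝ}
    (ht : 0 ≤ t) (i : S) :
    ∑' j, f j * transProb q t i j ≤ f i + B * ENNReal.ofReal t := by
  rw [tsum_mul_transProb_eq_iSup]
  refine iSup_le fun m => (h.tsum_mul_transBefore_le hf hB m ht i).trans ?_
  gcongr
  calc _ ≤ ∫⁻ s in Set.Ioc 0 t, 1 :=
        setLIntegral_mono measurable_const fun s hs => h.tsum_transBefore_le_one m hs.1.le i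
    _ = _ := by simp

/-- The total mass is conserved as soon as the expected number of jumps is finite. -/
theorem IsJumpRep.tsum_transProb_eq_one (h : IsJumpRep q r τ) {t : ℝ} (ht : 0 ≤ t) {i : S}
    (hfin : ∫⁻ s in Set.Ioc 0 t, ∑' k, transProb q s i k * ENNReal.ofReal (exitRate q k) ≠ ∞) :
    ∑' j, transProb q t i j = 1 := by
  have key := tsum_mul_transProb q (fun _ => 1) ht i
  simp only [one_mul, h.jumpSum_one] at key
  simp_rw [mul_comm (ENNReal.ofReal _)] at key
  exact (ENNReal.add_left_inj hfin).1 key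

/-- A Lyapunov criterion for the conservation of mass. -/
theorem IsJumpRep.tsum_transProb_eq_one_of_lyapunov (h : IsJumpRep q r τ) {f : S → ℝ}
    (hf : ∀ s, 0 ≤ f s) {A B : ℝ} (hA : ∀ s, exitRate q s ≤ A * f s) (hB : ∀ s, gen r τ f s ≤ B)
    {t : ℝ} (ht : 0 ≤ t) (i : S) : ∑' j, transProb q t i j = 1 := by
  refine h.tsum_transProb_eq_one ht ?_
  have hbound : ∀ s ∈ Set.Ioc 0 t, ∑' k, transProb q s i k * ENNReal.ofReal (exitRate q k) ≤
      ENNReal.ofReal A * (ENNReal.ofReal (f i) + ENNReal.ofReal B * ENNReal.ofReal t) := by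
    intro s hs
    have h1 := h.tsum_mul_transProb_le (f := fun j => ENNReal.ofReal (f j))
      (B := ENNReal.ofReal B) (by simp) (fun k => ?_) hs.1.le i
    · calc _ ≤ ∑' k, ENNReal.ofReal A * (ENNReal.ofReal (f k) * transProb q s i k) := by
            refine ENNReal.tsum_le_tsum fun k => ?_
            rw [mul_comm, ← mul_assoc, ← ENNReal.ofReal_mul' (hf k)]
            gcongr
            exact hA k
        _ ≤ _ := by
            rw [ENNReal.tsum_mul_left]
            gcongr
            refine h1.trans ?_
            gcongr
            exact hs.2
    · rw [h.jumpSum_ofReal hf, ← ENNReal.ofReal_mul (exitRate_nonneg q k)]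
      refine le_trans ?_ ENNReal.ofReal_add_le
      gcongr
      exact hB k
  refine ne_top_of_le_ne_top ?_ (setLIntegral_mono measurable_const hbound)
  simp [ENNReal.mul_eq_top]

end Weighted

section Balance

variable {S : Type*} [Countable S] [MeasurableSpace S] [DiscreteMeasurableSpace S]
  {q : S → S → ℝ≥0∞} {μ : Measure S}

theorem tsum_singleton_eq_one (μ : Measure S) [IsProbabilityMeasure μ] : ∑' i, μ {i} = 1 := by
  have := lintegral_eq_tsum_singleton μ fun _ => 1
  simpa using this.symm

theorem tsum_transBefore_le_of_balance
    (hbal : ∀ j, inflow q (fun k => μ {k}) j = ENNReal.ofReal (exitRate q j) * μ {j})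
    (m : ℕ) {t : ℝ} (ht : 0 ≤ t) (j : S) : ∑' i, μ {i} * transBefore q m t i j ≤ μ {j} := by
  classical
  induction m generalizing t j with
  | zero => simp [transBefore]
  | succ m ih =>
    have hm := fun i => measurable_inflow q (fun k => measurable_transBefore q m i k) j
    simp_rw [transBefore_succ, mul_add]
    rw [ENNReal.tsum_add]
    have e1 : ∑' i, μ {i} *
        (if i = j then ENNReal.ofReal (Real.exp (-(exitRate q j * t))) else 0) =
        μ {j} * ENNReal.ofReal (Real.exp (-(exitRate q j * t))) := by
      rw [tsum_eq_single j (fun i hi => by simp [hi])]; simp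
    have e2 : ∑' i, μ {i} * ∫⁻ s in Set.Ioc 0 t, inflow q (transBefore q m s i) j *
        ENNReal.ofReal (Real.exp (-(exitRate q j * (t - s)))) ≤
        μ {j} * ∫⁻ s in Set.Ioc 0 t, ENNReal.ofReal (exitRate q j) *
          ENNReal.ofReal (Real.exp (-(exitRate q j * (t - s)))) := by
      have hm' : ∀ i, Measurable fun s => inflow q (transBefore q m s i) j *
          ENNReal.ofReal (Real.exp (-(exitRate q j * (t - s)))) := fun i =>
        (hm i).mul (by fun_prop)
      simp_rw [← lintegral_const_mul _ (hm' _)]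
      rw [← lintegral_tsum fun i => ((hm' i).const_mul _).aemeasurable,
        ← lintegral_const_mul _ (by fun_prop)]
      refine setLIntegral_mono (by fun_prop) fun s hs => ?_
      simp only [← mul_assoc]
      rw [ENNReal.tsum_mul_right]
      gcongr
      rw [mul_comm, ← hbal j]
      simp only [inflow, ← ENNReal.tsum_mul_left]
      rw [ENNReal.tsum_comm]
      refine ENNReal.tsum_le_tsum fun k => ?_
      split_ifs
      · simp
      · simp only [← mul_assoc]
        rw [ENNReal.tsum_mul_right]
        gcongr
        exact ih hs.1.le k
    rw [e1]
    refine (add_le_add le_rfl e2).trans ?_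
    rw [← mul_add]
    refine mul_le_of_le_one_right' (le_of_eq ?_)
    rw [lintegral_const_mul _ (by fun_prop)]
    exact ofReal_exp_add_lintegral_reflect (exitRate_nonneg q j) ht

/-- A probability measure which satisfies the balance equations is stationary, provided that the
chain does not explode. -/
theorem isStationary_of_balance [IsProbabilityMeasure μ]
    (hbal : ∀ j, inflow q (fun k => μ {k}) j = ENNReal.ofReal (exitRate q j) * μ {j})
    (hmass : ∀ t, 0 ≤ t → ∀ i, ∑' j, transProb q t i j = 1) : IsStationary q μ := by
  refine ⟨inferInstance, fun t ht => ?_⟩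
  have hle : ∀ j, ∑' i, μ {i} * transProb q t i j ≤ μ {j} := by
    intro j
    simp_rw [transProb, ENNReal.mul_iSup]
    rw [tsum_iSup_of_monotone (f := fun m i => μ {i} * transBefore q m t i j)
      fun i m n hmn => mul_le_mul_right (transBefore_mono q t i j hmn) _]
    exact iSup_le fun m => tsum_transBefore_le_of_balance hbal m ht j
  have hsum : ∑' j, ∑' i, μ {i} * transProb q t i j = ∑' j, μ {j} := by
    rw [ENNReal.tsum_comm]
    simp_rw [ENNReal.tsum_mul_left, hmass t ht, mul_one]
  intro j
  by_contra hne
  have hlt := (hle j).lt_of_ne hne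
  refine absurd hsum (ENNReal.tsum_lt_tsum ?_ hle hlt).ne
  rw [hsum, tsum_singleton_eq_one]
  simp

theorem lintegral_jumpSum_of_balance
    (hbal : ∀ j, inflow q (fun k => μ {k}) j = ENNReal.ofReal (exitRate q j) * μ {j})
    (f : S → ℝ≥0∞) :
    ∫⁻ k, jumpSum q f k ∂μ = ∫⁻ k, ENNReal.ofReal (exitRate q k) * f k ∂μ := by
  rw [lintegral_eq_tsum_singleton, lintegral_eq_tsum_singleton, ← tsum_mul_inflow]
  refine tsum_congr fun j => ?_
  rw [hbal]; ring

variable {I : Type*} [Fintype I] {r : I → S → ℝ} {τ : I → S → S}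

theorem integrable_of_lintegral_ofReal_ne_top {f : S → ℝ} (hf : ∀ s, 0 ≤ f s)
    (h : ∫⁻ s, ENNReal.ofReal (f s) ∂μ ≠ ∞) : Integrable f μ :=
  ⟨Measurable.of_discrete.aestronglyMeasurable, by
    rw [hasFiniteIntegral_iff_ofReal (Eventually.of_forall hf)]; exact h.lt_top⟩

/-- Stationarity in generator form. -/
theorem IsJumpRep.integral_gen_eq_zero (h : IsJumpRep q r τ)
    (hbal : ∀ j, inflow q (fun k => μ {k}) j = ENNReal.ofReal (exitRate q j) * μ {j})
    {f : S → ℝ} (hf : ∀ s, 0 ≤ f s) (hint : Integrable (fun s => exitRate q s * f s) μ) :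
    Integrable (gen r τ f) μ ∧ ∫ s, gen r τ f s ∂μ = 0 := by
  have key := lintegral_jumpSum_of_balance hbal fun s => ENNReal.ofReal (f s)
  simp_rw [h.jumpSum_ofReal hf, ← ENNReal.ofReal_mul (exitRate_nonneg q _)] at key
  have hn1 : ∀ s, 0 ≤ exitRate q s * f s := fun s => mul_nonneg (exitRate_nonneg q s) (hf s)
  have hn2 : ∀ s, 0 ≤ exitRate q s * f s + gen r τ f s := h.exitRate_mul_add_gen_nonneg hf
  have hfin : ∫⁻ s, ENNReal.ofReal (exitRate q s * f s) ∂μ ≠ ∞ := by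
    have := hint.2
    rw [hasFiniteIntegral_iff_ofReal (Eventually.of_forall hn1)] at this
    exact this.ne
  have hint2 : Integrable (fun s => exitRate q s * f s + gen r τ f s) μ :=
    integrable_of_lintegral_ofReal_ne_top hn2 (by rw [key]; exact hfin)
  have hgen : Integrable (gen r τ f) μ := by
    exact (hint2.sub hint).congr (Eventually.of_forall fun s => add_sub_cancel_left _ _)
  refine ⟨hgen, ?_⟩
  have e : ∫ s, (exitRate q s * f s + gen r τ f s) ∂μ = ∫ s, exitRate q s * f s ∂μ := by
    rw [integral_eq_lintegral_of_nonneg_ae (Eventually.of_forall hn2)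
      Measurable.of_discrete.aestronglyMeasurable,
      integral_eq_lintegral_of_nonneg_ae (Eventually.of_forall hn1)
      Measurable.of_discrete.aestronglyMeasurable, key]
  rw [integral_add hint hgen] at e
  linarith

/-- Lyapunov bound for stationary measures: if `L H ≤ C - g` and `H` has finite sublevel sets, then
`g` is integrable. -/
theorem IsJumpRep.integrable_of_lyapunov [IsProbabilityMeasure μ] (h : IsJumpRep q r τ)
    (hbal : ∀ j, inflow q (fun k => μ {k}) j = ENNReal.ofReal (exitRate q j) * μ {j})
    {H g : S → ℝ} {C : ℝ} (hg : ∀ s, 0 ≤ g s)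
    (hgen : ∀ s, gen r τ H s ≤ C - g s) (hH : ∀ K : ℕ, {s | H s < K}.Finite) :
    Integrable g μ := by
  classical
  refine integrable_of_lintegral_ofReal_ne_top hg
    (ne_top_of_le_ne_top (ENNReal.ofReal_ne_top (r := C)) ?_)
  have hK : ∀ K : ℕ, ∫⁻ s, {s | H s < K}.indicator (fun s => ENNReal.ofReal (g s)) s ∂μ ≤
      ENNReal.ofReal C := by
    intro K
    set F : S → ℝ := fun s => max (K - H s) 0 with hF
    have hF0 : ∀ s, 0 ≤ F s := fun s => le_max_right _ _
    have key := lintegral_jumpSum_of_balance hbal fun s => ENNReal.ofReal (F s)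
    simp_rw [h.jumpSum_ofReal hF0] at key
    have hfin : ∫⁻ s, ENNReal.ofReal (exitRate q s) * ENNReal.ofReal (F s) ∂μ ≠ ∞ := by
      rw [lintegral_eq_tsum_singleton, tsum_eq_sum (s := (hH K).toFinset)]
      · refine ENNReal.sum_ne_top.2 fun s _ => ?_
        exact ENNReal.mul_ne_top (measure_ne_top _ _)
          (ENNReal.mul_ne_top ENNReal.ofReal_ne_top ENNReal.ofReal_ne_top)
      · intro s hs
        have : F s = 0 := by simpa [hF] using hs
        simp [this]
    have hpt : ∀ s, {s | H s < K}.indicator (fun s => ENNReal.ofReal (g s)) s +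
        ENNReal.ofReal (exitRate q s) * ENNReal.ofReal (F s) ≤
        ENNReal.ofReal C + ENNReal.ofReal (exitRate q s * F s + gen r τ F s) := by
      intro s
      by_cases hs : H s < K
      · rw [Set.indicator_of_mem (by exact hs), ← ENNReal.ofReal_mul (exitRate_nonneg q s),
          ← ENNReal.ofReal_add (hg s) (mul_nonneg (exitRate_nonneg q s) (hF0 s))]
        refine le_trans (ENNReal.ofReal_le_ofReal ?_) ENNReal.ofReal_add_le
        have h1 : -gen r τ H s ≤ gen r τ F s := by
          rw [gen, gen, ← Finset.sum_neg_distrib]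
          refine Finset.sum_le_sum fun a _ => ?_
          have h2 : F s = K - H s := max_eq_left (by linarith)
          have h3 : K - H (τ a s) ≤ F (τ a s) := le_max_left _ _
          rw [← mul_neg]
          refine mul_le_mul_of_nonneg_left ?_ (h.nonneg a s)
          linarith
        linarith [hgen s]
      · rw [Set.indicator_of_notMem (by exact hs)]
        have : F s = 0 := max_eq_right (by linarith [not_lt.1 hs])
        simp [this]
    have := lintegral_mono hpt (μ := μ)
    rw [lintegral_add_left Measurable.of_discrete, lintegral_add_left Measurable.of_discrete,
      key] at this
    have h5 := (ENNReal.add_le_add_iff_right hfin).1 this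
    simpa using h5
  have hmono : Monotone fun (K : ℕ) (s : S) =>
      {s | H s < K}.indicator (fun s => ENNReal.ofReal (g s)) s := by
    intro K L hKL s
    refine Set.indicator_le_indicator_of_subset (fun s hs => ?_) (fun _ => zero_le) s
    exact lt_of_lt_of_le (show H s < K from hs) (Nat.cast_le.2 hKL)
  have hsup : ∀ s, ENNReal.ofReal (g s) =
      ⨆ K : ℕ, {s | H s < K}.indicator (fun s => ENNReal.ofReal (g s)) s := by
    intro s
    refine le_antisymm ?_ (iSup_le fun K => Set.indicator_le_self _ _ s)
    obtain ⟨K, hK⟩ := exists_nat_gt (H s)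
    refine le_iSup_of_le K ?_
    rw [Set.indicator_of_mem (by exact hK)]
  rw [lintegral_congr hsup]
  rw [lintegral_iSup (fun K => Measurable.of_discrete) hmono]
  exact iSup_le hK

end Balance

section Dirichlet

variable {S I : Type*} [Fintype I] {r : I → S → ℝ} {τ : I → S → S}

open scoped Classical in
/-- The operator of the Dirichlet problem: the identity on `Z`, minus the generator off `Z`. -/
def dirichletOp (r : I → S → ℝ) (τ : I → S → S) (Z : Set S) (g : S → ℝ) (s : S) : ℝ :=
  if s ∈ Z then g s else -gen r τ g s

/-- On the finite set `A`, which is closed under the jumps, the chain is absorbed in `Z`: from every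
other state there is a possible jump along which `Φ` decreases. -/
structure IsAbsorbed (r : I → S → ℝ) (τ : I → S → S) (A : Finset S) (Z : Set S) (Φ : S → ℕ) :
    Prop where
  nonneg : ∀ a s, 0 ≤ r a s
  mem : ∀ a, ∀ s ∈ A, τ a s ∈ A
  descent : ∀ s ∈ A, s ∉ Z → ∃ a, 0 < r a s ∧ Φ (τ a s) < Φ s
  stay : ∀ s ∈ A, s ∈ Z → ∀ a, r a s = 0 ∨ τ a s = s

variable {A : Finset S} {Z : Set S} {Φ : S → ℕ}

theorem gen_congr {f g : S → ℝ} {s : S} (hs : f s = g s)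
    (h : ∀ a, r a s = 0 ∨ f (τ a s) = g (τ a s)) : gen r τ f s = gen r τ g s := by
  refine Finset.sum_congr rfl fun a _ => ?_
  rcases h a with h | h
  · simp [h]
  · rw [h, hs]

theorem gen_add (f g : S → ℝ) (s : S) :
    gen r τ (fun x => f x + g x) s = gen r τ f s + gen r τ g s := by
  simp only [gen, ← Finset.sum_add_distrib]
  exact Finset.sum_congr rfl fun a _ => by ring

theorem gen_const_mul (c : ℝ) (g : S → ℝ) (s : S) :
    gen r τ (fun x => c * g x) s = c * gen r τ g s := by
  simp only [gen, Finset.mul_sum]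
  exact Finset.sum_congr rfl fun a _ => by ring

theorem gen_sum {κ : Type*} (B : Finset κ) (g : κ → S → ℝ) (s : S) :
    gen r τ (fun x => ∑ b ∈ B, g b x) s = ∑ b ∈ B, gen r τ (g b) s := by
  simp only [gen]
  rw [Finset.sum_comm]
  refine Finset.sum_congr rfl fun a _ => ?_
  rw [← Finset.sum_sub_distrib, Finset.mul_sum]

theorem gen_sub (f g : S → ℝ) (s : S) :
    gen r τ (fun x => f x - g x) s = gen r τ f s - gen r τ g s := by
  simp only [gen, ← Finset.sum_sub_distrib]
  exact Finset.sum_congr rfl fun a _ => by ring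

theorem dirichletOp_add (f g : S → ℝ) (s : S) :
    dirichletOp r τ Z (fun x => f x + g x) s = dirichletOp r τ Z f s + dirichletOp r τ Z g s := by
  unfold dirichletOp
  split_ifs
  · rfl
  · rw [gen_add]; ring

theorem dirichletOp_const_mul (c : ℝ) (g : S → ℝ) (s : S) :
    dirichletOp r τ Z (fun x => c * g x) s = c * dirichletOp r τ Z g s := by
  unfold dirichletOp
  split_ifs
  · rfl
  · rw [gen_const_mul]; ring

theorem dirichletOp_sub (f g : S → ℝ) (s : S) :
    dirichletOp r τ Z (fun x => f x - g x) s = dirichletOp r τ Z f s - dirichletOp r τ Z g s := by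
  unfold dirichletOp
  split_ifs
  · rfl
  · rw [gen_sub]; ring

theorem dirichletOp_sum {κ : Type*} (B : Finset κ) (g : κ → S → ℝ) (s : S) :
    dirichletOp r τ Z (fun x => ∑ b ∈ B, g b x) s = ∑ b ∈ B, dirichletOp r τ Z (g b) s := by
  unfold dirichletOp
  split_ifs
  · rfl
  · rw [gen_sum, Finset.sum_neg_distrib]

namespace IsAbsorbed

theorem dirichletOp_congr (h : IsAbsorbed r τ A Z Φ) {f g : S → ℝ} (hfg : ∀ s ∈ A, f s = g s)
    {s : S} (hs : s ∈ A) : dirichletOp r τ Z f s = dirichletOp r τ Z g s := by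
  unfold dirichletOp
  split_ifs
  · exact hfg s hs
  · rw [gen_congr (hfg s hs) fun a => Or.inr (hfg _ (h.mem a s hs))]

/-- The maximum principle. -/
theorem nonneg_of_dirichletOp_nonneg (h : IsAbsorbed r τ A Z Φ) {g : S → ℝ}
    (hg : ∀ s ∈ A, 0 ≤ dirichletOp r τ Z g s) : ∀ s ∈ A, 0 ≤ g s := by
  classical
  by_contra! hcon
  obtain ⟨s, hs, hneg⟩ := hcon
  obtain ⟨s0, hs0, hmin⟩ := A.exists_min_image g ⟨s, hs⟩
  have hneg0 : g s0 < 0 := (hmin s hs).trans_lt hneg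
  obtain ⟨s1, hs1, hmin1⟩ := (A.filter fun s => g s = g s0).exists_min_image Φ
    ⟨s0, by simp [hs0]⟩
  rw [Finset.mem_filter] at hs1
  obtain ⟨hs1A, hs1e⟩ := hs1
  have hd := hg s1 hs1A
  unfold dirichletOp at hd
  split_ifs at hd with hZ
  · linarith
  · obtain ⟨a, ha, hΦ⟩ := h.descent s1 hs1A hZ
    have hterm : ∀ b ∈ Finset.univ, 0 ≤ r b s1 * (g (τ b s1) - g s1) := fun b _ =>
      mul_nonneg (h.nonneg b s1) (by linarith [hmin _ (h.mem b s1 hs1A)])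
    have hz : gen r τ g s1 = 0 := le_antisymm (by linarith) (Finset.sum_nonneg hterm)
    have hz' := (Finset.sum_eq_zero_iff_of_nonneg hterm).1 hz a (Finset.mem_univ a)
    have he : g (τ a s1) = g s0 := by
      rcases mul_eq_zero.1 hz' with h0 | h0 <;> linarith
    have := hmin1 (τ a s1) (by simp [he, h.mem a s1 hs1A])
    omega

theorem eq_of_dirichletOp_eq (h : IsAbsorbed r τ A Z Φ) {f g : S → ℝ}
    (hfg : ∀ s ∈ A, dirichletOp r τ Z f s = dirichletOp r τ Z g s) : ∀ s ∈ A, f s = g s := by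
  intro s hs
  have h1 := h.nonneg_of_dirichletOp_nonneg (g := fun x => f x - g x)
    (fun s hs => by rw [dirichletOp_sub, hfg s hs, sub_self]) s hs
  have h2 := h.nonneg_of_dirichletOp_nonneg (g := fun x => g x - f x)
    (fun s hs => by rw [dirichletOp_sub, hfg s hs, sub_self]) s hs
  linarith

/-- The Dirichlet problem is solvable. -/
theorem exists_dirichletOp_eq (h : IsAbsorbed r τ A Z Φ) (b : S → ℝ) :
    ∃ g : S → ℝ, (∀ s ∈ A, dirichletOp r τ Z g s = b s) ∧ ∀ s ∉ A, g s = 0 := by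
  classical
  let ext : (A → ℝ) → S → ℝ := fun f s => if hs : s ∈ A then f ⟨s, hs⟩ else 0
  have hext : ∀ (f : A → ℝ) (s : A), ext f s = f s := fun f s => dif_pos s.2
  let T : (A → ℝ) →ₗ[ℝ] (A → ℝ) :=
    { toFun := fun f s => dirichletOp r τ Z (ext f) s
      map_add' := fun f g => by
        funext s
        rw [Pi.add_apply, ← dirichletOp_add]
        congr 1
        funext x
        by_cases hx : x ∈ A <;> simp [ext, hx]
      map_smul' := fun c f => by
        funext s
        rw [RingHom.id_apply, Pi.smul_apply, smul_eq_mul, ← dirichletOp_const_mul]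
        congr 1
        funext x
        by_cases hx : x ∈ A <;> simp [ext, hx] }
  have hinj : Function.Injective T := by
    intro f g hfg
    funext s
    rw [← hext f, ← hext g]
    exact h.eq_of_dirichletOp_eq (fun x hx => congrFun hfg ⟨x, hx⟩) s s.2
  obtain ⟨f, hf⟩ := (LinearMap.injective_iff_surjective.1 hinj) fun s => b s
  exact ⟨ext f, fun s hs => congrFun hf ⟨s, hs⟩, fun s hs => dif_neg hs⟩

/-- The expected occupation measure of the chain, as a functional. -/
theorem exists_pos_functional (h : IsAbsorbed r τ A Z Φ) :
    ∃ ω : S → ℝ, (∀ s ∈ A, 0 < ω s) ∧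
      ∀ g : S → ℝ, ∑ s ∈ A, ω s * dirichletOp r τ Z g s = ∑ s ∈ A, g s := by
  classical
  choose G hG _ using fun x : S => h.exists_dirichletOp_eq (fun s => if s = x then 1 else 0)
  have hGpos : ∀ x, ∀ s ∈ A, 0 ≤ G x s := fun x => h.nonneg_of_dirichletOp_nonneg fun s hs => by
    rw [hG x s hs]; split_ifs <;> norm_num
  refine ⟨fun x => ∑ s ∈ A, G x s, fun x hx => ?_, fun g => ?_⟩
  · refine (Finset.sum_nonneg (hGpos x)).lt_of_ne' fun h0 => ?_
    have hz := (Finset.sum_eq_zero_iff_of_nonneg (hGpos x)).1 h0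
    have h1 := h.dirichletOp_congr (f := G x) (g := fun s => 0 * G x s)
      (fun s hs => by simp [hz s hs]) hx
    rw [dirichletOp_const_mul, hG x x hx] at h1
    simp at h1
  · have key := h.eq_of_dirichletOp_eq (f := g)
      (g := fun s => ∑ x ∈ A, dirichletOp r τ Z g x * G x s) (fun s hs => by
        rw [dirichletOp_sum]
        simp_rw [dirichletOp_const_mul, hG _ s hs]
        simp [hs])
    rw [Finset.sum_congr rfl key, Finset.sum_comm]
    refine Finset.sum_congr rfl fun x _ => ?_
    rw [Finset.sum_mul]
    exact Finset.sum_congr rfl fun s _ => mul_comm _ _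

end IsAbsorbed

end Dirichlet

section Absorption

variable {S I : Type*} [Fintype I] [Countable S] {q : S → S → ℝ≥0∞} {r : I → S → ℝ}
  {τ : I → S → S} {A : Finset S} {Z : Set S} {Φ : S → ℕ}

theorem IsJumpRep.transProb_eq_zero_of_notMem (hq : IsJumpRep q r τ)
    (hA : ∀ a, ∀ s ∈ A, τ a s ∈ A) {i : S} (hi : i ∈ A) (t : ℝ) {j : S} (hj : j ∉ A) :
    transProb q t i j = 0 := by
  classical
  rw [transProb, ENNReal.iSup_eq_zero]
  intro m
  induction m generalizing t j with
  | zero => rfl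
  | succ m ih =>
    have h0 : ∀ s, inflow q (transBefore q m s i) j = 0 := by
      intro s
      refine ENNReal.tsum_eq_zero.2 fun k => ?_
      split_ifs with hkj
      · rfl
      · by_cases hk : k ∈ A
        · rw [hq.rate_eq k j (Ne.symm hkj)]
          refine mul_eq_zero_of_right _ (Finset.sum_eq_zero fun a _ => ?_)
          rw [if_neg]
          rintro rfl
          exact hj (hA a k hk)
        · rw [ih s hk, zero_mul]
    rw [transBefore_succ, if_neg (by rintro rfl; exact hj hi)]
    simp [h0]

theorem IsJumpRep.tsum_mul_transProb_eq_sum (hq : IsJumpRep q r τ)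
    (hA : ∀ a, ∀ s ∈ A, τ a s ∈ A) {i : S} (hi : i ∈ A) (t : ℝ) (f : S → ℝ≥0∞) :
    ∑' j, f j * transProb q t i j = ∑ j ∈ A, f j * transProb q t i j :=
  tsum_eq_sum fun j hj => by rw [hq.transProb_eq_zero_of_notMem hA hi t hj, mul_zero]

theorem IsJumpRep.transProb_le_one (hq : IsJumpRep q r τ) {t : ℝ} (ht : 0 ≤ t) (i j : S) :
    transProb q t i j ≤ 1 :=
  (ENNReal.le_tsum j).trans (hq.tsum_transProb_le_one ht i)

theorem IsJumpRep.lintegral_sum_ne_top (hq : IsJumpRep q r τ)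
    (hA : ∀ a, ∀ s ∈ A, τ a s ∈ A) {i : S} (hi : i ∈ A) {t : ℝ} {f : S → ℝ≥0∞}
    (hf : ∀ s, f s ≠ ∞) : ∫⁻ s in Set.Ioc 0 t, ∑' j, f j * transProb q s i j ≠ ∞ := by
  have hb : ∀ s ∈ Set.Ioc 0 t, ∑' j, f j * transProb q s i j ≤ ∑ j ∈ A, f j := by
    intro s hs
    rw [hq.tsum_mul_transProb_eq_sum hA hi]
    exact Finset.sum_le_sum fun j _ => mul_le_of_le_one_right' (hq.transProb_le_one hs.1.le i j)
  refine ne_top_of_le_ne_top ?_ (setLIntegral_mono measurable_const hb)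
  rw [setLIntegral_const]
  refine ENNReal.mul_ne_top (ENNReal.sum_ne_top.2 fun j _ => hf j) (by simp)

theorem IsJumpRep.tsum_transProb_eq_one_of_mem (hq : IsJumpRep q r τ)
    (hA : ∀ a, ∀ s ∈ A, τ a s ∈ A) {i : S} (hi : i ∈ A) {t : ℝ} (ht : 0 ≤ t) :
    ∑' j, transProb q t i j = 1 := by
  refine hq.tsum_transProb_eq_one ht ?_
  simp_rw [mul_comm (transProb _ _ _ _)]
  exact hq.lintegral_sum_ne_top hA hi fun s => ENNReal.ofReal_ne_top

/-- Dynkin's formula for a function whose generator is `-g` on the closed set `A`. -/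
theorem IsJumpRep.tsum_mul_transProb_add (hq : IsJumpRep q r τ)
    (hA : ∀ a, ∀ s ∈ A, τ a s ∈ A) {i : S} (hi : i ∈ A) {t : ℝ} (ht : 0 ≤ t) {u g : S → ℝ}
    (hu : ∀ s, 0 ≤ u s) (hg : ∀ s, 0 ≤ g s) (hgen : ∀ s ∈ A, gen r τ u s = -g s) :
    (∑' j, ENNReal.ofReal (u j) * transProb q t i j) +
      ∫⁻ s in Set.Ioc 0 t, ∑' j, ENNReal.ofReal (g j) * transProb q s i j =
    ENNReal.ofReal (u i) := by
  have key := tsum_mul_transProb q (fun j => ENNReal.ofReal (u j)) ht i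
  have hsplit : ∀ s, ∑' j, ENNReal.ofReal (u j) * ENNReal.ofReal (exitRate q j) *
      transProb q s i j = (∑' j, ENNReal.ofReal (g j) * transProb q s i j) +
      ∑' k, transProb q s i k * jumpSum q (fun j => ENNReal.ofReal (u j)) k := by
    intro s
    rw [← ENNReal.tsum_add]
    refine tsum_congr fun k => ?_
    by_cases hk : k ∈ A
    · have hn := hq.jumpSum_ofReal hu k
      have hnn := hq.exitRate_mul_add_gen_nonneg hu k
      rw [hn, mul_comm (transProb _ _ _ _), ← add_mul, ← ENNReal.ofReal_add (hg k) hnn, hgen k hk,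
        ← ENNReal.ofReal_mul (hu k)]
      ring_nf
    · rw [hq.transProb_eq_zero_of_notMem hA hi s hk]; simp
  have hm := fun j => measurable_transProb q i j
  simp_rw [hsplit] at key
  rw [lintegral_add_left (Measurable.tsum fun j => (hm j).const_mul _), ← add_assoc] at key
  refine (ENNReal.add_left_inj ?_).1 key
  simp_rw [mul_comm (transProb _ _ _ _)]
  exact hq.lintegral_sum_ne_top hA hi fun s => hq.jumpSum_ne_top (fun s => ENNReal.ofReal_ne_top) s

theorem IsAbsorbed.gen_eq_zero (h : IsAbsorbed r τ A Z Φ) {s : S} (hs : s ∈ A) (hZ : s ∈ Z)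
    (g : S → ℝ) : gen r τ g s = 0 := by
  refine Finset.sum_eq_zero fun a _ => ?_
  rcases h.stay s hs hZ a with h0 | h0 <;> simp [h0]

theorem IsAbsorbed.exitRate_eq_zero (h : IsAbsorbed r τ A Z Φ) (hq : IsJumpRep q r τ) {s : S}
    (hs : s ∈ A) (hZ : s ∈ Z) : exitRate q s = 0 := by
  classical
  rw [hq.exitRate_eq]
  refine Finset.sum_eq_zero fun a _ => ?_
  rcases h.stay s hs hZ a with h0 | h0 <;> simp [h0]

open scoped Classical in
theorem IsAbsorbed.tendsto_notMem (h : IsAbsorbed r τ A Z Φ) (hq : IsJumpRep q r τ) {i : S}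
    (hi : i ∈ A) :
    Tendsto (fun t => ∑ j ∈ A with j ∉ Z, (transProb q t i j).toReal) atTop (𝓝 0) := by
  obtain ⟨v, hv, hv0⟩ := h.exists_dirichletOp_eq fun s => if s ∈ Z then 0 else 1
  have hvn : ∀ s, 0 ≤ v s := by
    intro s
    by_cases hs : s ∈ A
    · refine h.nonneg_of_dirichletOp_nonneg (fun s hs => ?_) s hs
      rw [hv s hs]; split_ifs <;> norm_num
    · rw [hv0 s hs]
  set N : ℝ → ℝ≥0∞ := fun t => ∑' j, ENNReal.ofReal (if j ∈ Z then 0 else 1) * transProb q t i j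
    with hN
  have hint : ∀ t, 0 ≤ t → ∫⁻ s in Set.Ioc 0 t, N s ≤ ENNReal.ofReal (v i) := by
    intro t ht
    rw [← hq.tsum_mul_transProb_add h.mem hi ht hvn (g := fun j => if j ∈ Z then 0 else 1)
      (fun s => by split_ifs <;> norm_num) (fun s hs => ?_)]
    · exact le_add_self
    · have := hv s hs
      unfold dirichletOp at this
      split_ifs at this ⊢ with hZ
      · rw [h.gen_eq_zero hs hZ, neg_zero]
      · linarith
  have hNZ : ∀ t, 0 ≤ t →
      N t + ∑' j, (if j ∈ Z then 1 else 0) * transProb q t i j = 1 := by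
    intro t ht
    refine Eq.trans ?_ (hq.tsum_transProb_eq_one_of_mem h.mem hi ht)
    rw [hN, ← ENNReal.tsum_add]
    refine tsum_congr fun j => ?_
    split_ifs <;> simp
  have hZform : ∀ t, 0 ≤ t → ∑' j, (if j ∈ Z then 1 else 0) * transProb q t i j =
      (if i ∈ Z then 1 else 0) + ∫⁻ s in Set.Ioc 0 t,
        ∑' k, transProb q s i k * jumpSum q (fun j => if j ∈ Z then 1 else 0) k := by
    intro t ht
    rw [← tsum_mul_transProb q (fun j => if j ∈ Z then 1 else 0) ht i]
    have : ∀ s, ∑' j, (if j ∈ Z then 1 else 0) * ENNReal.ofReal (exitRate q j) *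
        transProb q s i j = 0 := by
      intro s
      refine ENNReal.tsum_eq_zero.2 fun j => ?_
      by_cases hj : j ∈ A
      · split_ifs with hZ
        · rw [h.exitRate_eq_zero hq hj hZ]; simp
        · simp
      · rw [hq.transProb_eq_zero_of_notMem h.mem hi s hj, mul_zero]
    simp_rw [this]
    simp
  have hanti : ∀ s t, 0 ≤ s → s ≤ t → N t ≤ N s := by
    intro s t hs hst
    have h1 := hNZ s hs
    have h2 := hNZ t (hs.trans hst)
    have hle : ∑' j, (if j ∈ Z then 1 else 0) * transProb q s i j ≤
        ∑' j, (if j ∈ Z then 1 else 0) * transProb q t i j := by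
      rw [hZform s hs, hZform t (hs.trans hst)]
      gcongr
    have hfin : ∑' j, (if j ∈ Z then 1 else 0) * transProb q s i j ≠ ∞ :=
      ne_top_of_le_ne_top ENNReal.one_ne_top (le_add_self.trans h1.le)
    refine (ENNReal.add_le_add_iff_right hfin).1 ?_
    exact (add_le_add le_rfl hle).trans (h2.trans h1.symm).le
  have hNle : ∀ t, 0 ≤ t → ENNReal.ofReal t * N t ≤ ENNReal.ofReal (v i) := by
    intro t ht
    refine le_trans ?_ (hint t ht)
    calc ENNReal.ofReal t * N t = ∫⁻ s in Set.Ioc 0 t, N t := by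
          rw [setLIntegral_const, Real.volume_Ioc, sub_zero, mul_comm]
      _ ≤ _ := setLIntegral_mono
          (Measurable.tsum fun j => (measurable_transProb q i j).const_mul _)
          fun s hs => hanti s t hs.1.le hs.2
  have hNfin : ∀ t, 0 ≤ t → N t ≠ ∞ := fun t ht =>
    ne_top_of_le_ne_top ENNReal.one_ne_top (le_self_add.trans (hNZ t ht).le)
  have hreal : ∀ t, 0 < t → ∑ j ∈ A with j ∉ Z, (transProb q t i j).toReal ≤ v i / t := by
    intro t ht
    have e : ∑ j ∈ A with j ∉ Z, (transProb q t i j).toReal = (N t).toReal := by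
      rw [hN]
      simp only
      rw [hq.tsum_mul_transProb_eq_sum h.mem hi, ENNReal.toReal_sum, Finset.sum_filter]
      · refine Finset.sum_congr rfl fun j _ => ?_
        split_ifs <;> simp
      · intro j _
        exact ENNReal.mul_ne_top ENNReal.ofReal_ne_top
          (ne_top_of_le_ne_top ENNReal.one_ne_top (hq.transProb_le_one ht.le i j))
    rw [e, le_div_iff₀ ht, mul_comm]
    have := ENNReal.toReal_mono ENNReal.ofReal_ne_top (hNle t ht.le)
    rwa [ENNReal.toReal_mul, ENNReal.toReal_ofReal ht.le, ENNReal.toReal_ofReal (hvn i)] at this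
  refine tendsto_of_tendsto_of_tendsto_of_le_of_le' tendsto_const_nhds
    (tendsto_const_nhds.div_atTop tendsto_id) (Eventually.of_forall fun t =>
      Finset.sum_nonneg fun j _ => ENNReal.toReal_nonneg)
    ((eventually_gt_atTop 0).mono hreal)

open scoped Classical in
/-- The solution of the Dirichlet problem gives the limit of the expectations. -/
theorem IsAbsorbed.tendsto_sum_mul_transProb (h : IsAbsorbed r τ A Z Φ) (hq : IsJumpRep q r τ)
    {f u : S → ℝ} (hf : ∀ s ∈ A, 0 ≤ f s)
    (hu : ∀ s ∈ A, dirichletOp r τ Z u s = if s ∈ Z then f s else 0) {i : S} (hi : i ∈ A) :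
    Tendsto (fun t => ∑ j ∈ A, f j * (transProb q t i j).toReal) atTop (𝓝 (u i)) := by
  have hun : ∀ s ∈ A, 0 ≤ u s := h.nonneg_of_dirichletOp_nonneg fun s hs => by
    rw [hu s hs]; split_ifs
    · exact hf s hs
    · rfl
  set w : S → ℝ := fun s => if s ∈ A then u s else 0 with hw
  have hwn : ∀ s, 0 ≤ w s := by
    intro s
    simp only [hw]
    split_ifs with hs
    · exact hun s hs
    · rfl
  have hwA : ∀ s ∈ A, w s = u s := fun s hs => if_pos hs
  have hinv : ∀ t, 0 ≤ t → ∑ j ∈ A, u j * (transProb q t i j).toReal = u i := by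
    intro t ht
    have key := hq.tsum_mul_transProb_add h.mem hi ht hwn (g := fun _ => 0) (fun _ => le_rfl)
      (fun s hs => ?_)
    · simp only [ENNReal.ofReal_zero, zero_mul, tsum_zero, lintegral_zero, add_zero] at key
      rw [hq.tsum_mul_transProb_eq_sum h.mem hi] at key
      have k2 := congrArg ENNReal.toReal key
      rw [ENNReal.toReal_ofReal (hwn i), hwA i hi, ENNReal.toReal_sum] at k2
      · rw [← k2]
        refine Finset.sum_congr rfl fun j hj => ?_
        rw [ENNReal.toReal_mul, ENNReal.toReal_ofReal (hwn j), hwA j hj]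
      · intro j _
        exact ENNReal.mul_ne_top ENNReal.ofReal_ne_top
          (ne_top_of_le_ne_top ENNReal.one_ne_top (hq.transProb_le_one ht i j))
    · rw [neg_zero]
      by_cases hZ : s ∈ Z
      · exact h.gen_eq_zero hs hZ _
      · have h1 := h.dirichletOp_congr hwA hs
        rw [hu s hs, if_neg hZ] at h1
        simpa [dirichletOp, hZ] using h1
  have hM : ∀ t, 0 ≤ t → |∑ j ∈ A, f j * (transProb q t i j).toReal - u i| ≤
      (∑ j ∈ A, |f j - u j|) * ∑ j ∈ A with j ∉ Z, (transProb q t i j).toReal := by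
    intro t ht
    have e : ∑ j ∈ A, f j * (transProb q t i j).toReal - u i =
        ∑ j ∈ A with j ∉ Z, (f j - u j) * (transProb q t i j).toReal := by
      rw [← hinv t ht, ← Finset.sum_sub_distrib, Finset.sum_filter]
      refine Finset.sum_congr rfl fun j hj => ?_
      split_ifs with hZ
      · have := hu j hj
        simp only [dirichletOp, hZ, if_true] at this
        rw [this]; ring
      · ring
    rw [e, Finset.mul_sum]
    refine (Finset.abs_sum_le_sum_abs _ _).trans (Finset.sum_le_sum fun j hj => ?_)
    rw [abs_mul, abs_of_nonneg (ENNReal.toReal_nonneg (a := transProb q t i j))]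
    refine mul_le_mul_of_nonneg_right ?_ ENNReal.toReal_nonneg
    exact Finset.single_le_sum (f := fun j => |f j - u j|) (fun j _ => abs_nonneg _)
      (Finset.mem_filter.1 hj).1
  rw [tendsto_iff_norm_sub_tendsto_zero]
  have hlim := (h.tendsto_notMem hq hi).const_mul (∑ j ∈ A, |f j - u j|)
  rw [mul_zero] at hlim
  refine squeeze_zero' (Eventually.of_forall fun t => norm_nonneg _) ?_ hlim
  filter_upwards [eventually_ge_atTop 0] with t ht using hM t ht

end Absorption

section AllowedOccupation

variable {θ : ℝ} {k : ℕ}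

theorem allowedOcc_of_nonneg (hθ : 0 ≤ θ) (k : ℕ) : AllowedOcc θ k := fun h => absurd h hθ.not_gt

theorem allowedOcc_neg_inv_iff {α : ℕ} (hα : 0 < α) (k : ℕ) :
    AllowedOcc (-(1 / (α : ℝ))) k ↔ k ≤ α := by
  have hα' : (0 : ℝ) < α := Nat.cast_pos.2 hα
  have hneg : -(1 / (α : ℝ)) < 0 := by simpa using hα'
  rw [AllowedOcc, abs_neg, abs_of_pos (by positivity), one_div_one_div]
  simp [hα]

theorem AllowedOcc.mono {k' : ℕ} (h : AllowedOcc θ k) (hk : k' ≤ k) : AllowedOcc θ k' :=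
  fun hθ => (Nat.cast_le.2 hk).trans (h hθ)

theorem AdmissibleTheta.one_add_mul_nonneg (hθ : AdmissibleTheta θ) (hk : AllowedOcc θ k) :
    0 ≤ 1 + θ * k := by
  rcases hθ with hθ | ⟨α, hα, rfl⟩
  · positivity
  · have hα' : (0 : ℝ) < α := Nat.cast_pos.2 hα
    have hle : (k : ℝ) ≤ α := Nat.cast_le.2 ((allowedOcc_neg_inv_iff hα k).1 hk)
    have : (k : ℝ) / α ≤ 1 := (div_le_one hα').2 hle
    have e : 1 + -(1 / (α : ℝ)) * k = 1 - k / α := by ring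
    linarith

theorem AdmissibleTheta.allowedOcc_succ (hθ : AdmissibleTheta θ) (hk : AllowedOcc θ k)
    (hne : 1 + θ * k ≠ 0) : AllowedOcc θ (k + 1) := by
  rcases hθ with hθ | ⟨α, hα, rfl⟩
  · exact allowedOcc_of_nonneg hθ _
  · have hα' : (α : ℝ) ≠ 0 := (Nat.cast_pos.2 hα).ne'
    rw [allowedOcc_neg_inv_iff hα] at hk ⊢
    refine lt_of_le_of_ne hk fun h => hne ?_
    rw [h]; field_simp; ring

theorem AdmissibleTheta.one_add_mul_pos_of_lt (hθ : AdmissibleTheta θ) {j : ℕ}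
    (hk : AllowedOcc θ k) (hj : j < k) : 0 < 1 + θ * j := by
  rcases hθ with hθ | ⟨α, hα, rfl⟩
  · positivity
  · have hα' : (0 : ℝ) < α := Nat.cast_pos.2 hα
    have hlt : (j : ℝ) < α := Nat.cast_lt.2 (hj.trans_le ((allowedOcc_neg_inv_iff hα k).1 hk))
    have : (j : ℝ) / α < 1 := (div_lt_one hα').2 hlt
    have e : 1 + -(1 / (α : ℝ)) * j = 1 - j / α := by ring
    linarith

/-- If `1 + θ a = 0` then `a` is the largest allowed occupation number. -/
theorem AdmissibleTheta.le_of_one_add_mul_eq_zero (hθ : AdmissibleTheta θ) {a m : ℕ}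
    (ha : 1 + θ * a = 0) (hm : AllowedOcc θ m) : m ≤ a := by
  by_contra! h
  exact (hθ.one_add_mul_pos_of_lt hm h).ne' ha

end AllowedOccupation

section SingleSite

variable {θ : ℝ} {a m : ℕ}

theorem singleDuality_zero (θ : ℝ) (m : ℕ) : singleDuality θ 0 m = 1 := by
  simp [singleDuality]

theorem AdmissibleTheta.singleDuality_nonneg (hθ : AdmissibleTheta θ) (ha : AllowedOcc θ a) :
    0 ≤ singleDuality θ a m :=
  div_nonneg (Nat.cast_nonneg _) (Finset.prod_nonneg fun _ hj =>
    (hθ.one_add_mul_pos_of_lt ha (Finset.mem_range.1 hj)).le)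

theorem cast_descFactorial_succ (m a : ℕ) :
    ((m.descFactorial (a + 1) : ℕ) : ℝ) = ((m : ℝ) - a) * m.descFactorial a := by
  rw [Nat.descFactorial_succ]
  rcases le_or_gt a m with h | h
  · push_cast [Nat.cast_sub h]; ring
  · simp [Nat.descFactorial_eq_zero_iff_lt.2 h]

theorem AdmissibleTheta.mul_singleDuality_succ (hθ : AdmissibleTheta θ) (hm : AllowedOcc θ m) :
    (1 + θ * a) * singleDuality θ (a + 1) m = ((m : ℝ) - a) * singleDuality θ a m := by
  rw [singleDuality, singleDuality, cast_descFactorial_succ, Finset.prod_range_succ]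
  by_cases h : 1 + θ * a = 0
  · rw [h]
    rcases (hθ.le_of_one_add_mul_eq_zero h hm).lt_or_eq with hlt | heq
    · simp [Nat.descFactorial_eq_zero_iff_lt.2 hlt]
    · simp [heq]
  · rw [mul_comm (∏ j ∈ Finset.range a, (1 + θ * (j : ℝ))), ← mul_div_assoc,
      mul_div_mul_left _ _ h, mul_div_assoc]

theorem AdmissibleTheta.cast_mul_singleDuality (hθ : AdmissibleTheta θ) (hm : AllowedOcc θ m) :
    m * singleDuality θ a m =
      a * singleDuality θ a m + (1 + θ * a) * singleDuality θ (a + 1) m := by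
  rw [hθ.mul_singleDuality_succ hm]; ring

theorem AdmissibleTheta.cast_mul_singleDuality_pred (hθ : AdmissibleTheta θ)
    (hm : AllowedOcc θ m) :
    m * singleDuality θ a (m - 1) = (1 + θ * a) * singleDuality θ (a + 1) m := by
  rw [hθ.mul_singleDuality_succ hm]
  cases m with
  | zero =>
    cases a with
    | zero => simp
    | succ a => simp [singleDuality]
  | succ m =>
    rw [singleDuality, singleDuality, ← mul_div_assoc, ← mul_div_assoc, Nat.add_sub_cancel,
      ← cast_descFactorial_succ, Nat.succ_descFactorial_succ]
    push_cast; rfl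

theorem AdmissibleTheta.mul_singleDuality_add_one (hθ : AdmissibleTheta θ)
    (ha : AllowedOcc θ a) (hm : AllowedOcc θ m) :
    (1 + θ * m) * singleDuality θ a (m + 1) =
      a * singleDuality θ (a - 1) m + (1 + 2 * θ * a) * singleDuality θ a m +
        θ * ((1 + θ * a) * singleDuality θ (a + 1) m) := by
  rw [hθ.mul_singleDuality_succ hm]
  cases a with
  | zero => simp only [singleDuality_zero]; push_cast; ring
  | succ b =>
    have hb : 1 + θ * b ≠ 0 := (hθ.one_add_mul_pos_of_lt ha (Nat.lt_succ_self b)).ne'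
    have e1 : singleDuality θ (b + 1) m = (m - b) * singleDuality θ b m / (1 + θ * b) := by
      rw [eq_div_iff hb, mul_comm, hθ.mul_singleDuality_succ hm]
    have e2 : singleDuality θ (b + 1) (m + 1) = (m + 1) * singleDuality θ b m / (1 + θ * b) := by
      rw [singleDuality, singleDuality, Finset.prod_range_succ, Nat.succ_descFactorial_succ]
      push_cast
      rw [← mul_div_assoc, div_div]
    rw [e1, e2, Nat.add_sub_cancel]
    push_cast
    field_simp
    ring

end SingleSite

section Move

variable {ι : Type*} [DecidableEq ι]

theorem move_self_of_ne_zero {η : ι → ℕ} {i : ι} (h : η i ≠ 0) : move η i i = η := by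
  funext k
  by_cases hk : k = i
  · subst hk; simp [move]; omega
  · simp [move, hk]

theorem move_apply_left {η : ι → ℕ} {i j : ι} (h : i ≠ j) : move η i j i = η i - 1 := by
  simp [move, h]

theorem move_apply_right {η : ι → ℕ} {i j : ι} (h : i ≠ j) : move η i j j = η j + 1 := by
  simp [move, h.symm]

theorem move_apply_of_ne {η : ι → ℕ} {i j k : ι} (hi : k ≠ i) (hj : k ≠ j) :
    move η i j k = η k := by
  simp [move, hi, hj]

theorem add_single_apply_self (η : ι → ℕ) (i : ι) : (η + Pi.single i 1 : ι → ℕ) i = η i + 1 := by simp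

theorem add_single_apply_of_ne (η : ι → ℕ) {i k : ι} (h : k ≠ i) :
    (η + Pi.single i 1 : ι → ℕ) k = η k := by simp [h]

theorem sub_single_apply_self (η : ι → ℕ) (i : ι) : (η - Pi.single i 1 : ι → ℕ) i = η i - 1 := by simp

theorem sub_single_apply_of_ne (η : ι → ℕ) {i k : ι} (h : k ≠ i) :
    (η - Pi.single i 1 : ι → ℕ) k = η k := by simp [h]

theorem sum_sum_eq_zero_of_antisymm {ι : Type*} [Fintype ι] (p X : ι → ι → ℝ)
    (hp : ∀ i j, p i j = p j i) (hX : ∀ i j, X i j + X j i = 0) :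
    ∑ i, ∑ j, p i j * X i j = 0 := by
  have h1 : ∑ i, ∑ j, p i j * X i j = ∑ i, ∑ j, p i j * X j i := by
    rw [Finset.sum_comm]
    exact Finset.sum_congr rfl fun i _ => Finset.sum_congr rfl fun j _ => by rw [hp]
  have h2 : ∑ i, ∑ j, p i j * X i j + ∑ i, ∑ j, p i j * X j i = 0 := by
    simp only [← Finset.sum_add_distrib, ← mul_add, hX, mul_zero, Finset.sum_const_zero]
  linarith

end Move

section Duality

variable {N : ℕ}

/-- The strength of the left reservoir seen from the site `i`. -/
def leftRate (cl : ℝ) (i : Fin N) : ℝ := if i.val = 0 then cl else 0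

/-- The strength of the right reservoir seen from the site `i`. -/
def rightRate (cr : ℝ) (i : Fin N) : ℝ := if i.val + 1 = N then cr else 0

/-- The generator of the system with reservoirs, on functions of arbitrary configurations. -/
def resGen (θ : ℝ) (p : Fin N → Fin N → ℝ) (cl cr ρl ρr : ℝ) (f : (Fin N → ℕ) → ℝ)
    (η : Fin N → ℕ) : ℝ :=
  (∑ i, ∑ j, p i j * η i * (1 + θ * η j) * (f (move η i j) - f η)) +
  (∑ i, (leftRate cl i * (ρl * (1 + θ * η i)) * (f (η + Pi.single i 1) - f η) +
    leftRate cl i * ((1 + θ * ρl) * η i) * (f (η - Pi.single i 1) - f η))) +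
  (∑ i, (rightRate cr i * (ρr * (1 + θ * η i)) * (f (η + Pi.single i 1) - f η) +
    rightRate cr i * ((1 + θ * ρr) * η i) * (f (η - Pi.single i 1) - f η)))

/-- The generator of the dual system, on functions of arbitrary configurations. -/
def dualGen (θ : ℝ) (p : Fin N → Fin N → ℝ) (cl cr : ℝ) (f : (Fin (N + 2) → ℕ) → ℝ)
    (ξ : Fin (N + 2) → ℕ) : ℝ :=
  (∑ i, ∑ j, p i j * ξ (bulk i) * (1 + θ * ξ (bulk j)) * (f (move ξ (bulk i) (bulk j)) - f ξ)) +
  (∑ i, leftRate cl i * ξ (bulk i) * (f (move ξ (bulk i) 0) - f ξ)) +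
  (∑ i, rightRate cr i * ξ (bulk i) * (f (move ξ (bulk i) (Fin.last (N + 1))) - f ξ))

theorem bulk_ne_zero (i : Fin N) : bulk i ≠ 0 := by
  intro h
  have := congrArg Fin.val h
  simp [bulk] at this

theorem bulk_ne_last (i : Fin N) : bulk i ≠ Fin.last (N + 1) := by
  intro h
  have := congrArg Fin.val h
  simp [bulk] at this
  omega

theorem zero_ne_last : (0 : Fin (N + 2)) ≠ Fin.last (N + 1) := by
  intro h
  have := congrArg Fin.val h
  simp at this

/-- The part of the duality function which does not involve the sites in `B`. -/
def dualityRest (θ ρl ρr : ℝ) (B : Finset (Fin N)) (ξ : Fin (N + 2) → ℕ) (η : Fin N → ℕ) : ℝ :=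
  ρl ^ ξ 0 * (∏ k ∈ Bᶜ, singleDuality θ (ξ (bulk k)) (η k)) * ρr ^ ξ (Fin.last (N + 1))

theorem dualityFun_eq_prod_mul (θ ρl ρr : ℝ) (B : Finset (Fin N)) (ξ : Fin (N + 2) → ℕ)
    (η : Fin N → ℕ) : dualityFun θ ρl ρr ξ η =
      (∏ k ∈ B, singleDuality θ (ξ (bulk k)) (η k)) * dualityRest θ ρl ρr B ξ η := by
  rw [dualityFun, dualityRest, ← Finset.prod_mul_prod_compl B]
  ring

theorem dualityFun_eq_pair (θ ρl ρr : ℝ) {i j : Fin N} (hij : i ≠ j) (ξ : Fin (N + 2) → ℕ)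
    (η : Fin N → ℕ) : dualityFun θ ρl ρr ξ η =
      singleDuality θ (ξ (bulk i)) (η i) * singleDuality θ (ξ (bulk j)) (η j) *
        dualityRest θ ρl ρr {i, j} ξ η := by
  rw [dualityFun_eq_prod_mul θ ρl ρr {i, j}, Finset.prod_pair hij]

theorem dualityFun_eq_single (θ ρl ρr : ℝ) (i : Fin N) (ξ : Fin (N + 2) → ℕ)
    (η : Fin N → ℕ) : dualityFun θ ρl ρr ξ η =
      singleDuality θ (ξ (bulk i)) (η i) * dualityRest θ ρl ρr {i} ξ η := by
  rw [dualityFun_eq_prod_mul θ ρl ρr {i}, Finset.prod_singleton]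

theorem dualityRest_congr {θ ρl ρr : ℝ} {B : Finset (Fin N)} {ξ ξ' : Fin (N + 2) → ℕ}
    {η η' : Fin N → ℕ} (h0 : ξ' 0 = ξ 0) (hl : ξ' (Fin.last (N + 1)) = ξ (Fin.last (N + 1)))
    (hξ : ∀ k ∉ B, ξ' (bulk k) = ξ (bulk k)) (hη : ∀ k ∉ B, η' k = η k) :
    dualityRest θ ρl ρr B ξ' η' = dualityRest θ ρl ρr B ξ η := by
  rw [dualityRest, dualityRest, h0, hl]
  congr 2
  refine Finset.prod_congr rfl fun k hk => ?_
  rw [Finset.mem_compl] at hk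
  rw [hξ k hk, hη k hk]

variable {θ ρl ρr : ℝ} {ξ : Fin (N + 2) → ℕ} {η : Fin N → ℕ}

theorem duality_move_left {i j : Fin N} (hij : i ≠ j) :
    dualityFun θ ρl ρr (move ξ (bulk i) (bulk j)) η =
      singleDuality θ (ξ (bulk i) - 1) (η i) * singleDuality θ (ξ (bulk j) + 1) (η j) *
        dualityRest θ ρl ρr {i, j} ξ η := by
  have hb := bulk_injective.ne hij
  rw [dualityFun_eq_pair θ ρl ρr hij, move_apply_left hb, move_apply_right hb]
  congr 1
  refine dualityRest_congr (move_apply_of_ne (bulk_ne_zero i).symm (bulk_ne_zero j).symm)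
    (move_apply_of_ne (bulk_ne_last i).symm (bulk_ne_last j).symm) (fun k hk => ?_)
    fun _ _ => rfl
  simp only [Finset.mem_insert, Finset.mem_singleton, not_or] at hk
  exact move_apply_of_ne (bulk_injective.ne hk.1) (bulk_injective.ne hk.2)

theorem duality_move_right {i j : Fin N} (hij : i ≠ j) :
    dualityFun θ ρl ρr ξ (move η i j) =
      singleDuality θ (ξ (bulk i)) (η i - 1) * singleDuality θ (ξ (bulk j)) (η j + 1) *
        dualityRest θ ρl ρr {i, j} ξ η := by
  rw [dualityFun_eq_pair θ ρl ρr hij, move_apply_left hij, move_apply_right hij]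
  congr 1
  refine dualityRest_congr rfl rfl (fun _ _ => rfl) fun k hk => ?_
  simp only [Finset.mem_insert, Finset.mem_singleton, not_or] at hk
  exact move_apply_of_ne hk.1 hk.2

theorem dualityRest_pair_comm (i j : Fin N) :
    dualityRest θ ρl ρr {i, j} ξ η = dualityRest θ ρl ρr {j, i} ξ η := by
  rw [Finset.pair_comm]

theorem AdmissibleTheta.duality_bulk (hθ : AdmissibleTheta θ)
    (hξ : ∀ i, AllowedOcc θ (ξ (bulk i))) (hη : ∀ i, AllowedOcc θ (η i)) (i j : Fin N) :
    (η i * (1 + θ * η j) * (dualityFun θ ρl ρr ξ (move η i j) - dualityFun θ ρl ρr ξ η) -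
      ξ (bulk i) * (1 + θ * ξ (bulk j)) *
        (dualityFun θ ρl ρr (move ξ (bulk i) (bulk j)) η - dualityFun θ ρl ρr ξ η)) +
    (η j * (1 + θ * η i) * (dualityFun θ ρl ρr ξ (move η j i) - dualityFun θ ρl ρr ξ η) -
      ξ (bulk j) * (1 + θ * ξ (bulk i)) *
        (dualityFun θ ρl ρr (move ξ (bulk j) (bulk i)) η - dualityFun θ ρl ρr ξ η)) = 0 := by
  rcases eq_or_ne i j with rfl | hij
  · have h1 : (η i : ℝ) * (1 + θ * η i) *
        (dualityFun θ ρl ρr ξ (move η i i) - dualityFun θ ρl ρr ξ η) = 0 := by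
      by_cases h : η i = 0
      · simp [h]
      · simp [move_self_of_ne_zero h]
    have h2 : (ξ (bulk i) : ℝ) * (1 + θ * ξ (bulk i)) *
        (dualityFun θ ρl ρr (move ξ (bulk i) (bulk i)) η - dualityFun θ ρl ρr ξ η) = 0 := by
      by_cases h : ξ (bulk i) = 0
      · simp [h]
      · simp [move_self_of_ne_zero h]
    rw [h1, h2]; ring
  · rw [duality_move_left hij, duality_move_left hij.symm, duality_move_right hij,
      duality_move_right hij.symm, dualityFun_eq_pair θ ρl ρr hij, dualityRest_pair_comm j i]
    have a1 := hθ.cast_mul_singleDuality (a := ξ (bulk i)) (hη i)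
    have a2 := hθ.cast_mul_singleDuality_pred (a := ξ (bulk i)) (hη i)
    have a3 := hθ.mul_singleDuality_add_one (hξ i) (hη i)
    have b1 := hθ.cast_mul_singleDuality (a := ξ (bulk j)) (hη j)
    have b2 := hθ.cast_mul_singleDuality_pred (a := ξ (bulk j)) (hη j)
    have b3 := hθ.mul_singleDuality_add_one (hξ j) (hη j)
    generalize singleDuality θ (ξ (bulk i)) (η i) = x0 at *
    generalize singleDuality θ (ξ (bulk i)) (η i - 1) = xm at *
    generalize singleDuality θ (ξ (bulk i)) (η i + 1) = xp at *
    generalize singleDuality θ (ξ (bulk i) - 1) (η i) = ym at *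
    generalize singleDuality θ (ξ (bulk i) + 1) (η i) = yp at *
    generalize singleDuality θ (ξ (bulk j)) (η j) = x0' at *
    generalize singleDuality θ (ξ (bulk j)) (η j - 1) = xm' at *
    generalize singleDuality θ (ξ (bulk j)) (η j + 1) = xp' at *
    generalize singleDuality θ (ξ (bulk j) - 1) (η j) = ym' at *
    generalize singleDuality θ (ξ (bulk j) + 1) (η j) = yp' at *
    generalize dualityRest θ ρl ρr {i, j} ξ η = R
    generalize (η i : ℝ) = m at *
    generalize (η j : ℝ) = n at *
    generalize (ξ (bulk i) : ℝ) = a at *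
    generalize (ξ (bulk j) : ℝ) = b at *
    linear_combination R * ((1 + θ * n) * xp' * a2 + (1 + θ * a) * yp * b3 +
      (1 + θ * m) * xp * b2 + (1 + θ * b) * yp' * a3 - x0' * a1 - x0 * b1 -
      2 * θ * n * x0' * a1 - 2 * θ * (a * x0 + (1 + θ * a) * yp) * b1)

theorem duality_absorb_zero (i : Fin N) :
    ξ (bulk i) * dualityFun θ ρl ρr (move ξ (bulk i) 0) η =
      ξ (bulk i) * (ρl * singleDuality θ (ξ (bulk i) - 1) (η i) *
        dualityRest θ ρl ρr {i} ξ η) := by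
  rw [dualityFun_eq_single θ ρl ρr i, move_apply_left (bulk_ne_zero i)]
  have : dualityRest θ ρl ρr {i} (move ξ (bulk i) 0) η =
      ρl * dualityRest θ ρl ρr {i} ξ η := by
    rw [dualityRest, dualityRest, move_apply_right (bulk_ne_zero i),
      move_apply_of_ne (bulk_ne_last i).symm zero_ne_last.symm, pow_succ]
    rw [Finset.prod_congr rfl fun k hk => by
      rw [move_apply_of_ne (bulk_injective.ne (by simpa using hk)) (bulk_ne_zero k)]]
    ring
  rw [this]; ring

theorem duality_absorb_last (i : Fin N) :
    ξ (bulk i) * dualityFun θ ρl ρr (move ξ (bulk i) (Fin.last (N + 1))) η =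
      ξ (bulk i) * (ρr * singleDuality θ (ξ (bulk i) - 1) (η i) *
        dualityRest θ ρl ρr {i} ξ η) := by
  rw [dualityFun_eq_single θ ρl ρr i, move_apply_left (bulk_ne_last i)]
  have : dualityRest θ ρl ρr {i} (move ξ (bulk i) (Fin.last (N + 1))) η =
      ρr * dualityRest θ ρl ρr {i} ξ η := by
    rw [dualityRest, dualityRest, move_apply_right (bulk_ne_last i),
      move_apply_of_ne (bulk_ne_zero i).symm zero_ne_last, pow_succ]
    rw [Finset.prod_congr rfl fun k hk => by
      rw [move_apply_of_ne (bulk_injective.ne (by simpa using hk)) (bulk_ne_last k)]]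
    ring
  rw [this]; ring

theorem duality_update {η' : Fin N → ℕ} (i : Fin N) (h : ∀ k ≠ i, η' k = η k) :
    dualityFun θ ρl ρr ξ η' =
      singleDuality θ (ξ (bulk i)) (η' i) * dualityRest θ ρl ρr {i} ξ η := by
  rw [dualityFun_eq_single θ ρl ρr i]
  congr 1
  exact dualityRest_congr rfl rfl (fun _ _ => rfl) fun k hk => h k (by simpa using hk)

theorem AdmissibleTheta.duality_reservoir (hθ : AdmissibleTheta θ)
    (hξ : ∀ i, AllowedOcc θ (ξ (bulk i))) (hη : ∀ i, AllowedOcc θ (η i)) (i : Fin N) (ρ : ℝ) :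
    ρ * (1 + θ * η i) *
        (dualityFun θ ρl ρr ξ (η + Pi.single i 1) - dualityFun θ ρl ρr ξ η) +
      (1 + θ * ρ) * η i *
        (dualityFun θ ρl ρr ξ (η - Pi.single i 1) - dualityFun θ ρl ρr ξ η) =
    ξ (bulk i) * (ρ * singleDuality θ (ξ (bulk i) - 1) (η i) *
        dualityRest θ ρl ρr {i} ξ η) - ξ (bulk i) * dualityFun θ ρl ρr ξ η := by
  rw [duality_update (η := η) i fun k hk => add_single_apply_of_ne η hk,
    duality_update (η := η) i fun k hk => sub_single_apply_of_ne η hk,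
    add_single_apply_self, sub_single_apply_self, dualityFun_eq_single θ ρl ρr i]
  have a1 := hθ.cast_mul_singleDuality (a := ξ (bulk i)) (hη i)
  have a2 := hθ.cast_mul_singleDuality_pred (a := ξ (bulk i)) (hη i)
  have a3 := hθ.mul_singleDuality_add_one (hξ i) (hη i)
  linear_combination dualityRest θ ρl ρr {i} ξ η *
    (ρ * a3 + (1 + θ * ρ) * a2 - (θ * ρ + 1 + θ * ρ) * a1)

/-- Duality of the generators. -/
theorem AdmissibleTheta.resGen_dualityFun (hθ : AdmissibleTheta θ) {p : Fin N → Fin N → ℝ}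
    (hsymm : ∀ i j, p i j = p j i) (cl cr : ℝ)
    (hξ : ∀ i, AllowedOcc θ (ξ (bulk i))) (hη : ∀ i, AllowedOcc θ (η i)) :
    resGen θ p cl cr ρl ρr (dualityFun θ ρl ρr ξ) η =
      dualGen θ p cl cr (fun ξ => dualityFun θ ρl ρr ξ η) ξ := by
  have hb := sum_sum_eq_zero_of_antisymm p
    (fun i j => η i * (1 + θ * η j) *
        (dualityFun θ ρl ρr ξ (move η i j) - dualityFun θ ρl ρr ξ η) -
      ξ (bulk i) * (1 + θ * ξ (bulk j)) *
        (dualityFun θ ρl ρr (move ξ (bulk i) (bulk j)) η - dualityFun θ ρl ρr ξ η))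
    hsymm (hθ.duality_bulk hξ hη)
  rw [resGen, dualGen]
  congr 1
  · congr 1
    · rw [← sub_eq_zero, ← hb]
      simp only [← Finset.sum_sub_distrib]
      exact Finset.sum_congr rfl fun i _ => Finset.sum_congr rfl fun j _ => by ring
    · refine Finset.sum_congr rfl fun i _ => ?_
      linear_combination leftRate cl i * hθ.duality_reservoir (ρl := ρl) (ρr := ρr) hξ hη i ρl -
        leftRate cl i * duality_absorb_zero (θ := θ) (ρl := ρl) (ρr := ρr) (ξ := ξ) (η := η) i
  · refine Finset.sum_congr rfl fun i _ => ?_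
    linear_combination rightRate cr i * hθ.duality_reservoir (ρl := ρl) (ρr := ρr) hξ hη i ρr -
        rightRate cr i * duality_absorb_last (θ := θ) (ρl := ρl) (ρr := ρr) (ξ := ξ) (η := η) i

end Duality

section Restriction

variable {R I : Type*} {P : R → Prop}

open scoped Classical in
/-- The jumps `t a` of raw configurations, restricted to the configurations which satisfy `P`: jumps
which have rate zero or leave the state space are suppressed. -/
def restrictTarget (ρ : I → R → ℝ) (t : I → R → R) (a : I) (s : {x // P x}) : {x // P x} :=
  if h : 0 < ρ a s.1 ∧ P (t a s.1) then ⟨t a s.1, h.2⟩ else s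

variable {ρ : I → R → ℝ} {t : I → R → R}

theorem restrictTarget_val {a : I} {s : {x // P x}} (h0 : 0 < ρ a s.1) (hP : P (t a s.1)) :
    (restrictTarget ρ t a s).1 = t a s.1 := by
  rw [restrictTarget, dif_pos ⟨h0, hP⟩]

variable [Fintype I]

open scoped Classical in
theorem isJumpRep_restrictTarget {q : {x // P x} → {x // P x} → ℝ≥0∞}
    (hnn : ∀ a (s : {x // P x}), 0 ≤ ρ a s.1)
    (hq : ∀ s s', q s s' = ∑ a, if s'.1 = t a s.1 then ENNReal.ofReal (ρ a s.1) else 0) :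
    IsJumpRep q (fun a s => ρ a s.1) (restrictTarget ρ t) := by
  refine ⟨hnn, fun s s' hne => ?_⟩
  rw [hq]
  refine Finset.sum_congr rfl fun a _ => ?_
  by_cases h : 0 < ρ a s.1 ∧ P (t a s.1)
  · rw [restrictTarget, dif_pos h]
    simp only [Subtype.ext_iff]
  · rw [restrictTarget, dif_neg h, if_neg hne]
    split_ifs with he
    · have : ¬ 0 < ρ a s.1 := fun h0 => h ⟨h0, he ▸ s'.2⟩
      exact ENNReal.ofReal_of_nonpos (not_lt.1 this)
    · rfl

theorem gen_restrictTarget (hnn : ∀ a (s : {x // P x}), 0 ≤ ρ a s.1)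
    (hP : ∀ a (s : {x // P x}), 0 < ρ a s.1 → P (t a s.1)) (f : R → ℝ) (s : {x // P x}) :
    gen (fun a (s : {x // P x}) => ρ a s.1) (restrictTarget ρ t) (fun s => f s.1) s =
      ∑ a, ρ a s.1 * (f (t a s.1) - f s.1) := by
  refine Finset.sum_congr rfl fun a _ => ?_
  rcases (hnn a s).eq_or_lt with h | h
  · simp only [← h, zero_mul]
  · simp only
    rw [restrictTarget_val h (hP a s h)]

end Restriction

section Chains

variable {N : ℕ}

theorem leftRate_nonneg {cl : ℝ} (hcl : 0 ≤ cl) (i : Fin N) : 0 ≤ leftRate cl i := by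
  unfold leftRate; split_ifs <;> simp [hcl]

theorem rightRate_nonneg {cr : ℝ} (hcr : 0 ≤ cr) (i : Fin N) : 0 ≤ rightRate cr i := by
  unfold rightRate; split_ifs <;> simp [hcr]

/-- The kinds of jumps of the system with reservoirs: bulk jumps, creation and annihilation by the
left reservoir, creation and annihilation by the right reservoir. -/
abbrev ResIdx (N : ℕ) : Type := (Fin N × Fin N) ⊕ (Fin N ⊕ Fin N) ⊕ (Fin N ⊕ Fin N)

/-- The kinds of jumps of the dual system: bulk jumps, absorption on the left, absorption on the
right. -/
abbrev DualIdx (N : ℕ) : Type := (Fin N × Fin N) ⊕ Fin N ⊕ Fin N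

/-- Rates of the jumps of the system with reservoirs. -/
def resJumpRate (θ : ℝ) (p : Fin N → Fin N → ℝ) (cl cr ρl ρr : ℝ) (a : ResIdx N)
    (η : Fin N → ℕ) : ℝ :=
  match a with
  | .inl (i, j) => p i j * η i * (1 + θ * η j)
  | .inr (.inl (.inl i)) => leftRate cl i * (ρl * (1 + θ * η i))
  | .inr (.inl (.inr i)) => leftRate cl i * ((1 + θ * ρl) * η i)
  | .inr (.inr (.inl i)) => rightRate cr i * (ρr * (1 + θ * η i))
  | .inr (.inr (.inr i)) => rightRate cr i * ((1 + θ * ρr) * η i)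

/-- Targets of the jumps of the system with reservoirs. -/
def resJumpTarget (a : ResIdx N) (η : Fin N → ℕ) : Fin N → ℕ :=
  match a with
  | .inl (i, j) => move η i j
  | .inr (.inl (.inl i)) => η + Pi.single i 1
  | .inr (.inl (.inr i)) => η - Pi.single i 1
  | .inr (.inr (.inl i)) => η + Pi.single i 1
  | .inr (.inr (.inr i)) => η - Pi.single i 1

/-- Rates of the jumps of the dual system. -/
def dualJumpRate (θ : ℝ) (p : Fin N → Fin N → ℝ) (cl cr : ℝ) (a : DualIdx N)
    (ξ : Fin (N + 2) → ℕ) : ℝ :=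
  match a with
  | .inl (i, j) => p i j * ξ (bulk i) * (1 + θ * ξ (bulk j))
  | .inr (.inl i) => leftRate cl i * ξ (bulk i)
  | .inr (.inr i) => rightRate cr i * ξ (bulk i)

/-- Targets of the jumps of the dual system. -/
def dualJumpTarget (a : DualIdx N) (ξ : Fin (N + 2) → ℕ) : Fin (N + 2) → ℕ :=
  match a with
  | .inl (i, j) => move ξ (bulk i) (bulk j)
  | .inr (.inl i) => move ξ (bulk i) 0
  | .inr (.inr i) => move ξ (bulk i) (Fin.last (N + 1))

/-- The rates of the jumps of the system with reservoirs, on its state space. -/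
def resR (θ : ℝ) (p : Fin N → Fin N → ℝ) (cl cr ρl ρr : ℝ) (a : ResIdx N) (η : Config θ N) : ℝ :=
  resJumpRate θ p cl cr ρl ρr a η.1

/-- The jumps of the system with reservoirs, on its state space. -/
def resT (θ : ℝ) (p : Fin N → Fin N → ℝ) (cl cr ρl ρr : ℝ) (a : ResIdx N) (η : Config θ N) :
    Config θ N :=
  restrictTarget (P := fun η : Fin N → ℕ => ∀ i, AllowedOcc θ (η i))
    (resJumpRate θ p cl cr ρl ρr) resJumpTarget a η

/-- The rates of the jumps of the dual system, on its state space. -/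
def dualR (θ : ℝ) (p : Fin N → Fin N → ℝ) (cl cr : ℝ) (a : DualIdx N) (ξ : DualConfig θ N) : ℝ :=
  dualJumpRate θ p cl cr a ξ.1

/-- The jumps of the dual system, on its state space. -/
def dualT (θ : ℝ) (p : Fin N → Fin N → ℝ) (cl cr : ℝ) (a : DualIdx N) (ξ : DualConfig θ N) :
    DualConfig θ N :=
  restrictTarget (P := fun ξ : Fin (N + 2) → ℕ => ∀ i : Fin N, AllowedOcc θ (ξ (bulk i)))
    (dualJumpRate θ p cl cr) dualJumpTarget a ξ

theorem AdmissibleTheta.allowedOcc_move {θ : ℝ} (hθ : AdmissibleTheta θ) {ι : Type*}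
    [DecidableEq ι] {η : ι → ℕ} {i j k : ι} (hk : AllowedOcc θ (η k)) (hi : η i ≠ 0)
    (hj : k = j → 1 + θ * η j ≠ 0) : AllowedOcc θ (move η i j k) := by
  rcases eq_or_ne i j with rfl | hij
  · rwa [move_self_of_ne_zero hi]
  · rcases eq_or_ne k i with rfl | hki
    · rw [move_apply_left hij]; exact hk.mono (Nat.sub_le _ _)
    · rcases eq_or_ne k j with rfl | hkj
      · rw [move_apply_right hij]; exact hθ.allowedOcc_succ hk (hj rfl)
      · rwa [move_apply_of_ne hki hkj]

theorem AdmissibleTheta.allowedOcc_add_single {θ : ℝ} (hθ : AdmissibleTheta θ) {ι : Type*}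
    [DecidableEq ι] {η : ι → ℕ} {i k : ι} (hk : AllowedOcc θ (η k)) (hi : 1 + θ * η i ≠ 0) :
    AllowedOcc θ ((η + Pi.single i 1 : ι → ℕ) k) := by
  rcases eq_or_ne k i with rfl | hki
  · rw [add_single_apply_self]; exact hθ.allowedOcc_succ hk hi
  · rwa [add_single_apply_of_ne η hki]

theorem AllowedOcc.sub_single {θ : ℝ} {ι : Type*} [DecidableEq ι] {η : ι → ℕ} {k : ι}
    (hk : AllowedOcc θ (η k)) (i : ι) : AllowedOcc θ ((η - Pi.single i 1 : ι → ℕ) k) :=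
  hk.mono (Nat.sub_le _ _)

variable {θ : ℝ} {p : Fin N → Fin N → ℝ} {cl cr ρl ρr : ℝ}

theorem resJumpRate_nonneg (hθ : AdmissibleTheta θ) (hp : ∀ i j, 0 ≤ p i j) (hcl : 0 ≤ cl)
    (hcr : 0 ≤ cr) (hρl : 0 ≤ ρl) (hρr : 0 ≤ ρr) (hθl : 0 ≤ 1 + θ * ρl) (hθr : 0 ≤ 1 + θ * ρr)
    (a : ResIdx N) {η : Fin N → ℕ} (hη : ∀ i, AllowedOcc θ (η i)) :
    0 ≤ resJumpRate θ p cl cr ρl ρr a η := by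
  have h1 := fun i => hθ.one_add_mul_nonneg (hη i)
  have h2 := fun i : Fin N => leftRate_nonneg hcl i
  have h3 := fun i : Fin N => rightRate_nonneg hcr i
  rcases a with ⟨i, j⟩ | (i | i) | (i | i)
  · exact mul_nonneg (mul_nonneg (hp i j) (Nat.cast_nonneg _)) (h1 j)
  · exact mul_nonneg (h2 i) (mul_nonneg hρl (h1 i))
  · exact mul_nonneg (h2 i) (mul_nonneg hθl (Nat.cast_nonneg _))
  · exact mul_nonneg (h3 i) (mul_nonneg hρr (h1 i))
  · exact mul_nonneg (h3 i) (mul_nonneg hθr (Nat.cast_nonneg _))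

theorem dualJumpRate_nonneg (hθ : AdmissibleTheta θ) (hp : ∀ i j, 0 ≤ p i j) (hcl : 0 ≤ cl)
    (hcr : 0 ≤ cr) (a : DualIdx N) {ξ : Fin (N + 2) → ℕ} (hξ : ∀ i, AllowedOcc θ (ξ (bulk i))) :
    0 ≤ dualJumpRate θ p cl cr a ξ := by
  rcases a with ⟨i, j⟩ | i | i
  · exact mul_nonneg (mul_nonneg (hp i j) (Nat.cast_nonneg _)) (hθ.one_add_mul_nonneg (hξ j))
  · exact mul_nonneg (leftRate_nonneg hcl i) (Nat.cast_nonneg _)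
  · exact mul_nonneg (rightRate_nonneg hcr i) (Nat.cast_nonneg _)

theorem allowedOcc_resJumpTarget (hθ : AdmissibleTheta θ) (a : ResIdx N) {η : Fin N → ℕ}
    (hη : ∀ i, AllowedOcc θ (η i)) (h : resJumpRate θ p cl cr ρl ρr a η ≠ 0) (k : Fin N) :
    AllowedOcc θ (resJumpTarget a η k) := by
  rcases a with ⟨i, j⟩ | (i | i) | (i | i)
  · simp only [resJumpRate, mul_ne_zero_iff, Nat.cast_ne_zero] at h
    exact hθ.allowedOcc_move (hη k) h.1.2 fun _ => h.2
  · simp only [resJumpRate, mul_ne_zero_iff] at h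
    exact hθ.allowedOcc_add_single (hη k) h.2.2
  · exact (hη k).sub_single i
  · simp only [resJumpRate, mul_ne_zero_iff] at h
    exact hθ.allowedOcc_add_single (hη k) h.2.2
  · exact (hη k).sub_single i

theorem allowedOcc_dualJumpTarget (hθ : AdmissibleTheta θ) (a : DualIdx N)
    {ξ : Fin (N + 2) → ℕ} (hξ : ∀ i, AllowedOcc θ (ξ (bulk i)))
    (h : dualJumpRate θ p cl cr a ξ ≠ 0) (k : Fin N) :
    AllowedOcc θ (dualJumpTarget a ξ (bulk k)) := by
  rcases a with ⟨i, j⟩ | i | i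
  · simp only [dualJumpRate, mul_ne_zero_iff, Nat.cast_ne_zero] at h
    exact hθ.allowedOcc_move (hξ k) h.1.2 fun _ => h.2
  · simp only [dualJumpRate, mul_ne_zero_iff, Nat.cast_ne_zero] at h
    exact hθ.allowedOcc_move (hξ k) h.2 fun h0 => absurd h0 (bulk_ne_zero k)
  · simp only [dualJumpRate, mul_ne_zero_iff, Nat.cast_ne_zero] at h
    exact hθ.allowedOcc_move (hξ k) h.2 fun h0 => absurd h0 (bulk_ne_last k)

theorem isJumpRep_resRate (hθ : AdmissibleTheta θ) (hp : ∀ i j, 0 ≤ p i j) (hcl : 0 ≤ cl)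
    (hcr : 0 ≤ cr) (hρl : 0 ≤ ρl) (hρr : 0 ≤ ρr) (hθl : 0 ≤ 1 + θ * ρl) (hθr : 0 ≤ 1 + θ * ρr) :
    IsJumpRep (resRate θ p cl cr ρl ρr) (resR θ p cl cr ρl ρr) (resT θ p cl cr ρl ρr) := by
  classical
  refine isJumpRep_restrictTarget (P := fun η : Fin N → ℕ => ∀ i, AllowedOcc θ (η i))
    (fun a s => resJumpRate_nonneg hθ hp hcl hcr hρl hρr hθl hθr a s.2) fun s s' => ?_
  simp only [Fintype.sum_sum_type, Fintype.sum_prod_type, resJumpRate, resJumpTarget, resRate]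
  rw [add_assoc]
  congr 1
  · exact Finset.sum_congr rfl fun i _ => Finset.sum_congr rfl fun j _ => by congr
  · congr 1
    · rw [← Finset.sum_add_distrib]
      refine Finset.sum_congr rfl fun i _ => ?_
      unfold leftRate
      by_cases h : i.val = 0
      · simp only [h, if_true]
      · simp [h]
    · rw [← Finset.sum_add_distrib]
      refine Finset.sum_congr rfl fun i _ => ?_
      unfold rightRate
      by_cases h : i.val + 1 = N
      · simp only [h, if_true]
      · simp [h]

theorem isJumpRep_dualRate (hθ : AdmissibleTheta θ) (hp : ∀ i j, 0 ≤ p i j) (hcl : 0 ≤ cl)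
    (hcr : 0 ≤ cr) :
    IsJumpRep (dualRate θ p cl cr) (dualR θ p cl cr) (dualT θ p cl cr) := by
  classical
  refine isJumpRep_restrictTarget
    (P := fun ξ : Fin (N + 2) → ℕ => ∀ i : Fin N, AllowedOcc θ (ξ (bulk i)))
    (fun a s => dualJumpRate_nonneg hθ hp hcl hcr a s.2) fun s s' => ?_
  simp only [Fintype.sum_sum_type, Fintype.sum_prod_type, dualJumpRate, dualJumpTarget, dualRate,
    ← add_assoc]
  congr 1
  · congr 1
    · exact Finset.sum_congr rfl fun i _ => Finset.sum_congr rfl fun j _ => by congr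
    · refine Finset.sum_congr rfl fun i _ => ?_
      by_cases h1 : i.val = 0 <;> simp [leftRate, h1]
  · refine Finset.sum_congr rfl fun i _ => ?_
    by_cases h1 : i.val + 1 = N <;> simp [rightRate, h1]

theorem gen_res (hθ : AdmissibleTheta θ) (hp : ∀ i j, 0 ≤ p i j) (hcl : 0 ≤ cl)
    (hcr : 0 ≤ cr) (hρl : 0 ≤ ρl) (hρr : 0 ≤ ρr) (hθl : 0 ≤ 1 + θ * ρl) (hθr : 0 ≤ 1 + θ * ρr)
    (f : (Fin N → ℕ) → ℝ) (η : Config θ N) :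
    gen (resR θ p cl cr ρl ρr) (resT θ p cl cr ρl ρr) (fun η => f η.1) η =
      resGen θ p cl cr ρl ρr f η.1 := by
  refine (gen_restrictTarget (P := fun η : Fin N → ℕ => ∀ i, AllowedOcc θ (η i))
    (fun a s => resJumpRate_nonneg hθ hp hcl hcr hρl hρr hθl hθr a s.2)
    (fun a s h => allowedOcc_resJumpTarget hθ a s.2 h.ne') f η).trans ?_
  simp only [Fintype.sum_sum_type, Fintype.sum_prod_type, resJumpRate, resJumpTarget, resGen,
    ← add_assoc, Finset.sum_add_distrib]

theorem gen_dual (hθ : AdmissibleTheta θ) (hp : ∀ i j, 0 ≤ p i j) (hcl : 0 ≤ cl)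
    (hcr : 0 ≤ cr) (f : (Fin (N + 2) → ℕ) → ℝ) (ξ : DualConfig θ N) :
    gen (dualR θ p cl cr) (dualT θ p cl cr) (fun ξ => f ξ.1) ξ = dualGen θ p cl cr f ξ.1 := by
  refine (gen_restrictTarget
    (P := fun ξ : Fin (N + 2) → ℕ => ∀ i : Fin N, AllowedOcc θ (ξ (bulk i)))
    (fun a s => dualJumpRate_nonneg hθ hp hcl hcr a s.2)
    (fun a s h => allowedOcc_dualJumpTarget hθ a s.2 h.ne') f ξ).trans ?_
  simp only [Fintype.sum_sum_type, Fintype.sum_prod_type, dualJumpRate, dualJumpTarget, dualGen,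
    ← add_assoc]

instance (θ : ℝ) (N : ℕ) : Countable (Config θ N) :=
  inferInstanceAs (Countable {η : Fin N → ℕ // ∀ i, AllowedOcc θ (η i)})

instance (θ : ℝ) (N : ℕ) : Countable (DualConfig θ N) :=
  inferInstanceAs (Countable {ξ : Fin (N + 2) → ℕ // ∀ i : Fin N, AllowedOcc θ (ξ (bulk i))})

instance (θ : ℝ) (N : ℕ) : DiscreteMeasurableSpace (Config θ N) := ⟨fun _ => trivial⟩

end Chains

section Level

variable {N : ℕ}

theorem move_add_single {ι : Type*} [DecidableEq ι] {η : ι → ℕ} {i : ι} (h : η i ≠ 0) (j : ι) :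
    move η i j + Pi.single i 1 = η + Pi.single j 1 := by
  funext k
  by_cases hk : k = i
  · subst hk; simp [move]; omega
  · simp [move, hk]

theorem sum_fin_add_two {M : Type*} [AddCommMonoid M] (f : Fin (N + 2) → M) :
    ∑ s, f s = f 0 + ∑ i : Fin N, f (bulk i) + f (Fin.last (N + 1)) := by
  rw [Fin.sum_univ_castSucc, Fin.sum_univ_succ]
  rfl

/-- A total weight changes under a move by the difference of the weights of the two sites. -/
theorem sum_move_mul {ι : Type*} [Fintype ι] [DecidableEq ι] {M : Type*} [CommSemiring M]
    {η : ι → ℕ} {i : ι} (h : η i ≠ 0) (j : ι) (w : ι → M) :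
    ∑ k, (move η i j k : M) * w k + w i = ∑ k, (η k : M) * w k + w j := by
  have e := fun k => congrArg (fun ζ : ι → ℕ => (ζ k : M) * w k) (move_add_single h j)
  have e2 := Finset.sum_congr rfl fun k (_ : k ∈ Finset.univ) => e k
  simpa [add_mul, Finset.sum_add_distrib, Pi.single_apply] using e2

theorem finite_dualLevel (θ : ℝ) (N n : ℕ) : {ξ : DualConfig θ N | ∑ s, ξ.1 s = n}.Finite := by
  refine Set.Finite.of_finite_image (f := fun ξ => ξ.1) ?_ Subtype.val_injective.injOn
  refine (Set.finite_Icc (0 : Fin (N + 2) → ℕ) fun _ => n).subset ?_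
  rintro _ ⟨ξ, hξ, rfl⟩
  refine ⟨fun _ => Nat.zero_le _, fun s => ?_⟩
  rw [← show ∑ s, ξ.1 s = n from hξ]
  exact Finset.single_le_sum (f := ξ.1) (fun _ _ => Nat.zero_le _) (Finset.mem_univ s)

/-- The dual configurations with `n` particles. -/
def dualLevel (θ : ℝ) (N n : ℕ) : Finset (DualConfig θ N) := (finite_dualLevel θ N n).toFinset

theorem mem_dualLevel {θ : ℝ} {n : ℕ} {ξ : DualConfig θ N} :
    ξ ∈ dualLevel θ N n ↔ ∑ s, ξ.1 s = n := by
  simp [dualLevel]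

/-- The dual configurations all of whose particles are absorbed. -/
def absorbed (θ : ℝ) (N : ℕ) : Set (DualConfig θ N) := {ξ | ∀ i, ξ.1 (bulk i) = 0}

/-- Every site is connected to an active reservoir, along a path on which `d` decreases. -/
def IsRank (p : Fin N → Fin N → ℝ) (cl cr : ℝ) (d : Fin N → ℕ) : Prop :=
  ∀ i, 0 < leftRate cl i ∨ 0 < rightRate cr i ∨ ∃ j, 0 < p i j ∧ d j < d i

/-- The weight of a site of `V*` which is used to show absorption. -/
def siteWeight (d : Fin N → ℕ) (s : Fin (N + 2)) : ℕ :=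
  ∑ i, if s = bulk i then d i + 1 else 0

theorem siteWeight_bulk (d : Fin N → ℕ) (i : Fin N) : siteWeight d (bulk i) = d i + 1 := by
  simp [siteWeight, bulk_injective.eq_iff]

theorem siteWeight_zero (d : Fin N → ℕ) : siteWeight d 0 = 0 := by
  simp [siteWeight, (bulk_ne_zero _).symm]

theorem siteWeight_last (d : Fin N → ℕ) : siteWeight d (Fin.last (N + 1)) = 0 := by
  simp [siteWeight, (bulk_ne_last _).symm]

variable {θ : ℝ} {p : Fin N → Fin N → ℝ} {cl cr : ℝ}

theorem dualT_val (hθ : AdmissibleTheta θ) {a : DualIdx N} {ξ : DualConfig θ N}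
    (h : 0 < dualR θ p cl cr a ξ) : (dualT θ p cl cr a ξ).1 = dualJumpTarget a ξ.1 :=
  restrictTarget_val (P := fun ξ : Fin (N + 2) → ℕ => ∀ i : Fin N, AllowedOcc θ (ξ (bulk i)))
    h (allowedOcc_dualJumpTarget hθ a ξ.2 h.ne')

theorem dualT_eq_self {a : DualIdx N} {ξ : DualConfig θ N}
    (h : ¬ 0 < dualR θ p cl cr a ξ) : dualT θ p cl cr a ξ = ξ := by
  unfold dualT restrictTarget
  exact dif_neg fun h' => h h'.1

theorem dualT_mem_dualLevel (hθ : AdmissibleTheta θ) {n : ℕ} (a : DualIdx N) {ξ : DualConfig θ N}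
    (hξ : ξ ∈ dualLevel θ N n) : dualT θ p cl cr a ξ ∈ dualLevel θ N n := by
  by_cases h : 0 < dualR θ p cl cr a ξ
  · rw [mem_dualLevel] at hξ ⊢
    rw [dualT_val hθ h, ← hξ]
    have h' := h.ne'
    have key : ∀ {i : Fin N} (j : Fin (N + 2)), ξ.1 (bulk i) ≠ 0 →
        ∑ s, move ξ.1 (bulk i) j s = ∑ s, ξ.1 s := by
      intro i j hi
      have := sum_move_mul (M := ℕ) hi j fun _ => 1
      simpa using this
    rcases a with ⟨i, j⟩ | i | i
    · simp only [dualR, dualJumpRate, mul_ne_zero_iff, Nat.cast_ne_zero] at h'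
      exact key _ h'.1.2
    · simp only [dualR, dualJumpRate, mul_ne_zero_iff, Nat.cast_ne_zero] at h'
      exact key _ h'.2
    · simp only [dualR, dualJumpRate, mul_ne_zero_iff, Nat.cast_ne_zero] at h'
      exact key _ h'.2
  · rwa [dualT_eq_self h]

theorem dualR_eq_zero_of_absorbed {ξ : DualConfig θ N} (hξ : ξ ∈ absorbed θ N) (a : DualIdx N) :
    dualR θ p cl cr a ξ = 0 := by
  have h0 : ∀ i, ξ.1 (bulk i) = 0 := hξ
  rcases a with ⟨i, j⟩ | i | i <;> simp [dualR, dualJumpRate, h0]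

theorem isAbsorbed_dual (hθ : AdmissibleTheta θ) (hp : ∀ i j, 0 ≤ p i j) (hcl : 0 ≤ cl)
    (hcr : 0 ≤ cr) {d : Fin N → ℕ} (hd : IsRank p cl cr d) (n : ℕ) :
    IsAbsorbed (dualR θ p cl cr) (dualT θ p cl cr) (dualLevel θ N n) (absorbed θ N)
      (fun ξ => ∑ s, ξ.1 s * siteWeight d s) where
  nonneg a ξ := dualJumpRate_nonneg hθ hp hcl hcr a ξ.2
  mem a _ hξ := dualT_mem_dualLevel hθ a hξ
  stay _ _ hξ a := Or.inl (dualR_eq_zero_of_absorbed hξ a)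
  descent := by
    intro ξ _ hξ
    have hne : (Finset.univ.filter fun i : Fin N => ξ.1 (bulk i) ≠ 0).Nonempty := by
      by_contra h
      rw [Finset.not_nonempty_iff_eq_empty, Finset.filter_eq_empty_iff] at h
      exact hξ fun i => not_not.1 (h (Finset.mem_univ i))
    obtain ⟨i, hi, hmin⟩ := Finset.exists_min_image _ d hne
    have hi0 : ξ.1 (bulk i) ≠ 0 := (Finset.mem_filter.1 hi).2
    have hipos : (0 : ℝ) < ξ.1 (bulk i) := Nat.cast_pos.2 (Nat.pos_of_ne_zero hi0)
    rcases hd i with h | h | ⟨j, hj, hdj⟩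
    · have hr : 0 < dualR θ p cl cr (.inr (.inl i)) ξ := mul_pos h hipos
      refine ⟨_, hr, ?_⟩
      have := sum_move_mul (M := ℕ) hi0 0 (siteWeight d)
      rw [siteWeight_bulk, siteWeight_zero] at this
      simp only [dualT_val hθ hr, dualJumpTarget]
      simp only [Nat.cast_id] at this
      omega
    · have hr : 0 < dualR θ p cl cr (.inr (.inr i)) ξ := mul_pos h hipos
      refine ⟨_, hr, ?_⟩
      have := sum_move_mul (M := ℕ) hi0 (Fin.last (N + 1)) (siteWeight d)
      rw [siteWeight_bulk, siteWeight_last] at this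
      simp only [dualT_val hθ hr, dualJumpTarget]
      simp only [Nat.cast_id] at this
      omega
    · have hj0 : ξ.1 (bulk j) = 0 := by
        by_contra h0
        have := hmin j (by simpa using h0)
        omega
      have hr : 0 < dualR θ p cl cr (.inl (i, j)) ξ := by
        simp only [dualR, dualJumpRate, hj0]
        simpa using mul_pos hj hipos
      refine ⟨_, hr, ?_⟩
      have := sum_move_mul (M := ℕ) hi0 (bulk j) (siteWeight d)
      rw [siteWeight_bulk, siteWeight_bulk] at this
      simp only [dualT_val hθ hr, dualJumpTarget]
      simp only [Nat.cast_id] at this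
      omega

end Level

/-- The standing assumptions on the parameters. -/
structure ReservoirParams {N : ℕ} (θ : ℝ) (p : Fin N → Fin N → ℝ) (cl cr ρl ρr : ℝ) : Prop where
  adm : AdmissibleTheta θ
  p_nonneg : ∀ i j, 0 ≤ p i j
  symm : ∀ i j, p i j = p j i
  cl_nonneg : 0 ≤ cl
  cr_nonneg : 0 ≤ cr
  ρl_nonneg : 0 ≤ ρl
  ρr_nonneg : 0 ≤ ρr
  ρl_le : 0 ≤ 1 + θ * ρl
  ρr_le : 0 ≤ 1 + θ * ρr

section Finiteness

variable {θ : ℝ} {N : ℕ}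

theorem finite_config_le (θ : ℝ) (N M : ℕ) : {η : Config θ N | ∀ i, η.1 i ≤ M}.Finite := by
  refine Set.Finite.of_finite_image (f := fun η => η.1) ?_ Subtype.val_injective.injOn
  refine (Set.finite_Icc (0 : Fin N → ℕ) fun _ => M).subset ?_
  rintro _ ⟨η, hη, rfl⟩
  exact ⟨fun _ => Nat.zero_le _, hη⟩

theorem finite_config (N : ℕ) (hθ : θ < 0) : Finite (Config θ N) := by
  rw [← Set.finite_univ_iff]
  refine (finite_config_le θ N ⌊1 / |θ|⌋₊).subset fun η _ i => ?_
  exact Nat.le_floor (η.2 i hθ)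

theorem dualityFun_absorbed {ρl ρr : ℝ} {ξ : Fin (N + 2) → ℕ} (hξ : ∀ i, ξ (bulk i) = 0)
    (η : Fin N → ℕ) : dualityFun θ ρl ρr ξ η = ρl ^ ξ 0 * ρr ^ ξ (Fin.last (N + 1)) := by
  simp [dualityFun, hξ, singleDuality_zero]

theorem dualityFun_single {ρl ρr : ℝ} (n : ℕ) (i : Fin N) (η : Fin N → ℕ) :
    dualityFun θ ρl ρr (Pi.single (bulk i) n) η = singleDuality θ n (η i) := by
  rw [dualityFun, Finset.prod_eq_single i]
  · simp [(bulk_ne_zero i).symm, (bulk_ne_last i).symm]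
  · intro k _ hk
    simp [bulk_injective.ne hk, singleDuality_zero]
  · simp

theorem dualityFun_nonneg (hθ : AdmissibleTheta θ) {ρl ρr : ℝ} (hρl : 0 ≤ ρl) (hρr : 0 ≤ ρr)
    (ξ : DualConfig θ N) (η : Fin N → ℕ) : 0 ≤ dualityFun θ ρl ρr ξ.1 η :=
  mul_nonneg (mul_nonneg (pow_nonneg hρl _)
    (Finset.prod_nonneg fun i _ => hθ.singleDuality_nonneg (ξ.2 i))) (pow_nonneg hρr _)

theorem le_singleDuality (hθ : 0 ≤ θ) {n : ℕ} (hn : n ≠ 0) (m : ℕ) :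
    ((m : ℝ) + 1 - n) / ∏ j ∈ Finset.range n, (1 + θ * (j : ℝ)) ≤ singleDuality θ n m := by
  unfold singleDuality
  refine div_le_div_of_nonneg_right ?_ (Finset.prod_nonneg fun j _ => by positivity)
  rcases le_or_gt n (m + 1) with h | h
  · have h1 : m + 1 - n ≤ m.descFactorial n :=
      (Nat.le_self_pow hn _).trans (Nat.pow_sub_le_descFactorial m n)
    have h2 : ((m + 1 - n : ℕ) : ℝ) ≤ m.descFactorial n := Nat.cast_le.2 h1
    rw [Nat.cast_sub h] at h2
    push_cast at h2
    exact h2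
  · have h1 : (m : ℝ) + 1 < n := by exact_mod_cast h
    have h2 : (0 : ℝ) ≤ m.descFactorial n := Nat.cast_nonneg _
    linarith

end Finiteness

section Stationary

variable {N : ℕ} {θ : ℝ} {p : Fin N → Fin N → ℝ} {cl cr ρl ρr : ℝ} {μ : Measure (Config θ N)}
  {d : Fin N → ℕ}

namespace ReservoirParams

theorem isJumpRep_res (h : ReservoirParams θ p cl cr ρl ρr) :
    IsJumpRep (resRate θ p cl cr ρl ρr) (resR θ p cl cr ρl ρr) (resT θ p cl cr ρl ρr) :=
  isJumpRep_resRate h.adm h.p_nonneg h.cl_nonneg h.cr_nonneg h.ρl_nonneg h.ρr_nonneg h.ρl_le h.ρr_le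

theorem isJumpRep_dual (h : ReservoirParams θ p cl cr ρl ρr) :
    IsJumpRep (dualRate θ p cl cr) (dualR θ p cl cr) (dualT θ p cl cr) :=
  isJumpRep_dualRate h.adm h.p_nonneg h.cl_nonneg h.cr_nonneg

theorem isAbsorbed (h : ReservoirParams θ p cl cr ρl ρr) (hd : IsRank p cl cr d) (n : ℕ) :
    IsAbsorbed (dualR θ p cl cr) (dualT θ p cl cr) (dualLevel θ N n) (absorbed θ N)
      (fun ξ => ∑ s, ξ.1 s * siteWeight d s) :=
  isAbsorbed_dual h.adm h.p_nonneg h.cl_nonneg h.cr_nonneg hd n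

theorem gen_duality (h : ReservoirParams θ p cl cr ρl ρr) (ξ : DualConfig θ N) (η : Config θ N) :
    gen (resR θ p cl cr ρl ρr) (resT θ p cl cr ρl ρr) (fun η => dualityFun θ ρl ρr ξ.1 η.1) η =
      gen (dualR θ p cl cr) (dualT θ p cl cr) (fun ξ => dualityFun θ ρl ρr ξ.1 η.1) ξ := by
  rw [gen_res h.adm h.p_nonneg h.cl_nonneg h.cr_nonneg h.ρl_nonneg h.ρr_nonneg h.ρl_le h.ρr_le,
    gen_dual h.adm h.p_nonneg h.cl_nonneg h.cr_nonneg fun ξ => dualityFun θ ρl ρr ξ η.1]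
  exact h.adm.resGen_dualityFun h.symm cl cr ξ.2 η.2

theorem dualityFun_nonneg (h : ReservoirParams θ p cl cr ρl ρr) (ξ : DualConfig θ N)
    (η : Fin N → ℕ) : 0 ≤ dualityFun θ ρl ρr ξ.1 η :=
  ReservoirChain.dualityFun_nonneg h.adm h.ρl_nonneg h.ρr_nonneg ξ η

theorem finite_sublevel (h : ReservoirParams θ p cl cr ρl ρr) {n : ℕ} (hn : n ≠ 0)
    {c : DualConfig θ N → ℝ} (hc : ∀ ξ, 0 ≤ c ξ)
    (hcpos : ∀ ξ ∈ dualLevel θ N n, ξ ∉ absorbed θ N → 0 < c ξ) (K : ℕ) :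
    {η : Config θ N | ∑ ξ ∈ dualLevel θ N n, c ξ * dualityFun θ ρl ρr ξ.1 η.1 < K}.Finite := by
  rcases lt_or_ge θ 0 with hθ | hθ
  · have := finite_config N hθ
    exact Set.toFinite _
  · set P : ℝ := ∏ j ∈ Finset.range n, (1 + θ * (j : ℝ)) with hP
    have hPpos : 0 < P := Finset.prod_pos fun j _ => by positivity
    let X : Fin N → DualConfig θ N := fun i =>
      ⟨Pi.single (bulk i) n, fun _ => allowedOcc_of_nonneg hθ _⟩
    have hX : ∀ i, X i ∈ dualLevel θ N n := fun i => by
      rw [mem_dualLevel]; simp [X]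
    have hXa : ∀ i, X i ∉ absorbed θ N := fun i h0 => by
      have : (X i).1 (bulk i) = 0 := h0 i
      simp [X] at this
      exact hn this
    refine (finite_config_le θ N (∑ i, ⌈n + K * P / c (X i)⌉₊)).subset fun η hη i => ?_
    have h1 : c (X i) * singleDuality θ n (η.1 i) < K := by
      refine lt_of_le_of_lt ?_ hη
      rw [← dualityFun_single (ρl := ρl) (ρr := ρr)]
      exact Finset.single_le_sum (f := fun ξ : DualConfig θ N => c ξ * dualityFun θ ρl ρr ξ.1 η.1)
        (fun ξ _ => mul_nonneg (hc ξ) (h.dualityFun_nonneg ξ _)) (hX i)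
    have h2 := le_singleDuality hθ hn (η.1 i)
    rw [← hP] at h2
    have hci := hcpos _ (hX i) (hXa i)
    have h3 : (η.1 i : ℝ) ≤ n + K * P / c (X i) := by
      have h4 : ((η.1 i : ℝ) + 1 - n) / P ≤ K / c (X i) := by
        refine h2.trans ?_
        rw [le_div_iff₀ hci, mul_comm]
        exact h1.le
      rw [div_le_iff₀ hPpos] at h4
      have : (K : ℝ) / c (X i) * P = K * P / c (X i) := by ring
      linarith
    have h5 : η.1 i ≤ ⌈n + K * P / c (X i)⌉₊ := Nat.cast_le.1 (h3.trans (Nat.le_ceil _))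
    exact h5.trans (Finset.single_le_sum (f := fun i => ⌈n + K * P / c (X i)⌉₊)
      (fun _ _ => Nat.zero_le _) (Finset.mem_univ i))

theorem integrable_sum_dualityFun (h : ReservoirParams θ p cl cr ρl ρr) (hd : IsRank p cl cr d)
    (hμ : IsStationary (resRate θ p cl cr ρl ρr) μ) {n : ℕ} (hn : n ≠ 0) :
    Integrable (fun η => ∑ ξ ∈ dualLevel θ N n, dualityFun θ ρl ρr ξ.1 η.1) μ := by
  classical
  have := hμ.1
  obtain ⟨ω, hω, hωf⟩ := (h.isAbsorbed hd n).exists_pos_functional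
  set c : DualConfig θ N → ℝ := fun ξ =>
    if ξ ∈ dualLevel θ N n ∧ ξ ∉ absorbed θ N then ω ξ else 0 with hc
  have hcn : ∀ ξ, 0 ≤ c ξ := by
    intro ξ
    simp only [hc]
    split_ifs with h0
    · exact (hω ξ h0.1).le
    · rfl
  refine h.isJumpRep_res.integrable_of_lyapunov hμ.balance
    (H := fun η => ∑ ξ ∈ dualLevel θ N n, c ξ * dualityFun θ ρl ρr ξ.1 η.1)
    (C := ∑ ξ ∈ dualLevel θ N n,
      if ξ ∈ absorbed θ N then ω ξ * (ρl ^ ξ.1 0 * ρr ^ ξ.1 (Fin.last (N + 1))) else 0)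
    (fun η => Finset.sum_nonneg fun ξ _ => h.dualityFun_nonneg ξ _) (fun η => le_of_eq ?_)
    (h.finite_sublevel hn hcn fun ξ h1 h2 => ?_)
  · rw [gen_sum, ← hωf fun ξ => dualityFun θ ρl ρr ξ.1 η.1, ← Finset.sum_sub_distrib]
    refine Finset.sum_congr rfl fun ξ hξ => ?_
    rw [gen_const_mul, h.gen_duality, dirichletOp]
    by_cases hZ : ξ ∈ absorbed θ N
    · simp [hc, hZ, dualityFun_absorbed (show ∀ i, ξ.1 (bulk i) = 0 from hZ)]
    · simp [hc, hZ, hξ]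
  · simp only [hc]
    rw [if_pos ⟨h1, h2⟩]
    exact hω ξ h1

theorem integrable_dualityFun (h : ReservoirParams θ p cl cr ρl ρr) (hd : IsRank p cl cr d)
    (hμ : IsStationary (resRate θ p cl cr ρl ρr) μ) (ξ : DualConfig θ N) :
    Integrable (fun η => dualityFun θ ρl ρr ξ.1 η.1) μ := by
  have := hμ.1
  by_cases hn : ∑ s, ξ.1 s = 0
  · have h0 : ∀ s, ξ.1 s = 0 := fun s => Finset.sum_eq_zero_iff.1 hn s (Finset.mem_univ s)
    simp_rw [dualityFun_absorbed fun i => h0 (bulk i)]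
    exact integrable_const _
  · refine (h.integrable_sum_dualityFun hd hμ hn).mono' Measurable.of_discrete.aestronglyMeasurable
      (Eventually.of_forall fun η => ?_)
    rw [Real.norm_of_nonneg (h.dualityFun_nonneg ξ _)]
    exact Finset.single_le_sum (f := fun ξ : DualConfig θ N => dualityFun θ ρl ρr ξ.1 η.1)
      (fun ξ _ => h.dualityFun_nonneg ξ _) (mem_dualLevel.2 rfl)

theorem _root_.ReservoirChain.cast_mul_dualityFun (hθ : AdmissibleTheta θ) (ξ : Fin (N + 2) → ℕ)
    {η : Fin N → ℕ} (hη : ∀ i, AllowedOcc θ (η i)) (i : Fin N) :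
    η i * dualityFun θ ρl ρr ξ η = ξ (bulk i) * dualityFun θ ρl ρr ξ η +
      (1 + θ * ξ (bulk i)) * dualityFun θ ρl ρr (ξ + Pi.single (bulk i) 1) η := by
  rw [dualityFun_eq_single θ ρl ρr i, dualityFun_eq_single θ ρl ρr i (ξ + Pi.single (bulk i) 1),
    add_single_apply_self,
    dualityRest_congr (ξ := ξ) (η := η) (add_single_apply_of_ne ξ (bulk_ne_zero i).symm)
      (add_single_apply_of_ne ξ (bulk_ne_last i).symm)
      (fun k hk => add_single_apply_of_ne ξ (bulk_injective.ne (by simpa using hk)))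
      fun _ _ => rfl]
  linear_combination dualityRest θ ρl ρr {i} ξ η * hθ.cast_mul_singleDuality (a := ξ (bulk i)) (hη i)

theorem integrable_occupation_mul (h : ReservoirParams θ p cl cr ρl ρr) (hd : IsRank p cl cr d)
    (hμ : IsStationary (resRate θ p cl cr ρl ρr) μ) (hθ : 0 ≤ θ) (ξ : Fin (N + 2) → ℕ)
    (i : Fin N) : Integrable (fun η => (η.1 i : ℝ) * dualityFun θ ρl ρr ξ η.1) μ := by
  simp_rw [fun η : Config θ N => cast_mul_dualityFun (ρl := ρl) (ρr := ρr) h.adm ξ η.2 i]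
  have hD : ∀ ξ : Fin (N + 2) → ℕ, Integrable (fun η => dualityFun θ ρl ρr ξ η.1) μ := fun ξ =>
    h.integrable_dualityFun hd hμ ⟨ξ, fun _ => allowedOcc_of_nonneg hθ _⟩
  exact ((hD _).const_mul _).add ((hD _).const_mul _)

theorem integrable_occupation_mul_mul (h : ReservoirParams θ p cl cr ρl ρr)
    (hd : IsRank p cl cr d)
    (hμ : IsStationary (resRate θ p cl cr ρl ρr) μ) (hθ : 0 ≤ θ) (ξ : Fin (N + 2) → ℕ)
    (i j : Fin N) :
    Integrable (fun η => (η.1 j : ℝ) * ((η.1 i : ℝ) * dualityFun θ ρl ρr ξ η.1)) μ := by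
  simp_rw [fun η : Config θ N => cast_mul_dualityFun (ρl := ρl) (ρr := ρr) h.adm ξ η.2 i, mul_add,
    mul_left_comm]
  have hD := h.integrable_occupation_mul hd hμ hθ
  exact ((hD _ j).const_mul _).add ((hD _ j).const_mul _)

theorem integrable_exitRate_mul (h : ReservoirParams θ p cl cr ρl ρr)
    (hd : IsRank p cl cr d) (hμ : IsStationary (resRate θ p cl cr ρl ρr) μ) (ξ : DualConfig θ N) :
    Integrable (fun η => exitRate (resRate θ p cl cr ρl ρr) η * dualityFun θ ρl ρr ξ.1 η.1) μ := by
  have := hμ.1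
  rcases lt_or_ge θ 0 with hθ | hθ
  · have := finite_config N hθ
    exact Integrable.of_finite
  · have hD0 := h.integrable_dualityFun hd hμ ξ
    have hD1 := h.integrable_occupation_mul hd hμ hθ ξ.1
    have hD2 := h.integrable_occupation_mul_mul hd hμ hθ ξ.1
    have hint : Integrable (fun η => ∑ a, resR θ p cl cr ρl ρr a η *
        dualityFun θ ρl ρr ξ.1 η.1) μ := by
      refine integrable_finsetSum _ fun a _ => ?_
      have hlin : ∀ (i : Fin N) (c e : ℝ), Integrable (fun η : Config θ N =>
          c * ((1 + θ * η.1 i) * e) * dualityFun θ ρl ρr ξ.1 η.1) μ := by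
        intro i c e
        refine ((hD0.const_mul (c * e)).add ((hD1 i).const_mul (c * e * θ))).congr
          (Eventually.of_forall fun η => ?_)
        simp only [Pi.add_apply]; ring
      rcases a with ⟨i, j⟩ | (i | i) | (i | i)
      · refine (((hD1 i).const_mul (p i j)).add ((hD2 i j).const_mul (p i j * θ))).congr
          (Eventually.of_forall fun η => ?_)
        simp only [resR, resJumpRate, Pi.add_apply]; ring
      · refine (hlin i (leftRate cl i) ρl).congr (Eventually.of_forall fun η => ?_)
        simp only [resR, resJumpRate]; ring
      · refine ((hD1 i).const_mul (leftRate cl i * (1 + θ * ρl))).congr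
          (Eventually.of_forall fun η => ?_)
        simp only [resR, resJumpRate]; ring
      · refine (hlin i (rightRate cr i) ρr).congr (Eventually.of_forall fun η => ?_)
        simp only [resR, resJumpRate]; ring
      · refine ((hD1 i).const_mul (rightRate cr i * (1 + θ * ρr))).congr
          (Eventually.of_forall fun η => ?_)
        simp only [resR, resJumpRate]; ring
    refine hint.mono' Measurable.of_discrete.aestronglyMeasurable (Eventually.of_forall fun η => ?_)
    classical
    rw [Real.norm_of_nonneg (mul_nonneg (exitRate_nonneg _ _) (h.dualityFun_nonneg ξ _)),
      h.isJumpRep_res.exitRate_eq, ← Finset.sum_mul]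
    refine mul_le_mul_of_nonneg_right (Finset.sum_le_sum fun a _ => ?_) (h.dualityFun_nonneg ξ _)
    split_ifs
    · exact h.isJumpRep_res.nonneg a η
    · rfl

/-- The stationary expectation of the duality function solves the Dirichlet problem of the dual
system. -/
theorem dirichletOp_integral (h : ReservoirParams θ p cl cr ρl ρr)
    (hd : IsRank p cl cr d) (hμ : IsStationary (resRate θ p cl cr ρl ρr) μ) (ξ : DualConfig θ N) :
    dirichletOp (dualR θ p cl cr) (dualT θ p cl cr) (absorbed θ N)
      (fun ξ => ∫ η, dualityFun θ ρl ρr ξ.1 η.1 ∂μ) ξ =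
      open scoped Classical in
      if ξ ∈ absorbed θ N then ρl ^ ξ.1 0 * ρr ^ ξ.1 (Fin.last (N + 1)) else 0 := by
  have := hμ.1
  unfold dirichletOp
  split_ifs with hZ
  · simp_rw [dualityFun_absorbed (show ∀ i, ξ.1 (bulk i) = 0 from hZ)]
    simp
  · have hD := h.integrable_dualityFun hd hμ
    obtain ⟨_, h0⟩ := h.isJumpRep_res.integral_gen_eq_zero hμ.balance
      (fun η => h.dualityFun_nonneg ξ η.1) (h.integrable_exitRate_mul hd hμ ξ)
    simp_rw [h.gen_duality] at h0
    simp only [gen] at h0 ⊢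
    rw [neg_eq_zero, ← h0]
    refine Eq.trans ?_ (integral_finsetSum _ fun a _ =>
      show Integrable (fun η => dualR θ p cl cr a ξ *
        (dualityFun θ ρl ρr (dualT θ p cl cr a ξ).1 η.1 - dualityFun θ ρl ρr ξ.1 η.1)) μ from
        ((hD _).sub (hD _)).const_mul _).symm
    refine Finset.sum_congr rfl fun a _ => ?_
    rw [integral_const_mul, integral_sub (hD _) (hD _)]

end ReservoirParams

end Stationary

section BalanceTest

variable {S : Type*} [Countable S] [MeasurableSpace S] [DiscreteMeasurableSpace S]

open scoped Classical in
theorem balance_of_lintegral_jumpSum {q : S → S → ℝ≥0∞} {μ : Measure S} (j : S)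
    (h : ∫⁻ k, jumpSum q (fun s => ENNReal.ofReal (if s = j then 1 else 0)) k ∂μ =
      ∫⁻ k, ENNReal.ofReal (exitRate q k * if k = j then 1 else 0) ∂μ) :
    inflow q (fun k => μ {k}) j = ENNReal.ofReal (exitRate q j) * μ {j} := by
  rw [lintegral_eq_tsum_singleton, lintegral_eq_tsum_singleton, ← tsum_mul_inflow,
    tsum_eq_single j (fun k hk => by simp [hk]), tsum_eq_single j (fun k hk => by simp [hk])] at h
  simpa [mul_comm] using h

end BalanceTest

section Rank

variable {N : ℕ} {p : Fin N → Fin N → ℝ} {cl cr ρl ρr : ℝ}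

/-- The sites from which an active reservoir can be reached in at most `k + 1` steps. -/
def reachSet (p : Fin N → Fin N → ℝ) (cl cr : ℝ) : ℕ → Set (Fin N)
  | 0 => {i | 0 < leftRate cl i ∨ 0 < rightRate cr i}
  | k + 1 => reachSet p cl cr k ∪ {i | ∃ j ∈ reachSet p cl cr k, 0 < p i j}

open scoped Classical in
theorem exists_isRank (h : ∀ i, ∃ k, i ∈ reachSet p cl cr k) : ∃ d, IsRank p cl cr d := by
  refine ⟨fun i => Nat.find (h i), fun i => ?_⟩
  have hs := Nat.find_spec (h i)
  rcases hk : Nat.find (h i) with _ | k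
  · rw [hk] at hs
    rcases hs with hs | hs
    · exact Or.inl hs
    · exact Or.inr (Or.inl hs)
  · rw [hk] at hs
    rcases hs with hs | ⟨j, hj, hpj⟩
    · exact absurd hs (Nat.find_min (h i) (by omega))
    · refine Or.inr (Or.inr ⟨j, hpj, ?_⟩)
      change Nat.find (h j) < Nat.find (h i)
      rw [hk]
      exact Nat.lt_succ_of_le (Nat.find_min' (h j) hj)

/-- Adding a particle uniformly on a set of sites which is not connected to its complement nor to
the reservoirs commutes with the dynamics of independent particles. -/
theorem resGen_zero_sum_add_single (hsymm : ∀ i j, p i j = p j i) {C : Finset (Fin N)}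
    (hCl : ∀ i ∈ C, leftRate cl i = 0) (hCr : ∀ i ∈ C, rightRate cr i = 0)
    (hCp : ∀ i ∈ C, ∀ j ∉ C, p i j = 0) (f : (Fin N → ℕ) → ℝ) (η : Fin N → ℕ) :
    resGen 0 p cl cr ρl ρr (fun η => ∑ i ∈ C, f (η + Pi.single i 1)) η =
      ∑ i ∈ C, resGen 0 p cl cr ρl ρr f (η + Pi.single i 1) := by
  classical
  have hbulk : ∀ i ∈ C, ∑ a, ∑ b, p a b * ((η + Pi.single i 1 : Fin N → ℕ) a : ℝ) *
      (1 + 0 * ((η + Pi.single i 1 : Fin N → ℕ) b : ℝ)) *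
        (f (move (η + Pi.single i 1) a b) - f (η + Pi.single i 1)) =
      (∑ a, ∑ b, p a b * η a * (1 + 0 * η b) *
        (f (move η a b + Pi.single i 1) - f (η + Pi.single i 1))) +
      ∑ b, p i b * (f (η + Pi.single b 1) - f (η + Pi.single i 1)) := by
    intro i _
    have e1 : ∑ b, p i b * (f (η + Pi.single b 1) - f (η + Pi.single i 1)) =
        ∑ a, ∑ b, (if a = i then p a b * (f (η + Pi.single b 1) - f (η + Pi.single i 1)) else 0) :=
      ((Finset.sum_eq_single i (fun a _ ha => by simp [ha]) (by simp)).trans (by simp)).symm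
    rw [e1, ← Finset.sum_add_distrib]
    refine Finset.sum_congr rfl fun a _ => ?_
    rw [← Finset.sum_add_distrib]
    refine Finset.sum_congr rfl fun b _ => ?_
    have e2 : (η a : ℝ) * f (move (η + Pi.single i 1) a b) =
        η a * f (move η a b + Pi.single i 1) := by
      by_cases h0 : η a = 0
      · simp [h0]
      · congr 2
        funext k
        simp only [move, Pi.add_apply, Pi.sub_apply, Pi.single_apply]
        by_cases hk : k = a
        · subst hk; simp; omega
        · simp [hk]; omega
    by_cases ha : a = i
    · subst ha
      have e3 : move (η + Pi.single a 1) a b = η + Pi.single b 1 := by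
        simp [move]
      rw [e3] at e2
      rw [e3, if_pos rfl, add_single_apply_self]
      push_cast
      linear_combination p a b * e2
    · rw [if_neg ha, add_single_apply_of_ne η ha]
      linear_combination p a b * e2
  have hkill : ∀ (c : Fin N → ℝ) (ρ : ℝ), (∀ i ∈ C, c i = 0) → ∀ i ∈ C, ∀ a,
      c a * (ρ * (1 + 0 * ((η + Pi.single i 1 : Fin N → ℕ) a : ℝ))) *
          (f (η + Pi.single i 1 + Pi.single a 1) - f (η + Pi.single i 1)) +
        c a * ((1 + 0 * ρ) * ((η + Pi.single i 1 : Fin N → ℕ) a : ℝ)) *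
          (f (η + Pi.single i 1 - Pi.single a 1) - f (η + Pi.single i 1)) =
      c a * (ρ * (1 + 0 * η a)) *
          (f (η + Pi.single a 1 + Pi.single i 1) - f (η + Pi.single i 1)) +
        c a * ((1 + 0 * ρ) * η a) *
          (f (η - Pi.single a 1 + Pi.single i 1) - f (η + Pi.single i 1)) := by
    intro c ρ hc i hi a
    by_cases ha : a = i
    · rw [ha, hc i hi]; ring
    · rw [add_single_apply_of_ne η ha, add_right_comm η]
      have e2 : (η a : ℝ) * f (η + Pi.single i 1 - Pi.single a 1) =
          η a * f (η - Pi.single a 1 + Pi.single i 1) := by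
        by_cases h0 : η a = 0
        · simp [h0]
        · congr 2
          funext k
          simp only [Pi.add_apply, Pi.sub_apply, Pi.single_apply]
          by_cases hk : k = a
          · subst hk; simp; omega
          · simp [hk]
      linear_combination c a * e2
  have hanti : ∑ i ∈ C, ∑ b, p i b * (f (η + Pi.single b 1) - f (η + Pi.single i 1)) = 0 := by
    rw [← sum_sum_eq_zero_of_antisymm (fun i b => if i ∈ C then p i b else 0)
      (fun i b => f (η + Pi.single b 1) - f (η + Pi.single i 1)) (fun i j => ?_)
      (fun i j => by ring), ← Finset.sum_subset (Finset.subset_univ C)]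
    · refine Finset.sum_congr rfl fun i hi => Finset.sum_congr rfl fun b _ => ?_
      simp [hi]
    · intro i _ hi
      simp [hi]
    · by_cases hi : i ∈ C <;> by_cases hj : j ∈ C
      · simp [hi, hj, hsymm i j]
      · simp [hi, hj, hCp i hi j hj]
      · simp [hi, hj, hCp j hj i hi]
      · simp [hi, hj]
  have hterm : ∀ i ∈ C, resGen 0 p cl cr ρl ρr f (η + Pi.single i 1) =
      (∑ a, ∑ b, p a b * η a * (1 + 0 * η b) *
        (f (move η a b + Pi.single i 1) - f (η + Pi.single i 1))) +
      (∑ b, p i b * (f (η + Pi.single b 1) - f (η + Pi.single i 1))) +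
      (∑ a, (leftRate cl a * (ρl * (1 + 0 * η a)) *
          (f (η + Pi.single a 1 + Pi.single i 1) - f (η + Pi.single i 1)) +
        leftRate cl a * ((1 + 0 * ρl) * η a) *
          (f (η - Pi.single a 1 + Pi.single i 1) - f (η + Pi.single i 1)))) +
      (∑ a, (rightRate cr a * (ρr * (1 + 0 * η a)) *
          (f (η + Pi.single a 1 + Pi.single i 1) - f (η + Pi.single i 1)) +
        rightRate cr a * ((1 + 0 * ρr) * η a) *
          (f (η - Pi.single a 1 + Pi.single i 1) - f (η + Pi.single i 1)))) := by
    intro i hi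
    rw [resGen, hbulk i hi, Finset.sum_congr rfl fun a _ => hkill (leftRate cl) ρl hCl i hi a,
      Finset.sum_congr rfl fun a _ => hkill (rightRate cr) ρr hCr i hi a]
  have hres : ∀ (c : Fin N → ℝ) (ρ : ℝ),
      ∑ a, (c a * (ρ * (1 + 0 * (η a : ℝ))) *
          (∑ i ∈ C, f (η + Pi.single a 1 + Pi.single i 1) - ∑ i ∈ C, f (η + Pi.single i 1)) +
        c a * ((1 + 0 * ρ) * (η a : ℝ)) *
          (∑ i ∈ C, f (η - Pi.single a 1 + Pi.single i 1) - ∑ i ∈ C, f (η + Pi.single i 1))) =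
      ∑ i ∈ C, ∑ a, (c a * (ρ * (1 + 0 * (η a : ℝ))) *
          (f (η + Pi.single a 1 + Pi.single i 1) - f (η + Pi.single i 1)) +
        c a * ((1 + 0 * ρ) * (η a : ℝ)) *
          (f (η - Pi.single a 1 + Pi.single i 1) - f (η + Pi.single i 1))) := by
    intro c ρ
    rw [Finset.sum_comm]
    refine Finset.sum_congr rfl fun a _ => ?_
    rw [Finset.sum_add_distrib, ← Finset.mul_sum, ← Finset.mul_sum, Finset.sum_sub_distrib,
      Finset.sum_sub_distrib]
  refine Eq.trans ?_ (Finset.sum_congr (s₁ := C) rfl hterm).symm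
  rw [Finset.sum_add_distrib, Finset.sum_add_distrib,
    Finset.sum_add_distrib, hanti, add_zero, resGen, hres, hres]
  congr 2
  symm
  rw [Finset.sum_comm]
  refine Finset.sum_congr rfl fun a _ => ?_
  rw [Finset.sum_comm]
  refine Finset.sum_congr rfl fun b _ => ?_
  rw [← Finset.mul_sum, Finset.sum_sub_distrib]

/-- Independent particles with reservoirs do not explode. -/
theorem tsum_transProb_resRate_zero (h : ReservoirParams 0 p cl cr ρl ρr) {t : ℝ} (ht : 0 ≤ t)
    (η : Config 0 N) : ∑' η', transProb (resRate 0 p cl cr ρl ρr) t η η' = 1 := by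
  classical
  have hnn : ∀ η : Fin N → ℕ, 0 ≤ ∑ i, (η i : ℝ) := fun η =>
    Finset.sum_nonneg fun i _ => Nat.cast_nonneg _
  have hle : ∀ (η : Fin N → ℕ) i, (η i : ℝ) ≤ ∑ i, (η i : ℝ) := fun η i =>
    Finset.single_le_sum (f := fun i => (η i : ℝ)) (fun i _ => Nat.cast_nonneg _)
      (Finset.mem_univ i)
  have hL := fun i : Fin N => leftRate_nonneg h.cl_nonneg i
  have hR := fun i : Fin N => rightRate_nonneg h.cr_nonneg i
  have hp := h.p_nonneg
  have hρl := h.ρl_nonneg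
  have hρr := h.ρr_nonneg
  refine h.isJumpRep_res.tsum_transProb_eq_one_of_lyapunov
    (f := fun η => (fun η : Fin N → ℕ => 1 + ∑ i, (η i : ℝ)) η.1)
    (A := ∑ a : ResIdx N, match a with
      | .inl (i, j) => p i j
      | .inr (.inl (.inl i)) => leftRate cl i * ρl
      | .inr (.inl (.inr i)) => leftRate cl i
      | .inr (.inr (.inl i)) => rightRate cr i * ρr
      | .inr (.inr (.inr i)) => rightRate cr i)
    (B := ∑ i : Fin N, leftRate cl i * ρl + ∑ i : Fin N, rightRate cr i * ρr)
    (fun η => by have := hnn η.1; positivity) (fun η => ?_) (fun η => ?_) ht η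
  · rw [h.isJumpRep_res.exitRate_eq, Finset.sum_mul]
    refine Finset.sum_le_sum fun a _ => ?_
    have h1 := hnn η.1
    have h2 := hle η.1
    have h3 : (if resT 0 p cl cr ρl ρr a η = η then 0 else resR 0 p cl cr ρl ρr a η) ≤
        resR 0 p cl cr ρl ρr a η := by
      split_ifs
      · exact h.isJumpRep_res.nonneg a η
      · rfl
    refine h3.trans ?_
    rcases a with ⟨i, j⟩ | (i | i) | (i | i) <;> simp only [resR, resJumpRate, zero_mul, add_zero,
      mul_one, one_mul]
    · exact mul_le_mul_of_nonneg_left (by linarith [h2 i]) (hp i j)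
    · exact le_mul_of_one_le_right (mul_nonneg (hL i) hρl) (by linarith)
    · exact mul_le_mul_of_nonneg_left (by linarith [h2 i]) (hL i)
    · exact le_mul_of_one_le_right (mul_nonneg (hR i) hρr) (by linarith)
    · exact mul_le_mul_of_nonneg_left (by linarith [h2 i]) (hR i)
  · refine (gen_res h.adm h.p_nonneg h.cl_nonneg h.cr_nonneg h.ρl_nonneg h.ρr_nonneg h.ρl_le h.ρr_le
      (fun η : Fin N → ℕ => 1 + ∑ i, (η i : ℝ)) η).trans_le ?_
    have hadd : ∀ i, ∑ k, ((η.1 + Pi.single i 1 : Fin N → ℕ) k : ℝ) = ∑ k, (η.1 k : ℝ) + 1 := by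
      intro i
      simp [Finset.sum_add_distrib, Pi.single_apply]
    have hsub : ∀ i, ∑ k, ((η.1 - Pi.single i 1 : Fin N → ℕ) k : ℝ) ≤ ∑ k, (η.1 k : ℝ) :=
      fun i => Finset.sum_le_sum fun k _ => Nat.cast_le.2 (Nat.sub_le _ _)
    have hres : ∀ (c : Fin N → ℝ) (ρ : ℝ), (∀ i, 0 ≤ c i) →
        ∑ i, (c i * (ρ * (1 + 0 * (η.1 i : ℝ))) *
            (1 + ∑ k, ((η.1 + Pi.single i 1 : Fin N → ℕ) k : ℝ) - (1 + ∑ k, (η.1 k : ℝ))) +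
          c i * ((1 + 0 * ρ) * (η.1 i : ℝ)) *
            (1 + ∑ k, ((η.1 - Pi.single i 1 : Fin N → ℕ) k : ℝ) - (1 + ∑ k, (η.1 k : ℝ)))) ≤
        ∑ i, c i * ρ := by
      intro c ρ hc
      refine Finset.sum_le_sum fun i _ => ?_
      rw [hadd]
      have h1 : c i * ((1 + 0 * ρ) * (η.1 i : ℝ)) *
            (1 + ∑ k, ((η.1 - Pi.single i 1 : Fin N → ℕ) k : ℝ) - (1 + ∑ k, (η.1 k : ℝ))) ≤ 0 := by
        refine mul_nonpos_of_nonneg_of_nonpos ?_ (by linarith [hsub i])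
        rw [zero_mul, add_zero, one_mul]
        exact mul_nonneg (hc i) (Nat.cast_nonneg _)
      linarith
    rw [resGen]
    have hb : ∑ i, ∑ j, p i j * η.1 i * (1 + 0 * (η.1 j : ℝ)) *
        ((1 + ∑ k, (move η.1 i j k : ℝ)) - (1 + ∑ k, (η.1 k : ℝ))) = 0 := by
      refine Finset.sum_eq_zero fun i _ => Finset.sum_eq_zero fun j _ => ?_
      by_cases h0 : η.1 i = 0
      · simp [h0]
      · have := sum_move_mul (M := ℝ) h0 j fun _ => 1
        simp only [mul_one] at this
        rw [show ∑ k, (move η.1 i j k : ℝ) = ∑ k, (η.1 k : ℝ) by linarith]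
        ring
    simp only [hb, zero_add]
    exact add_le_add (hres _ ρl hL) (hres _ ρr hR)

/-- Adding a particle at the site `i`. -/
def addParticle (i : Fin N) (η : Config 0 N) : Config 0 N :=
  ⟨η.1 + Pi.single i 1, fun _ => allowedOcc_of_nonneg le_rfl _⟩

theorem addParticle_injective (i : Fin N) : Function.Injective (addParticle (N := N) i) :=
  fun _ _ he => Subtype.ext (add_right_cancel (congrArg Subtype.val he))

theorem ReservoirParams.gen_sum_addParticle (h : ReservoirParams 0 p cl cr ρl ρr)
    {C : Finset (Fin N)} (hCl : ∀ i ∈ C, leftRate cl i = 0) (hCr : ∀ i ∈ C, rightRate cr i = 0)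
    (hCp : ∀ i ∈ C, ∀ j ∉ C, p i j = 0) (f : (Fin N → ℕ) → ℝ) (η : Config 0 N) :
    gen (resR 0 p cl cr ρl ρr) (resT 0 p cl cr ρl ρr)
        (fun η => ∑ i ∈ C, f (addParticle i η).1) η =
      ∑ i ∈ C, gen (resR 0 p cl cr ρl ρr) (resT 0 p cl cr ρl ρr) (fun η => f η.1)
        (addParticle i η) := by
  obtain ⟨F, hF⟩ : ∃ F : (Fin N → ℕ) → ℝ, F = fun x => ∑ i ∈ C, f (x + Pi.single i 1) := ⟨_, rfl⟩
  have e : (fun η : Config 0 N => ∑ i ∈ C, f (addParticle i η).1) = fun η => F η.1 := by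
    rw [hF]; rfl
  rw [e]
  refine (gen_res h.adm h.p_nonneg h.cl_nonneg h.cr_nonneg h.ρl_nonneg h.ρr_nonneg
    h.ρl_le h.ρr_le F η).trans ?_
  rw [hF]
  refine (resGen_zero_sum_add_single h.symm hCl hCr hCp f η.1).trans ?_
  refine Finset.sum_congr rfl fun i _ => ?_
  exact (gen_res h.adm h.p_nonneg h.cl_nonneg h.cr_nonneg h.ρl_nonneg h.ρr_nonneg
    h.ρl_le h.ρr_le f (addParticle i η)).symm

open scoped Classical in
theorem integrable_mul_indicator_comp {S T : Type*} [MeasurableSpace S] [DiscreteMeasurableSpace S]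
    {μ : Measure S} [IsFiniteMeasure μ] {T' : S → T} (hT : Function.Injective T') (j : T)
    (g : S → ℝ) : Integrable (fun s => g s * if T' s = j then 1 else 0) μ := by
  by_cases hex : ∃ s0, T' s0 = j
  · obtain ⟨s0, hs0⟩ := hex
    refine Integrable.of_bound Measurable.of_discrete.aestronglyMeasurable |g s0|
      (Eventually.of_forall fun s => ?_)
    by_cases hs : T' s = j
    · rw [hT (hs.trans hs0.symm), if_pos hs0]
      simp
    · rw [if_neg hs, mul_zero, norm_zero]
      exact abs_nonneg _
  · have : (fun s => g s * if T' s = j then (1 : ℝ) else 0) = fun _ => 0 := by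
      funext s
      rw [if_neg fun h0 => hex ⟨s, h0⟩, mul_zero]
    rw [this]
    exact integrable_zero _ _ _

/-- Adding a particle uniformly on `C` to a stationary configuration. -/
def addUniform (C : Finset (Fin N)) (μ : Measure (Config 0 N)) : Measure (Config 0 N) :=
  (C.card : ℝ≥0∞)⁻¹ • ∑ i ∈ C, μ.map (addParticle i)

theorem lintegral_addUniform (C : Finset (Fin N)) (μ : Measure (Config 0 N))
    (F : Config 0 N → ℝ≥0∞) : ∫⁻ η, F η ∂(addUniform C μ) =
      (C.card : ℝ≥0∞)⁻¹ * ∑ i ∈ C, ∫⁻ η, F (addParticle i η) ∂μ := by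
  rw [addUniform, lintegral_smul_measure, lintegral_finsetSum_measure, smul_eq_mul]
  congr 1
  exact Finset.sum_congr rfl fun i _ =>
    lintegral_map Measurable.of_discrete Measurable.of_discrete

theorem ReservoirParams.balance_addUniform (h : ReservoirParams 0 p cl cr ρl ρr)
    {C : Finset (Fin N)} (hCl : ∀ i ∈ C, leftRate cl i = 0) (hCr : ∀ i ∈ C, rightRate cr i = 0)
    (hCp : ∀ i ∈ C, ∀ j ∉ C, p i j = 0)
    {μ : Measure (Config 0 N)} (hμ : IsStationary (resRate 0 p cl cr ρl ρr) μ) (j : Config 0 N) :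
    inflow (resRate 0 p cl cr ρl ρr) (fun k => addUniform C μ {k}) j =
      ENNReal.ofReal (exitRate (resRate 0 p cl cr ρl ρr) j) * addUniform C μ {j} := by
  classical
  have hprob := hμ.1
  refine balance_of_lintegral_jumpSum j ?_
  have hrep := h.isJumpRep_res
  have hgen0 := h.gen_sum_addParticle hCl hCr hCp
  have hbal := hμ.balance
  generalize resRate 0 p cl cr ρl ρr = q at hrep hbal ⊢
  generalize resR 0 p cl cr ρl ρr = r at hrep hgen0
  generalize resT 0 p cl cr ρl ρr = τ at hrep hgen0
  have hF0 : ∀ s : Config 0 N, 0 ≤ (if s = j then (1 : ℝ) else 0) := fun s => by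
    split_ifs <;> norm_num
  have hgen : ∀ η, gen r τ
      (fun η => ∑ i ∈ C, if addParticle i η = j then (1 : ℝ) else 0) η =
      ∑ i ∈ C, gen r τ (fun s => if s = j then 1 else 0) (addParticle i η) := by
    intro η
    have := hgen0 (fun x => if x = j.1 then 1 else 0) η
    have e : ∀ s : Config 0 N, (if s.1 = j.1 then (1 : ℝ) else 0) = if s = j then 1 else 0 :=
      fun s => if_congr Subtype.ext_iff.symm rfl rfl
    simpa only [e] using this
  have hfin : ∀ i (g : Config 0 N → ℝ),
      Integrable (fun η => g η * if addParticle i η = j then 1 else 0) μ := fun i g =>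
    integrable_mul_indicator_comp (addParticle_injective i) j g
  generalize hF : (fun s : Config 0 N => if s = j then (1 : ℝ) else 0) = F at hgen ⊢
  have hFs : ∀ s, (if s = j then (1 : ℝ) else 0) = F s := fun s => congrFun hF s
  simp only [hFs] at hfin hF0 hgen ⊢
  obtain ⟨hI, hI0⟩ := hrep.integral_gen_eq_zero hbal
    (f := fun η => ∑ i ∈ C, F (addParticle i η)) (fun η => Finset.sum_nonneg fun i _ => hF0 _) (by
      refine (integrable_finsetSum C fun i _ => hfin i (exitRate q)).congr
        (Eventually.of_forall fun η => ?_)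
      exact (Finset.mul_sum _ _ _).symm)
  have hE : Integrable (fun η => ∑ i ∈ C, exitRate q (addParticle i η) * F (addParticle i η)) μ :=
    integrable_finsetSum _ fun i _ => hfin i fun η => exitRate q (addParticle i η)
  have hnn1 : ∀ s : Config 0 N, 0 ≤ exitRate q s * F s := fun s =>
    mul_nonneg (exitRate_nonneg q s) (hF0 s)
  have hnn2 := hrep.exitRate_mul_add_gen_nonneg hF0
  rw [lintegral_congr fun s => hrep.jumpSum_ofReal hF0 s, lintegral_addUniform,
    lintegral_addUniform]
  congr 1
  rw [← lintegral_finsetSum _ fun i _ => Measurable.of_discrete,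
    ← lintegral_finsetSum _ fun i _ => Measurable.of_discrete]
  have e1 : ∀ η, ∑ i ∈ C, ENNReal.ofReal (exitRate q (addParticle i η) * F (addParticle i η)) =
      ENNReal.ofReal (∑ i ∈ C, exitRate q (addParticle i η) * F (addParticle i η)) := fun η =>
    (ENNReal.ofReal_sum_of_nonneg fun i _ => hnn1 _).symm
  have e2 : ∀ η, ∑ i ∈ C, ENNReal.ofReal
        (exitRate q (addParticle i η) * F (addParticle i η) + gen r τ F (addParticle i η)) =
      ENNReal.ofReal (∑ i ∈ C, exitRate q (addParticle i η) * F (addParticle i η) +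
        gen r τ (fun η => ∑ i ∈ C, F (addParticle i η)) η) := fun η => by
    rw [hgen, ← Finset.sum_add_distrib]
    exact (ENNReal.ofReal_sum_of_nonneg fun i _ => hnn2 _).symm
  have hnn3 : ∀ η, 0 ≤ ∑ i ∈ C, exitRate q (addParticle i η) * F (addParticle i η) +
      gen r τ (fun η => ∑ i ∈ C, F (addParticle i η)) η := fun η => by
    rw [hgen, ← Finset.sum_add_distrib]
    exact Finset.sum_nonneg fun i _ => hnn2 _
  rw [lintegral_congr e1, lintegral_congr e2]
  refine (ofReal_integral_eq_lintegral_ofReal (hE.add hI) (Eventually.of_forall hnn3)).symm.trans ?_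
  rw [← ofReal_integral_eq_lintegral_ofReal hE
      (Eventually.of_forall fun η => Finset.sum_nonneg fun i _ => hnn1 _)]
  congr 1
  exact (integral_add hE hI).trans (by rw [hI0, add_zero])

/-- If the stationary measure of independent particles is unique, then every site is connected to
an active reservoir. -/
theorem ReservoirParams.exists_rank (h : ReservoirParams 0 p cl cr ρl ρr)
    {μ : Measure (Config 0 N)} (hμ : IsUniqueStationary (resRate 0 p cl cr ρl ρr) μ) :
    ∃ d, IsRank p cl cr d := by
  classical
  refine exists_isRank ?_
  by_contra hcon
  push Not at hcon
  obtain ⟨i0, hi0⟩ := hcon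
  have hprob := hμ.1.1
  set C : Finset (Fin N) := Finset.univ.filter fun i => ∀ k, i ∉ reachSet p cl cr k with hC
  have hCmem : ∀ i, i ∈ C ↔ ∀ k, i ∉ reachSet p cl cr k := by simp [hC]
  have hCne : C.card ≠ 0 := (Finset.card_pos.2 ⟨i0, (hCmem i0).2 hi0⟩).ne'
  have hCl : ∀ i ∈ C, leftRate cl i = 0 := fun i hi =>
    le_antisymm (not_lt.1 fun h0 => (hCmem i).1 hi 0 (Or.inl h0)) (leftRate_nonneg h.cl_nonneg i)
  have hCr : ∀ i ∈ C, rightRate cr i = 0 := fun i hi =>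
    le_antisymm (not_lt.1 fun h0 => (hCmem i).1 hi 0 (Or.inr h0)) (rightRate_nonneg h.cr_nonneg i)
  have hCp : ∀ i ∈ C, ∀ j ∉ C, p i j = 0 := by
    intro i hi j hj
    rw [hCmem] at hj
    push Not at hj
    obtain ⟨k, hk⟩ := hj
    exact le_antisymm (not_lt.1 fun h0 => (hCmem i).1 hi (k + 1) (Or.inr ⟨j, hk, h0⟩))
      (h.p_nonneg i j)
  set ν := addUniform C μ with hνdef
  have hν : ∀ F : Config 0 N → ℝ≥0∞,
      ∫⁻ η, F η ∂ν = (C.card : ℝ≥0∞)⁻¹ * ∑ i ∈ C, ∫⁻ η, F (addParticle i η) ∂μ :=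
    lintegral_addUniform C μ
  have hCinv : (C.card : ℝ≥0∞)⁻¹ * C.card = 1 :=
    ENNReal.inv_mul_cancel (by exact_mod_cast hCne) (by simp)
  have hνprob : IsProbabilityMeasure ν := by
    refine ⟨?_⟩
    have := hν fun _ => 1
    simpa [hCinv] using this
  have hνμ : ν = μ := hμ.2 ν (isStationary_of_balance (h.balance_addUniform hCl hCr hCp hμ.1) fun t ht η =>
    tsum_transProb_resRate_zero h ht η)
  set G : Config 0 N → ℝ≥0∞ := fun η => 2⁻¹ ^ (∑ i ∈ C, η.1 i) with hG
  have hGT : ∀ i ∈ C, ∀ η, G (addParticle i η) = 2⁻¹ * G η := by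
    intro i hi η
    have : ∑ k ∈ C, (addParticle i η).1 k = ∑ k ∈ C, η.1 k + 1 := by
      simp [addParticle, Finset.sum_add_distrib, Pi.single_apply, hi]
    simp only [hG]
    rw [this, pow_succ, mul_comm]
  have hhalf : ∫⁻ η, G η ∂μ = (∫⁻ η, G η ∂μ) / 2 := by
    have h1 := hν G
    rw [hνμ, Finset.sum_congr rfl fun i hi => lintegral_congr (hGT i hi)] at h1
    rw [Finset.sum_const, nsmul_eq_mul, ← mul_assoc, hCinv, one_mul,
      lintegral_const_mul _ Measurable.of_discrete] at h1
    rw [ENNReal.div_eq_inv_mul]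
    exact h1
  have hle : ∫⁻ η, G η ∂μ ≤ 1 := by
    calc ∫⁻ η, G η ∂μ ≤ ∫⁻ _, 1 ∂μ := lintegral_mono fun η =>
          pow_le_one₀ zero_le (by simp)
      _ = 1 := by simp
  have hpos : ∫⁻ η, G η ∂μ ≠ 0 := by
    intro h0
    rw [lintegral_eq_zero_iff Measurable.of_discrete] at h0
    have : ∀ᵐ η ∂μ, False := h0.mono fun η hη => by
      have : G η ≠ 0 := pow_ne_zero _ (by simp)
      exact this hη
    exact hprob.ne_zero _ (ae_eq_bot.1 (eventually_false_iff_eq_bot.1 this))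
  exact (ENNReal.half_lt_self hpos (ne_top_of_le_ne_top ENNReal.one_ne_top hle)).ne hhalf.symm

end Rank

section Annihilation

variable {ι : Type*} [DecidableEq ι]

theorem move_sub_single_of_ne_right (ξ : ι → ℕ) {i j s : ι} (hij : i ≠ j) (hs : s ≠ j) :
    move ξ i j - Pi.single s 1 = move (ξ - Pi.single s 1) i j := by
  funext k
  simp only [move, Pi.add_apply, Pi.sub_apply, Pi.single_apply]
  by_cases h1 : k = i <;> by_cases h2 : k = j <;> by_cases h3 : k = s <;> simp_all

theorem move_sub_single_right (ξ : ι → ℕ) (i j : ι) :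
    move ξ i j - Pi.single j 1 = ξ - Pi.single i 1 := by
  simp [move]

theorem move_sub_single_left {ξ : ι → ℕ} {i j : ι} (hij : i ≠ j) (hj : ξ j ≠ 0) :
    move (ξ - Pi.single j 1) i j = ξ - Pi.single i 1 := by
  funext k
  simp only [move, Pi.add_apply, Pi.sub_apply, Pi.single_apply]
  by_cases h1 : k = i <;> by_cases h2 : k = j <;> simp_all <;> omega

variable [Fintype ι]

/-- The annihilation operator: sum over the particles of `ξ` of the value of `f` after the removal of
the particle. -/
def annihil (f : (ι → ℕ) → ℝ) (ξ : ι → ℕ) : ℝ := ∑ s, (ξ s : ℝ) * f (ξ - Pi.single s 1)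

theorem sum_eq_add_add_sum {i j : ι} (hij : i ≠ j) (g : ι → ℝ) :
    ∑ s, g s = g i + g j + ∑ s ∈ Finset.univ \ {i, j}, g s := by
  rw [← Finset.sum_pair hij, add_comm, Finset.sum_sdiff (Finset.subset_univ _)]

/-- The commutator of the annihilation operator with the jumps from `i` to `j`. -/
theorem annihil_jump (θ : ℝ) (f : (ι → ℕ) → ℝ) (ξ : ι → ℕ) (i j : ι) :
    (ξ i : ℝ) * (1 + θ * ξ j) * (annihil f (move ξ i j) - annihil f ξ) =
      ∑ s, (ξ s : ℝ) * (((ξ - Pi.single s 1 : ι → ℕ) i : ℝ) *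
        (1 + θ * ((ξ - Pi.single s 1 : ι → ℕ) j : ℝ)) *
          (f (move (ξ - Pi.single s 1) i j) - f (ξ - Pi.single s 1))) +
      θ * (ξ i * ξ j * (f (ξ - Pi.single i 1) - f (ξ - Pi.single j 1))) := by
  by_cases hi : ξ i = 0
  · simp [hi]
  by_cases hij : i = j
  · subst hij
    have hz : ∀ s, ((ξ - Pi.single s 1 : ι → ℕ) i : ℝ) *
        (1 + θ * ((ξ - Pi.single s 1 : ι → ℕ) i : ℝ)) *
          (f (move (ξ - Pi.single s 1) i i) - f (ξ - Pi.single s 1)) = 0 := by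
      intro s
      by_cases h0 : (ξ - Pi.single s 1 : ι → ℕ) i = 0
      · rw [h0]; simp
      · rw [move_self_of_ne_zero h0]; simp
    rw [move_self_of_ne_zero hi]
    simp only [hz]
    simp
  · have hcast : (((ξ i - 1 : ℕ)) : ℝ) = ξ i - 1 := Nat.cast_pred (Nat.pos_of_ne_zero hi)
    have hrest : ∑ s ∈ Finset.univ \ {i, j}, (ξ s : ℝ) * (((ξ - Pi.single s 1 : ι → ℕ) i : ℝ) *
        (1 + θ * ((ξ - Pi.single s 1 : ι → ℕ) j : ℝ)) *
          (f (move (ξ - Pi.single s 1) i j) - f (ξ - Pi.single s 1))) =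
        (ξ i : ℝ) * (1 + θ * ξ j) *
          (∑ s ∈ Finset.univ \ {i, j}, (move ξ i j s : ℝ) * f (move ξ i j - Pi.single s 1) -
            ∑ s ∈ Finset.univ \ {i, j}, (ξ s : ℝ) * f (ξ - Pi.single s 1)) := by
      rw [← Finset.sum_sub_distrib, Finset.mul_sum]
      refine Finset.sum_congr rfl fun s hs => ?_
      simp only [Finset.mem_sdiff, Finset.mem_univ, true_and, Finset.mem_insert,
        Finset.mem_singleton, not_or] at hs
      rw [sub_single_apply_of_ne ξ (Ne.symm hs.1), sub_single_apply_of_ne ξ (Ne.symm hs.2),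
        move_sub_single_of_ne_right ξ hij hs.2, move_apply_of_ne hs.1 hs.2]
      ring
    have hy : (ξ j : ℝ) * ((ξ i : ℝ) * (1 + θ * ((ξ j - 1 : ℕ) : ℝ)) *
        (f (move (ξ - Pi.single j 1) i j) - f (ξ - Pi.single j 1))) =
        (ξ j : ℝ) * (ξ i * (1 + θ * (ξ j - 1)) *
          (f (ξ - Pi.single i 1) - f (ξ - Pi.single j 1))) := by
      by_cases hj : ξ j = 0
      · simp [hj]
      · rw [move_sub_single_left hij hj, Nat.cast_pred (Nat.pos_of_ne_zero hj)]
    rw [annihil, annihil, sum_eq_add_add_sum hij, sum_eq_add_add_sum hij,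
      sum_eq_add_add_sum hij, hrest, sub_single_apply_self, sub_single_apply_self,
      sub_single_apply_of_ne ξ hij, sub_single_apply_of_ne ξ (Ne.symm hij), hy,
      move_sub_single_of_ne_right ξ hij hij, move_sub_single_right, move_apply_left hij,
      move_apply_right hij, hcast]
    push_cast
    ring

theorem sum_sub_single_add_one {ξ : ι → ℕ} {s : ι} (hs : ξ s ≠ 0) :
    ∑ k, (ξ - Pi.single s 1 : ι → ℕ) k + 1 = ∑ k, ξ k := by
  rw [← Finset.add_sum_erase _ _ (Finset.mem_univ s), ← Finset.add_sum_erase _ ξ (Finset.mem_univ s),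
    sub_single_apply_self, Finset.sum_congr rfl fun k hk =>
      sub_single_apply_of_ne ξ (Finset.ne_of_mem_erase hk)]
  omega

/-- The configuration of the particles with labels in `J`. -/
def partialOcc {L : Type*} (x : L → ι) (J : Finset L) : ι → ℕ := ∑ l ∈ J, Pi.single (x l) 1

theorem annihil_partialOcc {L : Type*} [DecidableEq L] (f : (ι → ℕ) → ℝ) (x : L → ι)
    (J : Finset L) : annihil f (partialOcc x J) = ∑ l ∈ J, f (partialOcc x (J.erase l)) := by
  have h1 : ∀ s, (partialOcc x J s : ℝ) = ∑ l ∈ J, if s = x l then 1 else 0 := by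
    intro s
    simp [partialOcc, Finset.sum_apply, Pi.single_apply]
  have h2 : ∀ l ∈ J, partialOcc x J - Pi.single (x l) 1 = partialOcc x (J.erase l) := by
    intro l hl
    rw [partialOcc, ← Finset.add_sum_erase J _ hl, add_tsub_cancel_left, partialOcc]
  simp only [annihil, h1, Finset.sum_mul]
  rw [Finset.sum_comm]
  refine Finset.sum_congr rfl fun l hl => ?_
  rw [← h2 l hl]
  simp

theorem annihil_iterate_partialOcc {L : Type*} [DecidableEq L] (f : (ι → ℕ) → ℝ) (x : L → ι)
    (κ m : ℕ) (J : Finset L) (hJ : J.card = κ + m) :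
    annihil^[m] f (partialOcc x J) =
      (m.factorial : ℝ) * ∑ I ∈ J.powersetCard κ, f (partialOcc x I) := by
  induction m generalizing J with
  | zero =>
    have : J.powersetCard κ = {J} := by
      rw [← show J.card = κ from hJ]; exact Finset.powersetCard_self J
    simp [this]
  | succ m ih =>
    rw [Function.iterate_succ_apply', annihil_partialOcc,
      Finset.sum_congr rfl fun l hl => ih (J.erase l) (by rw [Finset.card_erase_of_mem hl]; omega),
      ← Finset.mul_sum]
    have hswap : ∑ l ∈ J, ∑ I ∈ (J.erase l).powersetCard κ, f (partialOcc x I) =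
        ∑ I ∈ J.powersetCard κ, ∑ l ∈ J \ I, f (partialOcc x I) := by
      refine Finset.sum_comm' fun l I => ?_
      simp only [Finset.mem_powersetCard, Finset.mem_sdiff, Finset.subset_erase]
      tauto
    have hcount : ∑ I ∈ J.powersetCard κ, ∑ l ∈ J \ I, f (partialOcc x I) =
        ((m + 1 : ℕ) : ℝ) * ∑ I ∈ J.powersetCard κ, f (partialOcc x I) := by
      rw [Finset.mul_sum]
      refine Finset.sum_congr rfl fun I hI => ?_
      rw [Finset.mem_powersetCard] at hI
      rw [Finset.sum_const, Finset.card_sdiff_of_subset hI.1, nsmul_eq_mul, hJ, hI.2]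
      congr 2
      omega
    rw [hswap, hcount, Nat.factorial_succ]
    push_cast
    ring

theorem partialOcc_map {m : ℕ} {L : Type*} (x : L → ι) (e : Fin m ↪ L) :
    partialOcc x (Finset.univ.map e) = occupation (x ∘ e) := by
  simp [partialOcc, occupation]

theorem sum_powersetCard_univ_eq {n : ℕ} (κ : ℕ) (F : Finset (Fin n) → ℝ) :
    ∑ I ∈ (Finset.univ : Finset (Fin n)).powersetCard κ, F I =
      ∑ e : Fin κ ↪o Fin n, F (Finset.univ.map e.toEmbedding) := by
  symm
  refine Finset.sum_bij (fun e _ => Finset.univ.map e.toEmbedding) (fun e _ => ?_) ?_ ?_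
    fun _ _ => rfl
  · simp [Finset.mem_powersetCard]
  · intro e _ e' _ h
    have hr : Set.range e = Set.range e' := by
      have := congrArg (fun s : Finset (Fin n) => (s : Set (Fin n))) h
      simpa using this
    exact OrderEmbedding.range_inj.1 hr
  · intro I hI
    rw [Finset.mem_powersetCard] at hI
    refine ⟨I.orderEmbOfFin hI.2, Finset.mem_univ _, ?_⟩
    exact Finset.coe_injective (by simp)

end Annihilation

section Consistency

variable {N : ℕ} {θ : ℝ} {p : Fin N → Fin N → ℝ} {cl cr : ℝ}

/-- The dual generator commutes with the annihilation of particles. -/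
theorem dualGen_annihil (hsymm : ∀ i j, p i j = p j i) (f : (Fin (N + 2) → ℕ) → ℝ)
    (ξ : Fin (N + 2) → ℕ) :
    dualGen θ p cl cr (annihil f) ξ =
      ∑ s, (ξ s : ℝ) * dualGen θ p cl cr f (ξ - Pi.single s 1) := by
  have hb : ∀ i j, p i j * ξ (bulk i) * (1 + θ * ξ (bulk j)) *
      (annihil f (move ξ (bulk i) (bulk j)) - annihil f ξ) =
      ∑ s, (ξ s : ℝ) * (p i j * ((ξ - Pi.single s 1 : Fin (N + 2) → ℕ) (bulk i) : ℝ) *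
        (1 + θ * ((ξ - Pi.single s 1 : Fin (N + 2) → ℕ) (bulk j) : ℝ)) *
          (f (move (ξ - Pi.single s 1) (bulk i) (bulk j)) - f (ξ - Pi.single s 1))) +
      p i j * (θ * (ξ (bulk i) * ξ (bulk j) *
        (f (ξ - Pi.single (bulk i) 1) - f (ξ - Pi.single (bulk j) 1)))) := by
    intro i j
    have h := congrArg (fun z => p i j * z) (annihil_jump θ f ξ (bulk i) (bulk j))
    simp only [mul_add, Finset.mul_sum] at h
    refine Eq.trans (by ring) (h.trans ?_)
    congr 1
    exact Finset.sum_congr rfl fun s _ => by ring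
  have ha : ∀ (c : ℝ) (i : Fin N) (t : Fin (N + 2)), c * ξ (bulk i) *
      (annihil f (move ξ (bulk i) t) - annihil f ξ) =
      ∑ s, (ξ s : ℝ) * (c * ((ξ - Pi.single s 1 : Fin (N + 2) → ℕ) (bulk i) : ℝ) *
          (f (move (ξ - Pi.single s 1) (bulk i) t) - f (ξ - Pi.single s 1))) := by
    intro c i t
    have h := congrArg (fun z => c * z) (annihil_jump 0 f ξ (bulk i) t)
    simp only [zero_mul, add_zero, mul_one, Finset.mul_sum] at h
    refine Eq.trans (by ring) (h.trans ?_)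
    exact Finset.sum_congr rfl fun s _ => by ring
  have hanti := sum_sum_eq_zero_of_antisymm p (fun i j => θ * (ξ (bulk i) * ξ (bulk j) *
        (f (ξ - Pi.single (bulk i) 1) - f (ξ - Pi.single (bulk j) 1)))) hsymm
    (fun i j => by ring)
  have hR : ∀ A B C : Fin (N + 2) → ℝ, ∑ s, (ξ s : ℝ) * (A s + B s + C s) =
      ∑ s, (ξ s : ℝ) * A s + ∑ s, (ξ s : ℝ) * B s + ∑ s, (ξ s : ℝ) * C s := fun A B C => by
    simp only [mul_add, Finset.sum_add_distrib]
  have hswap : ∀ X : Fin N → Fin (N + 2) → ℝ,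
      ∑ i, ∑ s, (ξ s : ℝ) * X i s = ∑ s, (ξ s : ℝ) * ∑ i, X i s := fun X => by
    rw [Finset.sum_comm]
    exact Finset.sum_congr rfl fun s _ => (Finset.mul_sum _ _ _).symm
  simp only [dualGen, hb, ha, Finset.sum_add_distrib, hanti, add_zero]
  rw [hR]
  simp only [hswap]

theorem dualGen_annihil_iterate_eq_zero (hsymm : ∀ i j, p i j = p j i)
    {u : (Fin (N + 2) → ℕ) → ℝ} (hu : ∀ ξ : DualConfig θ N, dualGen θ p cl cr u ξ.1 = 0) (m : ℕ)
    (ξ : DualConfig θ N) : dualGen θ p cl cr (annihil^[m] u) ξ.1 = 0 := by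
  induction m generalizing ξ with
  | zero => exact hu ξ
  | succ m ih =>
    rw [Function.iterate_succ', Function.comp_def]
    refine (dualGen_annihil hsymm _ ξ.1).trans (Finset.sum_eq_zero fun s _ => ?_)
    rw [ih ⟨ξ.1 - Pi.single s 1, fun i => (ξ.2 i).mono (Nat.sub_le _ _)⟩, mul_zero]

theorem annihil_iterate_absorbed {u : (Fin (N + 2) → ℕ) → ℝ}
    (hu : ∀ ξ : DualConfig θ N, ξ ∈ absorbed θ N → u ξ.1 = if ξ.1 0 = 0 then 1 else 0)
    (κ m : ℕ) (ξ : DualConfig θ N) (hξ : ξ ∈ absorbed θ N) (hm : ∑ s, ξ.1 s = κ + m) :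
    annihil^[m] u ξ.1 = (m.factorial : ℝ) * ((ξ.1 (Fin.last (N + 1))).choose κ : ℝ) := by
  have hsum : ∀ ξ : DualConfig θ N, ξ ∈ absorbed θ N →
      ∑ s, ξ.1 s = ξ.1 0 + ξ.1 (Fin.last (N + 1)) := fun ξ hξ => by
    rw [sum_fin_add_two, Finset.sum_eq_zero fun i _ => hξ i, add_zero]
  induction m generalizing ξ with
  | zero =>
    rw [hsum ξ hξ] at hm
    rw [Function.iterate_zero, id, hu ξ hξ]
    split_ifs with h0
    · rw [show ξ.1 (Fin.last (N + 1)) = κ by omega]; simp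
    · rw [Nat.choose_eq_zero_of_lt (by omega)]; simp
  | succ m ih =>
    have key : ∀ s, ξ.1 s ≠ 0 → annihil^[m] u (ξ.1 - Pi.single s 1) =
        (m.factorial : ℝ) *
          (((ξ.1 - Pi.single s 1 : Fin (N + 2) → ℕ) (Fin.last (N + 1))).choose κ : ℝ) := by
      intro s hs
      refine ih ⟨ξ.1 - Pi.single s 1, fun i => (ξ.2 i).mono (Nat.sub_le _ _)⟩
        (fun i => Nat.le_zero.1 ((Nat.sub_le _ _).trans (hξ i).le)) ?_
      have := sum_sub_single_add_one hs
      change ∑ k, (ξ.1 - Pi.single s 1 : Fin (N + 2) → ℕ) k = κ + m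
      omega
    have h0 : (ξ.1 0 : ℝ) * annihil^[m] u (ξ.1 - Pi.single 0 1) =
        ξ.1 0 * ((m.factorial : ℝ) * ((ξ.1 (Fin.last (N + 1))).choose κ : ℝ)) := by
      by_cases hs : ξ.1 0 = 0
      · simp [hs]
      · rw [key 0 hs, sub_single_apply_of_ne _ zero_ne_last.symm]
    have hl : (ξ.1 (Fin.last (N + 1)) : ℝ) * annihil^[m] u (ξ.1 - Pi.single (Fin.last (N + 1)) 1) =
        (ξ.1 (Fin.last (N + 1)) - κ) *
          ((m.factorial : ℝ) * ((ξ.1 (Fin.last (N + 1))).choose κ : ℝ)) := by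
      by_cases hs : ξ.1 (Fin.last (N + 1)) = 0
      · rw [hs]
        rcases κ with _ | κ <;> simp
      · rw [key _ hs, sub_single_apply_self]
        obtain ⟨b, hb⟩ := Nat.exists_eq_succ_of_ne_zero hs
        rw [hb, Nat.succ_sub_one]
        have h1 := Nat.choose_mul_succ_eq b κ
        by_cases hκ : κ ≤ b + 1
        · have h2 : (b.choose κ : ℝ) * (b + 1) = ((b + 1).choose κ : ℝ) * (b + 1 - κ) := by
            have := congrArg (Nat.cast (R := ℝ)) h1
            rw [Nat.cast_mul, Nat.cast_mul, Nat.cast_sub hκ] at this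
            exact_mod_cast this
          push_cast
          linear_combination (m.factorial : ℝ) * h2
        · rw [Nat.choose_eq_zero_of_lt (by omega), Nat.choose_eq_zero_of_lt (by omega)]
          simp
    rw [Function.iterate_succ_apply', annihil, sum_fin_add_two, h0, hl,
      Finset.sum_eq_zero fun i _ => by rw [hξ i]; simp]
    rw [hsum ξ hξ] at hm
    have hm' : (ξ.1 0 : ℝ) + ξ.1 (Fin.last (N + 1)) = κ + (m + 1) := by exact_mod_cast hm
    rw [Nat.factorial_succ]
    push_cast
    linear_combination (m.factorial : ℝ) * ((ξ.1 (Fin.last (N + 1))).choose κ : ℝ) * hm'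

end Consistency

section Walk

variable {N : ℕ} {p : Fin N → Fin N → ℝ} {cl cr : ℝ}

open scoped Classical in
/-- Rates of the jumps of the random walk on `V*`. -/
def walkR (p : Fin N → Fin N → ℝ) (cl cr : ℝ) (a : DualIdx N) (u : Fin (N + 2)) : ℝ :=
  match a with
  | .inl (i, j) => if u = bulk i then p i j else 0
  | .inr (.inl i) => if u = bulk i then leftRate cl i else 0
  | .inr (.inr i) => if u = bulk i then rightRate cr i else 0

/-- Targets of the jumps of the random walk on `V*`. -/
def walkT (a : DualIdx N) (_ : Fin (N + 2)) : Fin (N + 2) :=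
  match a with
  | .inl (_, j) => bulk j
  | .inr (.inl _) => 0
  | .inr (.inr _) => Fin.last (N + 1)

theorem walkR_nonneg (hp : ∀ i j, 0 ≤ p i j) (hcl : 0 ≤ cl) (hcr : 0 ≤ cr) (a : DualIdx N)
    (u : Fin (N + 2)) : 0 ≤ walkR p cl cr a u := by
  rcases a with ⟨i, j⟩ | i | i <;> simp only [walkR] <;> split_ifs
  exacts [hp i j, le_rfl, leftRate_nonneg hcl i, le_rfl, rightRate_nonneg hcr i, le_rfl]

theorem isJumpRep_walk (hp : ∀ i j, 0 ≤ p i j) (hcl : 0 ≤ cl) (hcr : 0 ≤ cr) :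
    IsJumpRep (walkRate p cl cr) (walkR p cl cr) (walkT (N := N)) where
  nonneg := walkR_nonneg hp hcl hcr
  rate_eq u v _ := by
    classical
    simp only [Fintype.sum_sum_type, Fintype.sum_prod_type, walkR, walkT, walkRate, ← add_assoc]
    congr 1
    · congr 1
      · refine Finset.sum_congr rfl fun i _ => Finset.sum_congr rfl fun j _ => ?_
        by_cases h1 : u = bulk i <;> by_cases h2 : v = bulk j <;> simp [h1, h2]
      · refine Finset.sum_congr rfl fun i _ => ?_
        by_cases h1 : i.val = 0 <;> by_cases h2 : u = bulk i <;> by_cases h3 : v = 0 <;>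
          simp [leftRate, h1, h2, h3]
    · refine Finset.sum_congr rfl fun i _ => ?_
      by_cases h1 : i.val + 1 = N <;> by_cases h2 : u = bulk i <;>
        by_cases h3 : v = Fin.last (N + 1) <;> simp [rightRate, h1, h2, h3]

theorem eq_zero_or_last_or_bulk (s : Fin (N + 2)) :
    (s = 0 ∨ s = Fin.last (N + 1)) ∨ ∃ i : Fin N, s = bulk i := by
  rcases Fin.eq_castSucc_or_eq_last s with ⟨t, rfl⟩ | rfl
  · rcases Fin.eq_zero_or_eq_succ t with rfl | ⟨i, rfl⟩
    · exact Or.inl (Or.inl rfl)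
    · exact Or.inr ⟨i, rfl⟩
  · exact Or.inl (Or.inr rfl)

theorem walkR_bulk (i : Fin N) (f : Fin (N + 2) → ℝ) :
    gen (walkR p cl cr) walkT f (bulk i) = ∑ j, p i j * (f (bulk j) - f (bulk i)) +
      leftRate cl i * (f 0 - f (bulk i)) + rightRate cr i * (f (Fin.last (N + 1)) - f (bulk i)) := by
  simp [gen, Fintype.sum_sum_type, Fintype.sum_prod_type, walkR, walkT, bulk_injective.eq_iff,
    ite_mul, Finset.sum_ite_irrel, ← add_assoc]

theorem walkR_eq_zero {s : Fin (N + 2)} (hs : s = 0 ∨ s = Fin.last (N + 1)) (a : DualIdx N) :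
    walkR p cl cr a s = 0 := by
  rcases hs with rfl | rfl <;> rcases a with ⟨i, j⟩ | i | i <;>
    simp [walkR, (bulk_ne_zero _).symm, (bulk_ne_last _).symm]

theorem isAbsorbed_walk (hp : ∀ i j, 0 ≤ p i j) (hcl : 0 ≤ cl) (hcr : 0 ≤ cr) {d : Fin N → ℕ}
    (hd : IsRank p cl cr d) :
    IsAbsorbed (walkR p cl cr) walkT Finset.univ {0, Fin.last (N + 1)} (siteWeight d) where
  nonneg := walkR_nonneg hp hcl hcr
  mem _ _ _ := Finset.mem_univ _
  stay _ _ hs a := Or.inl (walkR_eq_zero hs a)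
  descent := by
    intro s _ hs
    rcases eq_zero_or_last_or_bulk s with h | ⟨i, rfl⟩
    · exact absurd h hs
    · rcases hd i with h | h | ⟨j, hj, hdj⟩
      · exact ⟨.inr (.inl i), by simpa [walkR] using h,
          by simp [walkT, siteWeight_zero, siteWeight_bulk]⟩
      · exact ⟨.inr (.inr i), by simpa [walkR] using h,
          by simp [walkT, siteWeight_last, siteWeight_bulk]⟩
      · exact ⟨.inl (i, j), by simpa [walkR] using hj,
          by simpa [walkT, siteWeight_bulk] using hdj⟩

/-- `w s` is the probability that the random walk started from `s` is absorbed on the right. -/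
structure IsRightProb (p : Fin N → Fin N → ℝ) (cl cr : ℝ) (w : Fin (N + 2) → ℝ) : Prop where
  zero : w 0 = 0
  last : w (Fin.last (N + 1)) = 1
  harmonic : ∀ i, ∑ j, p i j * (w (bulk j) - w (bulk i)) +
      leftRate cl i * (w 0 - w (bulk i)) + rightRate cr i * (w (Fin.last (N + 1)) - w (bulk i)) = 0

theorem occupation_eq_zero_iff {m : ℕ} {ι : Type*} [DecidableEq ι] (v : Fin m → ι) (a : ι) :
    occupation v a = 0 ↔ ∀ l, v l ≠ a := by
  rw [occupation_apply, Finset.card_eq_zero, Finset.filter_eq_empty_iff]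
  simp

open scoped Classical in
theorem irwNoLeft_eq {m : ℕ} (u : Fin m → Fin (N + 2)) (t : ℝ) :
    irwNoLeft p cl cr u t =
      ∏ l, (∑ s, if s = 0 then 0 else transProb (walkRate p cl cr) t (u l) s).toReal := by
  rw [irwNoLeft, ← ENNReal.toReal_prod]
  congr 1
  rw [Finset.prod_univ_sum, Fintype.piFinset_univ]
  refine Finset.sum_congr rfl fun v _ => ?_
  split_ifs with h
  · rw [occupation_eq_zero_iff] at h
    exact Finset.prod_congr rfl fun l _ => (if_neg (h l)).symm
  · rw [occupation_eq_zero_iff] at h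
    push Not at h
    obtain ⟨l, hl⟩ := h
    refine (Finset.prod_eq_zero (Finset.mem_univ l) ?_).symm
    exact if_pos hl

theorem exists_isRightProb (hp : ∀ i j, 0 ≤ p i j) (hcl : 0 ≤ cl) (hcr : 0 ≤ cr) {d : Fin N → ℕ}
    (hd : IsRank p cl cr d) : ∃ w, IsRightProb p cl cr w ∧
      ∀ (m : ℕ) (u : Fin m → Fin (N + 2)),
        Tendsto (irwNoLeft p cl cr u) atTop (𝓝 (∏ l, w (u l))) := by
  classical
  have habs := isAbsorbed_walk hp hcl hcr hd
  have hrep := isJumpRep_walk hp hcl hcr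
  obtain ⟨w, hw, -⟩ := habs.exists_dirichletOp_eq fun s =>
    if s ∈ ({0, Fin.last (N + 1)} : Set (Fin (N + 2))) then (if s = 0 then 0 else 1) else 0
  refine ⟨w, ⟨?_, ?_, fun i => ?_⟩, fun m u => ?_⟩
  · simpa [dirichletOp] using hw 0 (Finset.mem_univ _)
  · simpa [dirichletOp, zero_ne_last.symm] using hw (Fin.last (N + 1)) (Finset.mem_univ _)
  · have := hw (bulk i) (Finset.mem_univ _)
    simp only [dirichletOp, Set.mem_insert_iff, Set.mem_singleton_iff, bulk_ne_zero, bulk_ne_last,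
      or_self, if_false, neg_eq_zero] at this
    rwa [walkR_bulk] at this
  · refine (tendsto_finsetProd Finset.univ fun l _ =>
      habs.tendsto_sum_mul_transProb hrep (f := fun s => if s = 0 then 0 else 1)
        (fun s _ => by split_ifs <;> norm_num) (fun s hs => by convert hw s hs) (Finset.mem_univ (u l))).congr' ?_
    filter_upwards [eventually_ge_atTop 0] with t ht
    rw [irwNoLeft_eq]
    refine Finset.prod_congr rfl fun l _ => ?_
    rw [ENNReal.toReal_sum]
    · refine Finset.sum_congr rfl fun s _ => ?_
      split_ifs <;> simp
    · intro s _
      split_ifs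
      · simp
      · exact ne_top_of_le_ne_top ENNReal.one_ne_top (hrep.transProb_le_one ht _ _)

end Walk

section Absorption

variable {N : ℕ} {θ : ℝ} {p : Fin N → Fin N → ℝ} {cl cr ρl ρr : ℝ} {d : Fin N → ℕ}
  {u : (Fin (N + 2) → ℕ) → ℝ}

open scoped Classical in
/-- `u ξ` is the probability that all particles of the dual system started from `ξ` are absorbed on
the right, for every allowed `ξ`. -/
def IsAllRightProb (θ : ℝ) (p : Fin N → Fin N → ℝ) (cl cr : ℝ) (u : (Fin (N + 2) → ℕ) → ℝ) : Prop :=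
  ∀ ξ : DualConfig θ N, dirichletOp (dualR θ p cl cr) (dualT θ p cl cr) (absorbed θ N)
    (fun ξ => u ξ.1) ξ = if ξ ∈ absorbed θ N then (if ξ.1 0 = 0 then 1 else 0) else 0

theorem IsAllRightProb.eq_of_mem (hu : IsAllRightProb θ p cl cr u) (ξ : DualConfig θ N)
    (hξ : ξ ∈ absorbed θ N) : u ξ.1 = if ξ.1 0 = 0 then 1 else 0 := by
  have := hu ξ
  rwa [dirichletOp, if_pos hξ, if_pos hξ] at this

theorem dualGen_eq_zero_of_absorbed (f : (Fin (N + 2) → ℕ) → ℝ) {ξ : DualConfig θ N}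
    (hξ : ξ ∈ absorbed θ N) : dualGen θ p cl cr f ξ.1 = 0 := by
  have h : ∀ i, ξ.1 (bulk i) = 0 := hξ
  simp [dualGen, h]

theorem isAllRightProb_of (h : ReservoirParams θ p cl cr ρl ρr)
    (hb : ∀ ξ : DualConfig θ N, ξ ∈ absorbed θ N → u ξ.1 = if ξ.1 0 = 0 then 1 else 0)
    (hg : ∀ ξ : DualConfig θ N, dualGen θ p cl cr u ξ.1 = 0) : IsAllRightProb θ p cl cr u := by
  intro ξ
  rw [dirichletOp]
  split_ifs with h1 h2
  · rw [hb ξ h1, if_pos h2]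
  · rw [hb ξ h1, if_neg h2]
  · rw [gen_dual h.adm h.p_nonneg h.cl_nonneg h.cr_nonneg, hg, neg_zero]

theorem IsAllRightProb.dualGen_eq_zero (h : ReservoirParams θ p cl cr ρl ρr)
    (hu : IsAllRightProb θ p cl cr u) (ξ : DualConfig θ N) : dualGen θ p cl cr u ξ.1 = 0 := by
  by_cases hξ : ξ ∈ absorbed θ N
  · exact dualGen_eq_zero_of_absorbed u hξ
  · have := hu ξ
    rw [dirichletOp, if_neg hξ, if_neg hξ,
      gen_dual h.adm h.p_nonneg h.cl_nonneg h.cr_nonneg] at this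
    linarith

open scoped Classical in
theorem exists_isAllRightProb (h : ReservoirParams θ p cl cr ρl ρr) (hd : IsRank p cl cr d) :
    ∃ u, IsAllRightProb θ p cl cr u := by
  choose g hg _ using fun n => (h.isAbsorbed hd n).exists_dirichletOp_eq fun ξ =>
    if ξ ∈ absorbed θ N then (if ξ.1 0 = 0 then 1 else 0) else 0
  let v : DualConfig θ N → ℝ := fun ξ => g (∑ s, ξ.1 s) ξ
  refine ⟨fun ξ => if hξ : ∀ i : Fin N, AllowedOcc θ (ξ (bulk i)) then v ⟨ξ, hξ⟩ else 0,
    fun ξ => ?_⟩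
  have hv : (fun ξ : DualConfig θ N => if hξ : ∀ i : Fin N, AllowedOcc θ (ξ.1 (bulk i)) then
      v ⟨ξ.1, hξ⟩ else 0) = v := funext fun ξ => dif_pos ξ.2
  have hξ : ξ ∈ dualLevel θ N (∑ s, ξ.1 s) := mem_dualLevel.2 rfl
  refine (congrArg (fun f => dirichletOp (dualR θ p cl cr) (dualT θ p cl cr) (absorbed θ N) f ξ)
    hv).trans ?_
  rw [← hg _ ξ hξ]
  refine (h.isAbsorbed hd _).dirichletOp_congr (fun ζ hζ => ?_) hξ
  simp only [v]
  rw [mem_dualLevel.1 hζ]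

theorem IsAllRightProb.tendsto_dualNoLeft (h : ReservoirParams θ p cl cr ρl ρr)
    (hd : IsRank p cl cr d) (hu : IsAllRightProb θ p cl cr u) (ξ : DualConfig θ N) :
    Tendsto (dualNoLeft θ p cl cr ξ) atTop (𝓝 (u ξ.1)) := by
  classical
  have habs := h.isAbsorbed hd (∑ s, ξ.1 s)
  have hξ : ξ ∈ dualLevel θ N (∑ s, ξ.1 s) := mem_dualLevel.2 rfl
  refine (habs.tendsto_sum_mul_transProb h.isJumpRep_dual
    (f := fun ξ => if ξ.1 0 = 0 then 1 else 0) (u := fun ξ => u ξ.1)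
    (fun s _ => by split_ifs <;> norm_num) (fun s _ => hu s) hξ).congr' ?_
  filter_upwards [eventually_ge_atTop 0] with t ht
  have e : ∀ ξ' : DualConfig θ N, (if ξ'.1 0 = 0 then transProb (dualRate θ p cl cr) t ξ ξ' else 0) =
      (if ξ'.1 0 = 0 then 1 else 0) * transProb (dualRate θ p cl cr) t ξ ξ' := fun ξ' => by
    split_ifs <;> simp
  rw [dualNoLeft, tsum_congr e, h.isJumpRep_dual.tsum_mul_transProb_eq_sum habs.mem hξ,
    ENNReal.toReal_sum]
  · refine Finset.sum_congr rfl fun ξ' _ => ?_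
    split_ifs <;> simp
  · intro ξ' _
    refine ENNReal.mul_ne_top (by split_ifs <;> simp) ?_
    exact ne_top_of_le_ne_top ENNReal.one_ne_top (h.isJumpRep_dual.transProb_le_one ht _ _)

/-- The expansion of the stationary expectation of the duality function. -/
theorem IsAllRightProb.integral_dualityFun_eq (h : ReservoirParams θ p cl cr ρl ρr)
    (hd : IsRank p cl cr d) (hu : IsAllRightProb θ p cl cr u) {μ : Measure (Config θ N)}
    (hμ : IsStationary (resRate θ p cl cr ρl ρr) μ) {n : ℕ} {ξ : DualConfig θ N}
    (hξ : ∑ s, ξ.1 s = n) :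
    ∫ η, dualityFun θ ρl ρr ξ.1 η.1 ∂μ = ∑ κ ∈ Finset.range (n + 1),
      ((ρr - ρl) ^ κ * ρl ^ (n - κ) / (n - κ).factorial) * annihil^[n - κ] u ξ.1 := by
  classical
  refine (h.isAbsorbed hd n).eq_of_dirichletOp_eq
    (f := fun ξ => ∫ η, dualityFun θ ρl ρr ξ.1 η.1 ∂μ)
    (g := fun ξ => ∑ κ ∈ Finset.range (n + 1),
      ((ρr - ρl) ^ κ * ρl ^ (n - κ) / (n - κ).factorial) * annihil^[n - κ] u ξ.1)
    (fun ξ hξ => ?_) ξ (mem_dualLevel.2 hξ)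
  rw [h.dirichletOp_integral hd hμ, dirichletOp_sum]
  simp only [dirichletOp_const_mul]
  have hξ' := mem_dualLevel.1 hξ
  by_cases hA : ξ ∈ absorbed θ N
  · simp only [dirichletOp, if_pos hA]
    rw [sum_fin_add_two, Finset.sum_eq_zero fun i _ => hA i, add_zero] at hξ'
    set a := ξ.1 0 with ha
    set b := ξ.1 (Fin.last (N + 1)) with hb
    have hterm : ∀ κ ∈ Finset.range (n + 1),
        ((ρr - ρl) ^ κ * ρl ^ (n - κ) / (n - κ).factorial) * annihil^[n - κ] u ξ.1 =
        (ρr - ρl) ^ κ * ρl ^ (n - κ) * (b.choose κ : ℝ) := by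
      intro κ hκ
      rw [Finset.mem_range] at hκ
      rw [annihil_iterate_absorbed hu.eq_of_mem κ (n - κ) ξ hA (by rw [mem_dualLevel.1 hξ]; omega)]
      have : ((n - κ).factorial : ℝ) ≠ 0 := Nat.cast_ne_zero.2 (Nat.factorial_ne_zero _)
      field_simp
      rw [hb]
    rw [Finset.sum_congr rfl hterm, ← Finset.sum_subset (s₁ := Finset.range (b + 1))
      (Finset.range_subset_range.2 (by omega))]
    · have e : ρr ^ b = ((ρr - ρl) + ρl) ^ b := by ring
      rw [e, add_pow, Finset.mul_sum]
      refine Finset.sum_congr rfl fun κ hκ => ?_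
      rw [Finset.mem_range] at hκ
      rw [show n - κ = a + (b - κ) by omega, pow_add]
      ring
    · intro κ _ hκ
      rw [Finset.mem_range, not_lt] at hκ
      rw [Nat.choose_eq_zero_of_lt (by omega)]
      simp
  · simp only [dirichletOp, if_neg hA]
    refine (Finset.sum_eq_zero fun κ _ => ?_).symm
    rw [gen_dual h.adm h.p_nonneg h.cl_nonneg h.cr_nonneg (annihil^[n - κ] u),
      dualGen_annihil_iterate_eq_zero h.symm (hu.dualGen_eq_zero h)]
    simp

theorem sum_occupation {ι : Type*} [Fintype ι] [DecidableEq ι] {m : ℕ} (x : Fin m → ι) :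
    ∑ s, occupation x s = m := by
  simp only [occupation, Finset.sum_apply]
  rw [Finset.sum_comm]
  simp

theorem IsAllRightProb.integral_dualityFun_config (h : ReservoirParams θ p cl cr ρl ρr)
    (hd : IsRank p cl cr d) (hu : IsAllRightProb θ p cl cr u) {μ : Measure (Config θ N)}
    (hμ : IsStationary (resRate θ p cl cr ρl ρr) μ) {n : ℕ} (x : Positions θ N n) :
    ∫ η, dualityFun θ ρl ρr x.config.1 η.1 ∂μ = ∑ κ ∈ Finset.range (n + 1),
      (∑ e : Fin κ ↪o Fin n, u (occupation (x.sub e).sites)) * (ρr - ρl) ^ κ * ρl ^ (n - κ) := by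
  rw [hu.integral_dualityFun_eq h hd hμ (n := n) (ξ := x.config) (sum_occupation _)]
  refine Finset.sum_congr rfl fun κ hκ => ?_
  rw [Finset.mem_range] at hκ
  have e : x.config.1 = partialOcc x.sites Finset.univ := rfl
  rw [e, annihil_iterate_partialOcc u x.sites κ (n - κ) Finset.univ (by simp; omega),
    sum_powersetCard_univ_eq]
  have : ((n - κ).factorial : ℝ) ≠ 0 := Nat.cast_ne_zero.2 (Nat.factorial_ne_zero _)
  simp only [partialOcc_map]
  field_simp
  rfl

variable {w : Fin (N + 2) → ℝ}

/-- A single dual particle behaves as the random walk. -/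
theorem IsAllRightProb.eq_sum_of_level_one (h : ReservoirParams θ p cl cr ρl ρr)
    (hd : IsRank p cl cr d) (hu : IsAllRightProb θ p cl cr u) (hw : IsRightProb p cl cr w)
    {ξ : DualConfig θ N} (hξ : ∑ s, ξ.1 s = 1) : u ξ.1 = ∑ s, (ξ.1 s : ℝ) * w s := by
  classical
  refine (h.isAbsorbed hd 1).eq_of_dirichletOp_eq (f := fun ξ => u ξ.1)
    (g := fun ξ => ∑ s, (ξ.1 s : ℝ) * w s) (fun ξ hξ => ?_) ξ (mem_dualLevel.2 hξ)
  rw [hu ξ, dirichletOp]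
  have hξ' := mem_dualLevel.1 hξ
  by_cases hA : ξ ∈ absorbed θ N
  · have h0 : ∀ i, ξ.1 (bulk i) = 0 := hA
    rw [sum_fin_add_two, Finset.sum_eq_zero fun i _ => hA i, add_zero] at hξ'
    rw [if_pos hA, if_pos hA, sum_fin_add_two, hw.zero, hw.last]
    split_ifs with h1
    · rw [show ξ.1 (Fin.last (N + 1)) = 1 by omega]
      simp [h0]
    · rw [show ξ.1 (Fin.last (N + 1)) = 0 by omega]
      simp [h0]
  · rw [if_neg hA, if_neg hA,
      gen_dual h.adm h.p_nonneg h.cl_nonneg h.cr_nonneg fun ξ => ∑ s, (ξ s : ℝ) * w s]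
    have hmove : ∀ (i : Fin N) (j : Fin (N + 2)) (c c' : ℝ), c * (ξ.1 (bulk i) : ℝ) * c' *
        (∑ s, (move ξ.1 (bulk i) j s : ℝ) * w s - ∑ s, (ξ.1 s : ℝ) * w s) =
        c * (ξ.1 (bulk i) : ℝ) * c' * (w j - w (bulk i)) := by
      intro i j c c'
      by_cases h0 : ξ.1 (bulk i) = 0
      · simp [h0]
      · rw [← sub_eq_zero, ← mul_sub]
        have := sum_move_mul h0 j w
        exact mul_eq_zero_of_right _ (by linarith)
    have hmove1 : ∀ (i : Fin N) (j : Fin (N + 2)) (c : ℝ), c * (ξ.1 (bulk i) : ℝ) *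
        (∑ s, (move ξ.1 (bulk i) j s : ℝ) * w s - ∑ s, (ξ.1 s : ℝ) * w s) =
        c * (ξ.1 (bulk i) : ℝ) * (w j - w (bulk i)) := fun i j c => by
      simpa only [mul_one] using hmove i j c 1
    have hanti := sum_sum_eq_zero_of_antisymm p (fun i j => θ * (ξ.1 (bulk i) * ξ.1 (bulk j) *
        (w (bulk j) - w (bulk i)))) h.symm (fun i j => by ring)
    have hh := Finset.sum_eq_zero fun i (_ : i ∈ Finset.univ) =>
      mul_eq_zero_of_right (ξ.1 (bulk i) : ℝ) (hw.harmonic i)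
    simp only [dualGen, hmove, hmove1]
    rw [eq_comm, neg_eq_zero, ← hh, ← sub_eq_zero, ← hanti, ← Finset.sum_add_distrib,
      ← Finset.sum_add_distrib, ← Finset.sum_sub_distrib]
    refine Finset.sum_congr rfl fun i _ => ?_
    rw [mul_add, mul_add, Finset.mul_sum]
    have : ∀ A B C D E F : ℝ, A + C + D - (B + E + F) = A - B + (C - E) + (D - F) := by
      intros; ring
    rw [this, ← Finset.sum_sub_distrib, add_assoc]
    refine (add_eq_left.2 (by ring)).trans ?_
    exact Finset.sum_congr rfl fun j _ => by ring

/-- The function `ξ ↦ ∏ w_s ^ ξ_s`. -/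
def powProd (w : Fin (N + 2) → ℝ) (ξ : Fin (N + 2) → ℕ) : ℝ := ∏ s, w s ^ ξ s

theorem powProd_add_single (w : Fin (N + 2) → ℝ) (ξ : Fin (N + 2) → ℕ) (j : Fin (N + 2)) :
    powProd w (ξ + Pi.single j 1) = powProd w ξ * w j := by
  simp only [powProd, Pi.add_apply, pow_add, Finset.prod_mul_distrib]
  congr 1
  rw [Finset.prod_eq_single j (fun s _ hs => by simp [hs]) (by simp)]
  simp

theorem powProd_occupation (w : Fin (N + 2) → ℝ) {m : ℕ} (x : Fin m → Fin (N + 2)) :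
    powProd w (occupation x) = ∏ l, w (x l) := by
  have : ∀ J : Finset (Fin m), powProd w (∑ l ∈ J, Pi.single (x l) 1) = ∏ l ∈ J, w (x l) := by
    intro J
    induction J using Finset.cons_induction with
    | empty => simp [powProd]
    | cons a J ha ih =>
      rw [Finset.sum_cons, Finset.prod_cons, add_comm, powProd_add_single, ih, mul_comm]
  exact this Finset.univ

/-- Independent particles are all absorbed on the right with the product of the probabilities. -/
theorem isAllRightProb_powProd (h : ReservoirParams 0 p cl cr ρl ρr) (hw : IsRightProb p cl cr w) :
    IsAllRightProb 0 p cl cr (powProd w) := by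
  refine isAllRightProb_of h (fun ξ hξ => ?_) fun ξ => ?_
  · have h0 : ∀ i, ξ.1 (bulk i) = 0 := hξ
    rw [powProd, Fin.prod_univ_castSucc, Fin.prod_univ_succ, hw.last,
      Finset.prod_eq_one fun i _ => by rw [show ξ.1 (Fin.succ i).castSucc = 0 from h0 i, pow_zero]]
    simp [hw.zero, zero_pow_eq]
  · have hmove : ∀ (i : Fin N) (j : Fin (N + 2)) (c : ℝ), c * (ξ.1 (bulk i) : ℝ) *
        (powProd w (move ξ.1 (bulk i) j) - powProd w ξ.1) =
        (ξ.1 (bulk i) : ℝ) * powProd w (ξ.1 - Pi.single (bulk i) 1) * (c * (w j - w (bulk i))) := by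
      intro i j c
      by_cases h0 : ξ.1 (bulk i) = 0
      · simp [h0]
      · have h1 := powProd_add_single w (ξ.1 - Pi.single (bulk i) 1) (bulk i)
        have h2 : ξ.1 - Pi.single (bulk i) 1 + Pi.single (bulk i) 1 = ξ.1 := move_self_of_ne_zero h0
        rw [h2] at h1
        rw [move, powProd_add_single, h1]
        ring
    have hh := Finset.sum_eq_zero fun i (_ : i ∈ Finset.univ) =>
      mul_eq_zero_of_right ((ξ.1 (bulk i) : ℝ) * powProd w (ξ.1 - Pi.single (bulk i) 1))
        (hw.harmonic i)
    simp only [dualGen, zero_mul, add_zero, mul_one, hmove]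
    rw [← Finset.sum_add_distrib, ← Finset.sum_add_distrib]
    refine Eq.trans ?_ hh
    refine Finset.sum_congr rfl fun i _ => ?_
    rw [mul_add, mul_add, Finset.mul_sum]

end Absorption

theorem sum_range_succ_eq_sum_Icc {n : ℕ} (f : ℕ → ℝ) (h0 : f 0 = 0) (h1 : f 1 = 0) :
    ∑ κ ∈ Finset.range (n + 1), f κ = ∑ κ ∈ Finset.Icc 2 n, f κ := by
  symm
  refine Finset.sum_subset (fun κ hκ => ?_) fun κ hκ hκ' => ?_
  · rw [Finset.mem_Icc] at hκ
    rw [Finset.mem_range]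
    omega
  · rw [Finset.mem_range] at hκ
    rw [Finset.mem_Icc] at hκ'
    have : κ = 0 ∨ κ = 1 := by omega
    rcases this with rfl | rfl
    exacts [h0, h1]

theorem occupation_fin_zero {ι : Type*} [DecidableEq ι] (x : Fin 0 → ι) : occupation x = 0 := by
  simp [occupation]

theorem occupation_fin_one {ι : Type*} [DecidableEq ι] (x : Fin 1 → ι) :
    occupation x = Pi.single (x 0) 1 := by
  simp [occupation]

end ReservoirChain

end

theorem theorem7p1 {N : ℕ} (θ : ℝ) (hθ : AdmissibleTheta θ)
    (p : Fin N → Fin N → ℝ) (hp : ∀ i j, 0 ≤ p i j) (hsymm : ∀ i j, p i j = p j i)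
    (cl cr ρl ρr : ℝ) (hcl : 0 ≤ cl) (hcr : 0 ≤ cr) (hρl : 0 ≤ ρl) (hρr : 0 ≤ ρr)
    (hθl : 0 ≤ 1 + θ * ρl) (hθr : 0 ≤ 1 + θ * ρr)
    (μθ : MeasureTheory.Measure (Config θ N))
    (hμθ : IsUniqueStationary (resRate θ p cl cr ρl ρr) μθ)
    (μ0 : MeasureTheory.Measure (Config 0 N))
    (hμ0 : IsUniqueStationary (resRate 0 p cl cr ρl ρr) μ0)
    (n : ℕ) (hn : 2 ≤ n) (x : Positions θ N n) :
    -- the limits that define the absorption probabilities exist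
    (∀ (κ : ℕ) (e : Fin κ ↪o Fin n),
      Filter.Tendsto (dualNoLeft θ p cl cr (x.sub e).config) Filter.atTop
        (nhds (dualNoLeftLimit θ p cl cr (x.sub e).config)) ∧
      Filter.Tendsto (irwNoLeft p cl cr (x.sub e).sites) Filter.atTop
        (nhds (irwNoLeftLimit p cl cr (x.sub e).sites))) ∧
    -- the two stationary expectations exist
    MeasureTheory.Integrable (fun η => dualityFun θ ρl ρr x.config.1 η.1) μθ ∧
    MeasureTheory.Integrable (fun η => dualityFun 0 ρl ρr x.config.1 η.1) μ0 ∧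
    ∫ η, dualityFun θ ρl ρr x.config.1 η.1 ∂μθ - ∫ η, dualityFun 0 ρl ρr x.config.1 η.1 ∂μ0 =
      ∑ κ ∈ Finset.Icc 2 n, gammaCoeff p cl cr κ x * (ρr - ρl) ^ κ * ρl ^ (n - κ) := by
  have hpar : ReservoirParams θ p cl cr ρl ρr := ⟨hθ, hp, hsymm, hcl, hcr, hρl, hρr, hθl, hθr⟩
  have hpar0 : ReservoirParams 0 p cl cr ρl ρr :=
    ⟨Or.inl le_rfl, hp, hsymm, hcl, hcr, hρl, hρr, by simp, by simp⟩
  obtain ⟨d, hd⟩ := hpar0.exists_rank hμ0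
  obtain ⟨u, hu⟩ := exists_isAllRightProb hpar hd
  obtain ⟨w, hw, hwlim⟩ := exists_isRightProb hp hcl hcr hd
  have hu0 := isAllRightProb_powProd hpar0 hw
  let x0 : Positions 0 N n := ⟨x.1, fun _ => allowedOcc_of_nonneg le_rfl _⟩
  have hdual := fun (κ : ℕ) (e : Fin κ ↪o Fin n) => hu.tendsto_dualNoLeft hpar hd (x.sub e).config
  have hirw := fun (κ : ℕ) (e : Fin κ ↪o Fin n) => hwlim κ (x.sub e).sites
  refine ⟨fun κ e => ⟨tendsto_nhds_limUnder ⟨_, hdual κ e⟩, tendsto_nhds_limUnder ⟨_, hirw κ e⟩⟩,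
    hpar.integrable_dualityFun hd hμθ.1 x.config, hpar0.integrable_dualityFun hd hμ0.1 x0.config, ?_⟩
  have hγ : ∀ κ, gammaCoeff p cl cr κ x = ∑ e : Fin κ ↪o Fin n,
      (u (occupation (x.sub e).sites) - powProd w (occupation (x.sub e).sites)) := by
    intro κ
    refine Finset.sum_congr rfl fun e _ => ?_
    rw [dualNoLeftLimit, irwNoLeftLimit, (hdual κ e).limUnder_eq, (hirw κ e).limUnder_eq,
      powProd_occupation]
    rfl
  have hγ0 : gammaCoeff p cl cr 0 x = 0 := by
    rw [hγ]
    refine Finset.sum_eq_zero fun e _ => ?_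
    have h1 := hu.eq_of_mem (x.sub e).config fun i => by
      simp [Positions.config, occupation_fin_zero]
    have h2 : (x.sub e).config.1 = occupation (x.sub e).sites := rfl
    rw [h2] at h1
    rw [h1, powProd_occupation]
    simp [occupation_fin_zero]
  have hγ1 : gammaCoeff p cl cr 1 x = 0 := by
    rw [hγ]
    refine Finset.sum_eq_zero fun e _ => ?_
    have h1 := hu.eq_sum_of_level_one hpar hd hw (ξ := (x.sub e).config) (sum_occupation _)
    have h2 : (x.sub e).config.1 = occupation (x.sub e).sites := rfl
    rw [h2] at h1
    rw [h1, powProd_occupation]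
    simp [occupation_fin_one, Pi.single_apply]
  have hint := hu.integral_dualityFun_config hpar hd hμθ.1 x
  have hint0 : ∫ η, dualityFun 0 ρl ρr x.config.1 η.1 ∂μ0 = ∑ κ ∈ Finset.range (n + 1),
      (∑ e : Fin κ ↪o Fin n, powProd w (occupation (x.sub e).sites)) *
        (ρr - ρl) ^ κ * ρl ^ (n - κ) :=
    hu0.integral_dualityFun_config hpar0 hd hμ0.1 x0
  rw [← sum_range_succ_eq_sum_Icc _ (by rw [hγ0]; ring) (by rw [hγ1]; ring), hint, hint0,
    ← Finset.sum_sub_distrib]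
  refine Finset.sum_congr rfl fun κ _ => ?_
  rw [hγ, Finset.sum_sub_distrib]
  ring
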